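/- **Setting.** A word-length function on a group $G$ is $L:G\to[0,\infty)$ with $L(1)=0$, $L(g^{-1})=L(g)$, $L(gh)\le L(g)+L(h)$. On $\ell^2(G)$ let $D_L\delta_g=L(g)\delta_g$, let $\partial_L(M)=D_LM-MD_L$, and for $a\in\mathbb C[G]$, acting by the left regular representation $\lambda$, let $\eta_m(a)=\sum_{i=0}^m\binom mi\|\partial_L^i(a)\|$. The $\eta_m$ are submultiplicative. The Connes–Moscovici algebra $H^{CM}_L(G)$ is the Fréchet algebra completion of $\mathbb C[G]$ in the seminorms $\{\eta_m\}_{m\ge0}$. Let $(\Gamma_\cdot^+,L_\cdot^+)$ be an augmented simplicial group with word-length: a functor $\Gamma:(\Delta^+)^{op}\to(\text{groups})$ with a word-length function $L_n$ on each $\Gamma_n$, $n\ge-1$. Let $S_m$ be the set of all seminorms $\eta_{n,j}\circ\Gamma(f)$ on $\mathbb C[\Gamma_m]$, where $f$ runs over the morphisms $[m]\to[n]$ of $(\Delta^+)^{op}$, $n\ge -1$, $j\ge0$, and $\eta_{n,j}$ is the seminorm $\eta_j$ of $(\Gamma_n,L_n)$. Let $H^{CM}_{L_\cdot}(\Gamma_\cdot^+)_m$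 be the completion of $\mathbb C[\Gamma_m]$ in the seminorms $S_m$. A map of sets $f$ between groups with word-length is p-bounded if $L'(f(g))\le p(L(g))$ for a polynomial $p$. Let $\varepsilon_n:\Gamma_n\to\Gamma_{-1}$ be the augmentation and $\Gamma(\varepsilon)_n=\ker\varepsilon_n$. Then $(\Gamma_\cdot^+,L_\cdot^+)$ is a *type P resolution* if * all face and degeneracy maps and $\varepsilon=\varepsilon_0$ are p-bounded, and $\varepsilon$ has a p-bounded set-theoretic section (this holds, for instance, when $\varepsilon$ is onto and $L_{-1}(x)=\min\{L_0(g):\varepsilon(g)=x\}$); * for $n\ge0$, $\Gamma_n$ is a countably generated free group and $L_n$ is the word-length metric induced by a proper function from a set of free generators to the positive integers; * the simplicial set $\Gamma(\varepsilon)_\cdot$ admits a simplicial contraction, p-bounded in each degree: p-bounded maps $s'_{n+1}:\Gamma(\varepsilon)_n\to\Gamma(\varepsilon)_{n+1}$, $n\ge 0$, with $\partial_{n+1}s'_{n+1}=\mathrm{id}$, $\partial_is'_{n+1}=s'_n\partial_i$ for $n\ge1$, $0\le i\le n$, and $\partial_0s'_1$ constant. For a locally convex algebra $A$, $CH^t_*(A)$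 is the Hochschild complex with $CH^t_k(A)=A^{\hat\otimes(k+1)}$ (projectively completed tensor powers), $CC^t_*(A)$ is the total complex of the cyclic bicomplex ($CC^t_n(A)=\bigoplus_{q\le n}A^{\hat\otimes(q+1)}$), and $CH_t^*(A)$, $CC_t^*(A)$ are their continuous duals. An augmented simplicial chain complex is *of resolution type* if in each chain degree the augmented simplicial abelian group is a resolution (the augmentation is onto, and its kernel has vanishing homotopy groups); dually, a coaugmented cosimplicial cochain complex is of resolution type if in each cochain degree the coaugmented cochain complex with differential the alternating sum of the cofaces is exact. **Theorem.** 1. The structure maps of $\mathbb C[\Gamma_\cdot^+]$ extend by continuity and make $H^{CM}_{L_\cdot}(\Gamma_\cdot^+)$ an augmented simplicial Fréchet algebra (each degree is complete, Hausdorff, and topologized by countably many submultiplicative seminorms; the structure maps are continuous homomorphisms). In degree $-1$ it is the Connes–Moscovici algebra $H^{CM}_{L_{-1}}(\Gamma_{-1})$. Moreover, for $\pi=\Gamma_{-1}$ and $L=L_{-1}$, $\lambda$ extends to an injective homomorphism $H^{CM}_L(\pi)\to\mathcal L(\ell^2(\pi))$ whose image is the closure of $\mathbb C[\pi]$, in the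 seminorms $\eta_m$, in $\{a\in C^*_r(\pi): \partial_L^k(a)\text{ is bounded for all }k\}$, and under which the topology is given by the seminorms $\eta_m$. 2. If $(\Gamma_\cdot^+,L_\cdot^+)$ is a type P resolution, then $\{[n]\mapsto CH^t_*(H^{CM}_{L_\cdot}(\Gamma_\cdot^+)_n)\}_{n\ge-1}$ and $\{[n]\mapsto CC^t_*(H^{CM}_{L_\cdot}(\Gamma_\cdot^+)_n)\}_{n\ge-1}$ are augmented simplicial chain complexes of resolution type, and $\{[n]\mapsto CH_t^*(H^{CM}_{L_\cdot}(\Gamma_\cdot^+)_n)\}_{n\ge-1}$ and $\{[n]\mapsto CC_t^*(H^{CM}_{L_\cdot}(\Gamma_\cdot^+)_n)\}_{n\ge-1}$ are coaugmented cosimplicial cochain complexes of resolution type. -/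

import Mathlib

universe u v w

open CategoryTheory

namespace CMRes

noncomputable section

/-! ### Word-length functions and the Connes-Moscovici seminorms -/

/-- A word-length function on a group. -/
structure WordLength (G : Type u) [Group G] where
  toFun : G → ℝ
  nonneg : ∀ g, 0 ≤ toFun g
  one : toFun 1 = 0
  inv : ∀ g, toFun g⁻¹ = toFun g
  mul_le : ∀ g h, toFun (g * h) ≤ toFun g + toFun h

instance {G : Type u} [Group G] : CoeFun (WordLength G) (fun _ => G → ℝ) := ⟨WordLength.toFun⟩

/-- The Hilbert space of square-summable functions on `G`. -/
abbrev Ell2 (G : Type u) : Type u := lp (fun _ : G => ℂ) 2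

/-- Bounded operators on `ℓ²(G)`. -/
abbrev Bdd (G : Type u) : Type u := Ell2 G →L[ℂ] Ell2 G

section Operators

variable {G : Type u} [Group G]

theorem sum_weighted_translate_le (g : G) (w : G → ℂ) (C : ℝ) (hw : ∀ x, ‖w x‖ ≤ C)
    (ξ : Ell2 G) (s : Finset G) :
    ∑ x ∈ s, ‖w x * ξ (g⁻¹ * x)‖ ^ (2 : ENNReal).toReal ≤ (C * ‖ξ‖) ^ (2 : ENNReal).toReal := by
  classical
  have hC : 0 ≤ C := (norm_nonneg _).trans (hw 1)
  have h2 : (2 : ENNReal).toReal = 2 := by norm_num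
  have key := lp.sum_rpow_le_norm_rpow (p := 2) (by norm_num) ξ (s.image (fun x => g⁻¹ * x))
  rw [Finset.sum_image (fun a _ b _ h => mul_left_cancel h)] at key
  rw [Real.mul_rpow hC (norm_nonneg _)]
  refine le_trans ?_ (mul_le_mul_of_nonneg_left key (Real.rpow_nonneg hC _))
  rw [Finset.mul_sum]
  refine Finset.sum_le_sum fun x _ => ?_
  rw [norm_mul, Real.mul_rpow (norm_nonneg _) (norm_nonneg _)]
  exact mul_le_mul_of_nonneg_right
    (Real.rpow_le_rpow (norm_nonneg _) (hw x) (by norm_num)) (Real.rpow_nonneg (norm_nonneg _) _)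

/-- The bounded operator `ξ ↦ (x ↦ w x * ξ (g⁻¹ x))` on `ℓ²(G)`, for a bounded weight `w`. -/
def weightedTranslate (g : G) (w : G → ℂ) (C : ℝ) (hw : ∀ x, ‖w x‖ ≤ C) : Bdd G :=
  LinearMap.mkContinuous
    { toFun := fun ξ => (⟨fun x => w x * ξ (g⁻¹ * x),
        memℓp_gen' (sum_weighted_translate_le g w C hw ξ)⟩ : lp (fun _ : G => ℂ) 2)
      map_add' := fun ξ η => by
        ext x
        exact mul_add _ _ _
      map_smul' := fun c ξ => by
        ext x
        exact mul_left_comm _ _ _ }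
    C (fun ξ => lp.norm_le_of_forall_sum_le (by norm_num)
      (mul_nonneg ((norm_nonneg _).trans (hw 1)) (norm_nonneg _))
      (sum_weighted_translate_le g w C hw ξ))

theorem weightedTranslate_apply (g : G) (w : G → ℂ) (C : ℝ) (hw : ∀ x, ‖w x‖ ≤ C)
    (ξ : Ell2 G) (x : G) : weightedTranslate g w C hw ξ x = w x * ξ (g⁻¹ * x) := rfl

theorem WordLength.norm_sub_pow_le (L : WordLength G) (g : G) (i : ℕ) (x : G) :
    ‖(((L x - L (g⁻¹ * x) : ℝ) : ℂ)) ^ i‖ ≤ L g ^ i := by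
  rw [norm_pow, Complex.norm_real, Real.norm_eq_abs]
  refine pow_le_pow_left₀ (abs_nonneg _) (abs_sub_le_iff.2 ⟨?_, ?_⟩) i
  · have := L.mul_le g (g⁻¹ * x)
    rw [mul_inv_cancel_left] at this
    linarith
  · have := L.mul_le g⁻¹ x
    rw [L.inv] at this
    linarith

/-- The operator `∂_L^i (λ_g)`, where `λ` is the left regular representation:
`δ_h ↦ (L (g h) - L h)^i δ_{g h}`. -/
def unitDeriv (L : WordLength G) (i : ℕ) (g : G) : Bdd G :=
  weightedTranslate g (fun x => ((L x - L (g⁻¹ * x) : ℝ) : ℂ) ^ i) (L g ^ i)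
    (L.norm_sub_pow_le g i)

theorem unitDeriv_apply (L : WordLength G) (i : ℕ) (g : G) (ξ : Ell2 G) (x : G) :
    unitDeriv L i g ξ x = ((L x - L (g⁻¹ * x) : ℝ) : ℂ) ^ i * ξ (g⁻¹ * x) := rfl

theorem coe_sum_apply {H : Type u} {ι : Type*} (s : Finset ι) (f : ι → Bdd H) (ξ : Ell2 H) (x : H) :
    ((∑ i ∈ s, f i) ξ : Ell2 H) x = ∑ i ∈ s, (f i ξ : Ell2 H) x := by
  rw [sum_apply, lp.coeFn_sum, Finset.sum_apply]

theorem unitDeriv_mul (L : WordLength G) (i : ℕ) (g h : G) :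
    unitDeriv L i (g * h) = ∑ j ∈ Finset.range (i + 1),
      (i.choose j : ℂ) • (unitDeriv L j g * unitDeriv L (i - j) h) := by
  refine ContinuousLinearMap.ext fun ξ => ?_
  refine lp.ext (funext fun x => ?_)
  rw [coe_sum_apply]
  have : ∀ j, (((i.choose j : ℂ) • (unitDeriv L j g * unitDeriv L (i - j) h)) ξ : Ell2 G) x =
      (((L x - L (g⁻¹ * x) : ℝ) : ℂ) ^ j * ((L (g⁻¹ * x) - L (h⁻¹ * (g⁻¹ * x)) : ℝ) : ℂ) ^ (i - j)
        * (i.choose j : ℂ)) * ξ (h⁻¹ * (g⁻¹ * x)) := by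
    intro j
    change (i.choose j : ℂ) * (((L x - L (g⁻¹ * x) : ℝ) : ℂ) ^ j *
      (((L (g⁻¹ * x) - L (h⁻¹ * (g⁻¹ * x)) : ℝ) : ℂ) ^ (i - j) * ξ (h⁻¹ * (g⁻¹ * x)))) = _
    ring
  rw [Finset.sum_congr rfl fun j _ => this j, ← Finset.sum_mul, ← add_pow, unitDeriv_apply]
  rw [mul_inv_rev, mul_assoc, ← Complex.ofReal_add, sub_add_sub_cancel]

/-- `∂_L^i (λ(a))` for `a` in the group algebra, as a bounded operator on `ℓ²(G)`. -/
def derivOp (L : WordLength G) (i : ℕ) : MonoidAlgebra ℂ G →ₗ[ℂ] Bdd G :=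
  (Finsupp.linearCombination ℂ (unitDeriv L i)).comp
    (MonoidAlgebra.coeffLinearEquiv ℂ).toLinearMap

theorem derivOp_single (L : WordLength G) (i : ℕ) (g : G) (c : ℂ) :
    derivOp L i (MonoidAlgebra.single g c) = c • unitDeriv L i g := by
  simp [derivOp, Finsupp.linearCombination_single]

/-- The Leibniz rule for the iterates of `∂_L`. -/
theorem derivOp_mul (L : WordLength G) (i : ℕ) (a b : MonoidAlgebra ℂ G) :
    derivOp L i (a * b) = ∑ j ∈ Finset.range (i + 1),
      (i.choose j : ℂ) • (derivOp L j a * derivOp L (i - j) b) := by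
  induction a using MonoidAlgebra.induction_linear with
  | zero => simp
  | add a a' ha ha' =>
    simp only [add_mul, map_add, ha, ha', smul_add, Finset.sum_add_distrib]
  | single g c =>
    induction b using MonoidAlgebra.induction_linear with
    | zero => simp
    | add b b' hb hb' =>
      simp only [mul_add, map_add, hb, hb', smul_add, Finset.sum_add_distrib]
    | single h d =>
      simp only [MonoidAlgebra.single_mul_single, derivOp_single, unitDeriv_mul, Finset.smul_sum]
      refine Finset.sum_congr rfl fun j _ => ?_
      rw [smul_mul_smul_comm, smul_comm]

/-- The left regular representation of the group algebra on `ℓ²(G)`. -/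
def leftReg (G : Type u) [Group G] : MonoidAlgebra ℂ G →ₐ[ℂ] Bdd G :=
  MonoidAlgebra.lift ℂ (Bdd G) G
    { toFun := fun g => weightedTranslate g (fun _ => 1) 1 (fun _ => by simp)
      map_one' := by
        refine ContinuousLinearMap.ext fun ξ => lp.ext (funext fun x => ?_)
        rw [weightedTranslate_apply]
        simp
      map_mul' := fun g h => by
        refine ContinuousLinearMap.ext fun ξ => lp.ext (funext fun x => ?_)
        rw [weightedTranslate_apply]
        change _ = (1 : ℂ) * ((1 : ℂ) * ξ (h⁻¹ * (g⁻¹ * x)))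
        simp [mul_assoc] }

theorem derivOp_zero (L : WordLength G) (a : MonoidAlgebra ℂ G) :
    derivOp L 0 a = leftReg G a := by
  induction a using MonoidAlgebra.induction_linear with
  | zero => simp
  | add a a' ha ha' => simp only [map_add, ha, ha']
  | single g c =>
    rw [derivOp_single, leftReg, MonoidAlgebra.lift_single]
    congr 1

open Classical in
/-- `S = ∂_L(T) = D_L ∘ T - T ∘ D_L`, where `D_L δ_y = L(y) δ_y`: the matrix coefficients of the
bounded operator `S` are those of the commutator, evaluated on the basis vectors `δ_y`. -/
def IsDeriv (L : WordLength G) (T S : Bdd G) : Prop :=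
  ∀ x y : G, (S (lp.single 2 y (1 : ℂ)) : Ell2 G) x =
    (L x : ℂ) * (T (lp.single 2 y (1 : ℂ)) : Ell2 G) x
      - (T ((L y : ℂ) • lp.single 2 y (1 : ℂ)) : Ell2 G) x

/-- `S i = ∂_L^i(T)` is bounded for all `i`. -/
def IsDerivSeq (L : WordLength G) (T : Bdd G) (S : ℕ → Bdd G) : Prop :=
  S 0 = T ∧ ∀ i, IsDeriv L (S i) (S (i + 1))

theorem isDerivSeq_derivOp (L : WordLength G) (a : MonoidAlgebra ℂ G) :
    IsDerivSeq L (leftReg G a) (fun i => derivOp L i a) := by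
  classical
  refine ⟨derivOp_zero L a, fun i x y => ?_⟩
  induction a using MonoidAlgebra.induction_linear with
  | zero =>
    have h0 : ∀ j, derivOp L j 0 = 0 := fun j => map_zero _
    change (derivOp L (i + 1) 0 (lp.single 2 y (1 : ℂ)) : Ell2 G) x =
      (L x : ℂ) * (derivOp L i 0 (lp.single 2 y (1 : ℂ)) : Ell2 G) x
        - (derivOp L i 0 ((L y : ℂ) • lp.single 2 y (1 : ℂ)) : Ell2 G) x
    rw [h0, h0]
    change (0 : ℂ) = _ * (0 : ℂ) - 0
    simp
  | add a a' ha ha' =>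
    simp only [map_add, add_apply, lp.coeFn_add, Pi.add_apply] at ha ha' ⊢
    rw [ha, ha']
    ring
  | single g c =>
    simp only [derivOp_single]
    set δ : Ell2 G := lp.single 2 y (1 : ℂ) with hδ
    change c * (((L x - L (g⁻¹ * x) : ℝ) : ℂ) ^ (i + 1) * δ (g⁻¹ * x)) =
      (L x : ℂ) * (c * (((L x - L (g⁻¹ * x) : ℝ) : ℂ) ^ i * δ (g⁻¹ * x))) -
      c * (((L x - L (g⁻¹ * x) : ℝ) : ℂ) ^ i * ((L y : ℂ) * δ (g⁻¹ * x)))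
    by_cases h : g⁻¹ * x = y
    · rw [h]
      push_cast
      ring
    · have h0 : δ (g⁻¹ * x) = 0 := lp.single_apply_ne (E := fun _ : G => ℂ) 2 y 1 h
      rw [h0]
      ring

/-- The seminorm `η_m(S) = ∑ i ≤ m, (m choose i) ‖∂^i‖` evaluated on a sequence of derivatives. -/
def etaSeq (m : ℕ) (S : ℕ → Bdd G) : ℝ :=
  ∑ i ∈ Finset.range (m + 1), (m.choose i : ℝ) * ‖S i‖

/-- The set of `T` in the reduced group C*-algebra (the norm closure of the group algebra acting on
`ℓ²(G)` by the left regular representation) such that all `∂_L^i(T)` are bounded. -/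
def cmSet (L : WordLength G) : Set (Bdd G) :=
  {T | T ∈ closure (Set.range (leftReg G)) ∧ ∃ S, IsDerivSeq L T S}

/-- The seminorm `η_m(a) = ∑ i ≤ m, (m choose i) ‖∂_L^i(a)‖` on the group algebra. -/
def eta (L : WordLength G) (m : ℕ) : Seminorm ℂ (MonoidAlgebra ℂ G) :=
  Seminorm.of (fun a => etaSeq m (fun i => derivOp L i a))
    (fun a b => by
      simp only [etaSeq, map_add, ← Finset.sum_add_distrib, ← mul_add]
      exact Finset.sum_le_sum fun i _ =>
        mul_le_mul_of_nonneg_left (norm_add_le _ _) (Nat.cast_nonneg _))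
    (fun c a => by
      simp only [etaSeq, map_smul, norm_smul, Finset.mul_sum]
      exact Finset.sum_congr rfl fun i _ => mul_left_comm _ _ _)

theorem eta_apply (L : WordLength G) (m : ℕ) (a : MonoidAlgebra ℂ G) :
    eta L m a = ∑ i ∈ Finset.range (m + 1), (m.choose i : ℝ) * ‖derivOp L i a‖ := rfl

theorem choose_mul_choose_le (m j l : ℕ) :
    m.choose (j + l) * (j + l).choose j ≤ m.choose j * m.choose l := by
  by_cases h : j + l ≤ m
  · rw [Nat.choose_mul (Nat.le_add_right _ _), Nat.add_sub_cancel_left]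
    exact Nat.mul_le_mul_left _ (Nat.choose_le_choose _ (Nat.sub_le _ _))
  · rw [Nat.choose_eq_zero_of_lt (not_le.1 h), zero_mul]
    exact Nat.zero_le _

theorem eta_mul_le (L : WordLength G) (m : ℕ) (a b : MonoidAlgebra ℂ G) :
    eta L m (a * b) ≤ eta L m a * eta L m b := by
  have h1 : ∀ i, ‖derivOp L i (a * b)‖ ≤ ∑ p ∈ Finset.HasAntidiagonal.antidiagonal i,
      ((p.1 + p.2).choose p.1 : ℝ) * (‖derivOp L p.1 a‖ * ‖derivOp L p.2 b‖) := by
    intro i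
    rw [derivOp_mul, Finset.Nat.sum_antidiagonal_eq_sum_range_succ_mk]
    refine (norm_sum_le _ _).trans (Finset.sum_le_sum fun j hj => ?_)
    have hj' : j + (i - j) = i := Nat.add_sub_cancel' (Nat.lt_succ_iff.1 (Finset.mem_range.1 hj))
    simp only [hj']
    rw [norm_smul]
    refine mul_le_mul (by simp) (norm_mul_le _ _) (norm_nonneg _) (Nat.cast_nonneg _)
  have h2 : ∀ i, (m.choose i : ℝ) * ‖derivOp L i (a * b)‖ ≤ ∑ p ∈ Finset.HasAntidiagonal.antidiagonal i,
      (m.choose p.1 * ‖derivOp L p.1 a‖) * (m.choose p.2 * ‖derivOp L p.2 b‖) := by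
    intro i
    refine (mul_le_mul_of_nonneg_left (h1 i) (Nat.cast_nonneg _)).trans ?_
    rw [Finset.mul_sum]
    refine Finset.sum_le_sum fun p hp => ?_
    have hp' := Finset.HasAntidiagonal.mem_antidiagonal.1 hp
    have := choose_mul_choose_le m p.1 p.2
    have h3 : (m.choose i : ℝ) * ((p.1 + p.2).choose p.1 : ℝ) ≤ m.choose p.1 * m.choose p.2 := by
      rw [← hp']
      exact_mod_cast this
    calc _ = ((m.choose i : ℝ) * ((p.1 + p.2).choose p.1 : ℝ)) *
          (‖derivOp L p.1 a‖ * ‖derivOp L p.2 b‖) := by ring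
      _ ≤ (m.choose p.1 * m.choose p.2) * (‖derivOp L p.1 a‖ * ‖derivOp L p.2 b‖) :=
          mul_le_mul_of_nonneg_right h3 (by positivity)
      _ = _ := by ring
  rw [eta_apply, eta_apply, eta_apply, Finset.sum_mul_sum, ← Finset.sum_product']
  refine (Finset.sum_le_sum fun i _ => h2 i).trans ?_
  rw [← Finset.sum_biUnion]
  · refine Finset.sum_le_sum_of_subset_of_nonneg ?_ fun p _ _ => by positivity
    intro p hp
    simp only [Finset.mem_biUnion, Finset.HasAntidiagonal.mem_antidiagonal, Finset.mem_product,
      Finset.mem_range] at hp ⊢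
    obtain ⟨i, hi, hpi⟩ := hp
    omega
  · intro i _ j _ hij
    rw [Function.onFun, Finset.disjoint_left]
    intro p hp hp'
    exact hij ((Finset.HasAntidiagonal.mem_antidiagonal.1 hp).symm.trans (Finset.HasAntidiagonal.mem_antidiagonal.1 hp'))

end Operators

/-! ### Completions of algebras in families of submultiplicative seminorms -/

/-- A family of submultiplicative seminorms on a complex algebra. -/
structure SubmulFamily (A : Type u) [Ring A] [Algebra ℂ A] (ι : Type v) where
  toFamily : SeminormFamily ℂ A ι
  mul_le : ∀ i a b, toFamily i (a * b) ≤ toFamily i a * toFamily i b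

/-- The algebra `A` with the topology defined by the family of seminorms `S`. -/
def WithFamily {A : Type u} [Ring A] [Algebra ℂ A] {ι : Type v} (_S : SubmulFamily A ι) : Type u :=
  A

section WithFamily

variable {A : Type u} [Ring A] [Algebra ℂ A] {ι : Type v} (S : SubmulFamily A ι)

instance : Ring (WithFamily S) := inferInstanceAs (Ring A)

instance : Algebra ℂ (WithFamily S) := inferInstanceAs (Algebra ℂ A)

/-- The family of seminorms, on the topologized copy of the algebra. -/
def WithFamily.seminorms : SeminormFamily ℂ (WithFamily S) ι := S.toFamily

instance : TopologicalSpace (WithFamily S) := (WithFamily.seminorms S).moduleFilterBasis.topology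

theorem withSeminorms_withFamily : WithSeminorms (WithFamily.seminorms S) := ⟨rfl⟩

instance : IsTopologicalAddGroup (WithFamily S) := (withSeminorms_withFamily S).topologicalAddGroup

instance : ContinuousSMul ℂ (WithFamily S) := (withSeminorms_withFamily S).continuousSMul

instance : UniformSpace (WithFamily S) := IsTopologicalAddGroup.rightUniformSpace (WithFamily S)

instance : IsUniformAddGroup (WithFamily S) := isUniformAddGroup_of_addCommGroup

instance : UniformContinuousConstSMul ℂ (WithFamily S) :=
  uniformContinuousConstSMul_of_continuousConstSMul ℂ (WithFamily S)

open Filter Topology in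
instance : IsTopologicalRing (WithFamily S) := by
  have hS := withSeminorms_withFamily S
  have hcont : ∀ i, Tendsto (WithFamily.seminorms S i) (𝓝 0) (𝓝 0) := fun i => by
    have := (hS.continuous_seminorm i).tendsto 0
    rwa [map_zero] at this
  have hmul : ∀ i (a b : WithFamily S), WithFamily.seminorms S i (a * b) ≤
      WithFamily.seminorms S i a * WithFamily.seminorms S i b := S.mul_le
  refine IsTopologicalRing.of_addGroup_of_nhds_zero ?_ (fun a => ?_) (fun a => ?_)
  · refine (hS.tendsto_nhds _ _).2 fun i ε hε => ?_
    have h := ((hcont i).comp tendsto_fst).mul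
      ((hcont i).comp (tendsto_snd (f := 𝓝 (0 : WithFamily S))))
    rw [mul_zero] at h
    filter_upwards [h.eventually_lt_const hε] with x hx
    rw [sub_zero]
    exact (hmul i x.1 x.2).trans_lt hx
  · refine (hS.tendsto_nhds _ _).2 fun i ε hε => ?_
    have h := (hcont i).const_mul (WithFamily.seminorms S i a)
    rw [mul_zero] at h
    filter_upwards [h.eventually_lt_const hε] with x hx
    rw [sub_zero]
    exact (hmul i a x).trans_lt hx
  · refine (hS.tendsto_nhds _ _).2 fun i ε hε => ?_
    have h := (hcont i).mul_const (WithFamily.seminorms S i a)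
    rw [zero_mul] at h
    filter_upwards [h.eventually_lt_const hε] with x hx
    rw [sub_zero]
    exact (hmul i x a).trans_lt hx

/-- The completion of `A` with respect to the family of seminorms `S`. -/
abbrev FamilyCompletion : Type u := UniformSpace.Completion (WithFamily S)

/-- The canonical homomorphism of `A` into its completion. -/
def toFamilyCompletion : A →ₐ[ℂ] FamilyCompletion S where
  toRingHom := (UniformSpace.Completion.coeRingHom : WithFamily S →+* FamilyCompletion S)
  commutes' := fun _ => rfl

end WithFamily

section FamilyMap

variable {A : Type u} [Ring A] [Algebra ℂ A] {ι : Type v} (S : SubmulFamily A ι)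
variable {B : Type u} [Ring B] [Algebra ℂ B] {κ : Type w} (T : SubmulFamily B κ)

theorem continuous_withFamily (φ : A →ₐ[ℂ] B)
    (h : ∀ j, ∃ i, ∀ a, T.toFamily j (φ a) = S.toFamily i a) :
    Continuous (show WithFamily S → WithFamily T from φ) := by
  let ψ : WithFamily S →ₗ[ℂ] WithFamily T := φ.toLinearMap
  refine WithSeminorms.continuous_of_continuous_comp (withSeminorms_withFamily T) ψ fun j => ?_
  obtain ⟨i, hi⟩ := h j
  have : ((WithFamily.seminorms T j).comp ψ : WithFamily S → ℝ) = WithFamily.seminorms S i :=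
    funext hi
  rw [this]
  exact (withSeminorms_withFamily S).continuous_seminorm i

/-- The continuous extension to the completions of a homomorphism of algebras that pulls back the
seminorms in `T` to seminorms in `S`. -/
def familyMap (φ : A →ₐ[ℂ] B) (h : ∀ j, ∃ i, ∀ a, T.toFamily j (φ a) = S.toFamily i a) :
    FamilyCompletion S →A[ℂ] FamilyCompletion T where
  toRingHom := UniformSpace.Completion.mapRingHom
    (show WithFamily S →+* WithFamily T from φ.toRingHom) (continuous_withFamily S T φ h)
  commutes' := fun r => by
    have h1 := UniformSpace.Completion.mapRingHom_coe (continuous_withFamily S T φ h)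
      (f := (show WithFamily S →+* WithFamily T from φ.toRingHom)) (algebraMap ℂ (WithFamily S) r)
    refine h1.trans ?_
    exact congrArg (fun x : WithFamily T => (x : FamilyCompletion T)) (φ.commutes r)
  cont := UniformSpace.Completion.continuous_map

end FamilyMap

/-- A Fréchet algebra: a complete Hausdorff topological algebra whose topology is defined by a
countable family of submultiplicative seminorms. -/
def IsFrechetAlgebra (A : Type u) [Ring A] [Algebra ℂ A] [UniformSpace A] : Prop :=
  IsUniformAddGroup A ∧ CompleteSpace A ∧ T2Space A ∧
    ∃ p : SeminormFamily ℂ A ℕ, WithSeminorms p ∧ ∀ n a b, p n (a * b) ≤ p n a * p n b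

/-! ### The Connes-Moscovici algebra of a group with word-length -/

section ConnesMoscovici

variable {G : Type u} [Group G] (L : WordLength G)

/-- The seminorms `η_m`, `m ≥ 0`, on the group algebra. -/
def etaFamily : SubmulFamily (MonoidAlgebra ℂ G) ℕ where
  toFamily := eta L
  mul_le := eta_mul_le L

/-- The Connes-Moscovici algebra, as the completion of the group algebra in the seminorms `η_m`. -/
abbrev CMAlgebra : Type u := FamilyCompletion (etaFamily L)

/-- The operators in `cmSet L` that are limits, in all the seminorms `η_m`, of elements of the group
algebra. -/
def cmClosure : Set (Bdd G) :=
  {T | T ∈ cmSet L ∧ ∀ m : ℕ, ∀ ε > 0, ∃ (a : MonoidAlgebra ℂ G) (S : ℕ → Bdd G),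
    IsDerivSeq L (T - leftReg G a) S ∧ etaSeq m S < ε}

/-- `Φ` identifies the topological algebra `A`, which contains the group algebra by way of `j`, with
the algebra of operators `cmClosure L`, topologized by the seminorms `η_m`. -/
structure IsCMRealization {A : Type u} [Ring A] [Algebra ℂ A] [TopologicalSpace A]
    (j : MonoidAlgebra ℂ G →ₐ[ℂ] A) (Φ : A →ₐ[ℂ] Bdd G) : Prop where
  injective : Function.Injective Φ
  apply_coe : ∀ a, Φ (j a) = leftReg G a
  range_eq : Set.range Φ = cmClosure L
  topology : ∃ q : SeminormFamily ℂ A ℕ, WithSeminorms q ∧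
    ∀ m x S, IsDerivSeq L (Φ x) S → q m x = etaSeq m S

end ConnesMoscovici

/-! ### Augmented simplicial groups and their completed group algebras -/

/-- The opposite of the augmented simplex category. -/
abbrev AugOp : Type := AugmentedSimplexCategoryᵒᵖ

/-- The object `[n]`, `n ≥ 0`. -/
def deg (n : ℕ) : AugOp :=
  Opposite.op (AugmentedSimplexCategory.inclusion.obj (SimplexCategory.mk n))

/-- The object `[-1]`. -/
def degNegOne : AugOp := Opposite.op WithInitial.star

/-- The face `∂_i` from degree `n + 1` to degree `n`. -/
def face (n : ℕ) (i : Fin (n + 2)) : deg (n + 1) ⟶ deg n :=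
  (AugmentedSimplexCategory.inclusion.map (SimplexCategory.δ i)).op

/-- The degeneracy `s_i` from degree `n` to degree `n + 1`. -/
def degen (n : ℕ) (i : Fin (n + 1)) : deg n ⟶ deg (n + 1) :=
  (AugmentedSimplexCategory.inclusion.map (SimplexCategory.σ i)).op

/-- The unique morphism `ε_n` from degree `n` to degree `-1`. -/
def aug (n : ℕ) : deg n ⟶ degNegOne :=
  (WithInitial.homTo (SimplexCategory.mk n)).op

theorem face_comp_aug (n : ℕ) (i : Fin (n + 2)) : face n i ≫ aug n = aug (n + 1) :=
  Quiver.Hom.unop_inj (WithInitial.starInitial.hom_ext _ _)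

section SimplicialGroup

variable (Γ : AugOp ⥤ GrpCat.{u}) (L : ∀ X, WordLength (Γ.obj X))

/-- The index set for the seminorms in degree `X`: a morphism `f : X ⟶ Y` and a number `j`. -/
abbrev CMIndex (X : AugOp) : Type := Σ Y : AugOp, (X ⟶ Y) × ℕ

/-- The homomorphism of group algebras induced by a simplicial structure map. -/
def groupAlgMap {X Y : AugOp} (f : X ⟶ Y) :
    MonoidAlgebra ℂ (Γ.obj X) →ₐ[ℂ] MonoidAlgebra ℂ (Γ.obj Y) :=
  MonoidAlgebra.mapDomainAlgHom ℂ ℂ (Γ.map f).hom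

theorem groupAlgMap_comp {X Y Z : AugOp} (f : X ⟶ Y) (g : Y ⟶ Z) (a : MonoidAlgebra ℂ (Γ.obj X)) :
    groupAlgMap Γ g (groupAlgMap Γ f a) = groupAlgMap Γ (f ≫ g) a := by
  induction a using MonoidAlgebra.induction_linear with
  | zero => simp
  | add a b ha hb => simp only [map_add, ha, hb]
  | single x c => simp [groupAlgMap]

/-- All pullbacks `f^*(η_j)` of the Connes-Moscovici seminorms along the structure maps. -/
def cmFamily (X : AugOp) : SubmulFamily (MonoidAlgebra ℂ (Γ.obj X)) (CMIndex X) where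
  toFamily := fun i => (eta (L i.1) i.2.2).comp (groupAlgMap Γ i.2.1).toLinearMap
  mul_le := fun i a b => by
    change eta (L i.1) i.2.2 (groupAlgMap Γ i.2.1 (a * b)) ≤ _
    rw [map_mul]
    exact eta_mul_le _ _ _ _

/-- The degree `X` part of the completed simplicial group algebra. -/
abbrev HCM (X : AugOp) : Type u := FamilyCompletion (cmFamily Γ L X)

/-- The structure maps of the completed simplicial group algebra. -/
def HCM.map {X Y : AugOp} (f : X ⟶ Y) : HCM Γ L X →A[ℂ] HCM Γ L Y :=
  familyMap (cmFamily Γ L X) (cmFamily Γ L Y) (groupAlgMap Γ f) fun j =>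
    ⟨⟨j.1, f ≫ j.2.1, j.2.2⟩, fun a =>
      congrArg (eta (L j.1) j.2.2) (groupAlgMap_comp Γ f j.2.1 a)⟩

/-! ### Type P resolutions -/

/-- A map of sets between groups with word-length that is polynomially bounded. -/
def PolyBounded {G H : Type u} [Group G] [Group H] (LG : WordLength G) (LH : WordLength H)
    (f : G → H) : Prop :=
  ∃ p : Polynomial ℝ, ∀ g, LH (f g) ≤ p.eval (LG g)

/-- `G` is a countably generated free group, and `L` is the word-length metric with values in `ℕ`
that is induced by a proper function `w` on a set of free generators: `L g` is the least total weight
of a word in the generators and their inverses that represents `g`. -/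
def IsFreeWithProperWordMetric {G : Type u} [Group G] (L : WordLength G) : Prop :=
  ∃ (ι : Type u) (_ : Countable ι) (b : FreeGroupBasis ι G) (w : ι → ℕ),
    (∀ x, 0 < w x) ∧ (∀ m, {x | w x ≤ m}.Finite) ∧
    ∀ g, ∃ n : ℕ, L g = n ∧ IsLeast
      {m : ℕ | ∃ l : List (ι × Bool), FreeGroup.mk l = b.repr g ∧ m = (l.map fun y => w y.1).sum} n

/-- The kernel `Γ(ε)_n` of `ε_n`. -/
def augKer (n : ℕ) : Subgroup (Γ.obj (deg n)) := (Γ.map (aug n)).hom.ker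

/-- The word-length on `Γ(ε)_n` inherited from `Γ_n`. -/
def WordLength.restrict {G : Type u} [Group G] (LG : WordLength G) (K : Subgroup G) :
    WordLength K where
  toFun := fun g => LG g
  nonneg := fun g => LG.nonneg g
  one := LG.one
  inv := fun g => LG.inv g
  mul_le := fun g h => LG.mul_le g h

/-- The faces of the simplicial group `Γ(ε)`. -/
def kerFace (n : ℕ) (i : Fin (n + 2)) (x : augKer Γ (n + 1)) : augKer Γ n :=
  ⟨Γ.map (face n i) x, by
    have h : (Γ.map (aug (n + 1))).hom x = 1 := x.2
    rw [← face_comp_aug n i, Γ.map_comp] at h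
    exact h⟩

/-- A simplicial contraction, polynomially bounded in each degree, of the simplicial set underlying
`Γ(ε)`, onto a vertex `v`: an extra degeneracy `s n` from degree `n` to degree `n + 1`. -/
structure IsPolyContraction (v : augKer Γ 0) (s : ∀ n, augKer Γ n → augKer Γ (n + 1)) : Prop where
  face_last : ∀ n x, kerFace Γ n (Fin.last (n + 1)) (s n x) = x
  face_zero : ∀ x, kerFace Γ 0 0 (s 0 x) = v
  face_castSucc : ∀ n x (i : Fin (n + 2)),
    kerFace Γ (n + 1) i.castSucc (s (n + 1) x) = s n (kerFace Γ n i x)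
  polyBounded : ∀ n, PolyBounded ((L (deg n)).restrict (augKer Γ n))
    ((L (deg (n + 1))).restrict (augKer Γ (n + 1))) (s n)

/-- Type P resolutions. -/
structure IsTypeP : Prop where
  polyBounded_face : ∀ n i, PolyBounded (L (deg (n + 1))) (L (deg n)) (Γ.map (face n i))
  polyBounded_degen : ∀ n i, PolyBounded (L (deg n)) (L (deg (n + 1))) (Γ.map (degen n i))
  polyBounded_aug : PolyBounded (L (deg 0)) (L degNegOne) (Γ.map (aug 0))
  /-- The augmentation has a polynomially bounded section (as a map of sets). -/
  exists_section : ∃ s : Γ.obj degNegOne → Γ.obj (deg 0),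
    (∀ x, Γ.map (aug 0) (s x) = x) ∧ PolyBounded (L degNegOne) (L (deg 0)) s
  free : ∀ n, IsFreeWithProperWordMetric (L (deg n))
  exists_contraction : ∃ v s, IsPolyContraction Γ L v s

end SimplicialGroup

/-! ### Completed projective tensor powers -/

/-- The algebraic tensor power `E^{⊗ n}` of a topological vector space, with the projective topology:
the locally convex topology defined by all seminorms `q` for which
`(x_1, …, x_n) ↦ q (x_1 ⊗ ⋯ ⊗ x_n)` is continuous. -/
def ProjTensor (E : Type u) [AddCommGroup E] [Module ℂ E] [TopologicalSpace E] (n : ℕ) : Type u :=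
  PiTensorProduct ℂ (fun _ : Fin n => E)

section ProjTensor

variable (E : Type u) [AddCommGroup E] [Module ℂ E] [TopologicalSpace E] (n : ℕ)

instance : AddCommGroup (ProjTensor E n) :=
  inferInstanceAs (AddCommGroup (PiTensorProduct ℂ (fun _ : Fin n => E)))

instance : Module ℂ (ProjTensor E n) :=
  inferInstanceAs (Module ℂ (PiTensorProduct ℂ (fun _ : Fin n => E)))

/-- The pure tensor `x_1 ⊗ ⋯ ⊗ x_n`. -/
def pureTensor : MultilinearMap ℂ (fun _ : Fin n => E) (ProjTensor E n) :=
  PiTensorProduct.tprod ℂ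

/-- The seminorms defining the projective topology. -/
def projSeminorms : SeminormFamily ℂ (ProjTensor E n)
    {q : Seminorm ℂ (ProjTensor E n) // Continuous fun x => q (pureTensor E n x)} :=
  fun q => q.1

instance : TopologicalSpace (ProjTensor E n) := (projSeminorms E n).moduleFilterBasis.topology

theorem withSeminorms_projTensor : WithSeminorms (projSeminorms E n) := ⟨rfl⟩

instance : IsTopologicalAddGroup (ProjTensor E n) :=
  (withSeminorms_projTensor E n).topologicalAddGroup

instance : ContinuousSMul ℂ (ProjTensor E n) := (withSeminorms_projTensor E n).continuousSMul

instance : UniformSpace (ProjTensor E n) :=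
  IsTopologicalAddGroup.rightUniformSpace (ProjTensor E n)

instance : IsUniformAddGroup (ProjTensor E n) := isUniformAddGroup_of_addCommGroup

instance : UniformContinuousConstSMul ℂ (ProjTensor E n) :=
  uniformContinuousConstSMul_of_continuousConstSMul ℂ (ProjTensor E n)

/-- The projectively completed tensor power. -/
abbrev CompTensor : Type u := UniformSpace.Completion (ProjTensor E n)

variable {E n}
variable {F : Type u} [AddCommGroup F] [Module ℂ F] [TopologicalSpace F] {m : ℕ}

theorem continuous_projTensor (g : ProjTensor E n →ₗ[ℂ] ProjTensor F m)
    (c : (Fin n → E) → (Fin m → F)) (hc : Continuous c)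
    (h : ∀ x, g (pureTensor E n x) = pureTensor F m (c x)) : Continuous g := by
  refine WithSeminorms.continuous_of_continuous_comp (withSeminorms_projTensor F m) g fun q => ?_
  have hq : Continuous fun x => (q.1.comp g) (pureTensor E n x) := by
    have : (fun x => (q.1.comp g) (pureTensor E n x)) = fun x => q.1 (pureTensor F m (c x)) :=
      funext fun x => congrArg q.1 (h x)
    rw [this]
    exact q.2.comp hc
  exact (withSeminorms_projTensor E n).continuous_seminorm ⟨q.1.comp g, hq⟩

/-- The continuous linear map between projective tensor powers that sends the pure tensor of `x` to
the pure tensor of `c x`. -/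
def tensorLift (c : (Fin n → E) → (Fin m → F)) (hc : Continuous c)
    (μ : MultilinearMap ℂ (fun _ : Fin n => E) (ProjTensor F m))
    (hμ : ∀ x, μ x = pureTensor F m (c x)) : ProjTensor E n →L[ℂ] ProjTensor F m where
  toLinearMap := (PiTensorProduct.lift μ : PiTensorProduct ℂ (fun _ : Fin n => E) →ₗ[ℂ] _)
  cont := continuous_projTensor _ c hc fun x => (PiTensorProduct.lift.tprod x).trans (hμ x)

/-- The map `φ ⊗ ⋯ ⊗ φ` on completed tensor powers. -/
def tensorPow (φ : E →L[ℂ] F) (n : ℕ) : CompTensor E n →L[ℂ] CompTensor F n :=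
  (tensorLift (fun x i => φ (x i)) (by fun_prop)
    ((pureTensor F n).compLinearMap fun _ => φ.toLinearMap) (fun _ => rfl)).completion

/-- The cyclic rotation `x_0 ⊗ ⋯ ⊗ x_k ↦ x_k ⊗ x_0 ⊗ ⋯ ⊗ x_{k-1}` on completed tensor powers. -/
def tensorRot (E : Type u) [AddCommGroup E] [Module ℂ E] [TopologicalSpace E] (k : ℕ) :
    CompTensor E (k + 1) →L[ℂ] CompTensor E (k + 1) :=
  (tensorLift (fun x i => x ((finRotate (k + 1)).symm i)) (by fun_prop)
    ((pureTensor E (k + 1)).domDomCongr (finRotate (k + 1)).symm) (fun _ => rfl)).completion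

end ProjTensor

/-! ### Topological Hochschild and cyclic complexes -/

section Hochschild

variable {A : Type u} [Ring A]

/-- The tuple `(x_0, …, x_i x_{i+1}, …, x_{k+1})`. -/
def mulAt {k : ℕ} (i : Fin (k + 1)) (x : Fin (k + 2) → A) (l : Fin (k + 1)) : A :=
  if l < i then x l.castSucc else if l = i then x l.castSucc * x l.succ else x l.succ

theorem mulAt_update {k : ℕ} (i : Fin (k + 1)) (x : Fin (k + 2) → A) (j : Fin (k + 2))
    [DecidableEq (Fin (k + 2))] : ∃ (l : Fin (k + 1)) (u v : A), ∀ a,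
      mulAt i (Function.update x j a) = Function.update (mulAt i x) l (u * a * v) := by
  have hj := j.2
  have hi := i.2
  have aux : ∀ (l : Fin (k + 1)) (b : A) (a : A),
      mulAt i (Function.update x j a) l = b →
      (∀ l', l' ≠ l → mulAt i (Function.update x j a) l' = mulAt i x l') →
      mulAt i (Function.update x j a) = Function.update (mulAt i x) l b := by
    intro l b a h1 h2
    funext l'
    by_cases h : l' = l
    · subst h
      rw [h1, Function.update_self]
    · rw [h2 l' h, Function.update_of_ne h]
  have hup : ∀ (a : A) (p : Fin (k + 2)), Function.update x j a p =
      if (p : ℕ) = j then a else x p := by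
    intro a p
    rw [Function.update_apply]
    simp only [Fin.ext_iff]
  rcases lt_trichotomy (j : ℕ) i with h | h | h
  · refine ⟨⟨j, by omega⟩, 1, 1, fun a => aux _ _ _ ?_ fun l' hl' => ?_⟩
    · simp [mulAt, Fin.lt_def, h]
    · have hl'' : (l' : ℕ) ≠ j := fun e => hl' (Fin.ext e)
      unfold mulAt
      simp only [hup, Fin.lt_def, Fin.ext_iff, Fin.val_castSucc, Fin.val_succ]
      split_ifs <;> first | rfl | omega
  · refine ⟨i, 1, x i.succ, fun a => aux _ _ _ ?_ fun l' hl' => ?_⟩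
    · simp [mulAt, hup, h]
    · have hl'' : (l' : ℕ) ≠ i := fun e => hl' (Fin.ext e)
      unfold mulAt
      simp only [hup, Fin.lt_def, Fin.ext_iff, Fin.val_castSucc, Fin.val_succ]
      split_ifs <;> first | rfl | omega
  · by_cases h' : (j : ℕ) = i + 1
    · refine ⟨i, x i.castSucc, 1, fun a => aux _ _ _ ?_ fun l' hl' => ?_⟩
      · simp [mulAt, hup, h']
      · have hl'' : (l' : ℕ) ≠ i := fun e => hl' (Fin.ext e)
        unfold mulAt
        simp only [hup, Fin.lt_def, Fin.ext_iff, Fin.val_castSucc, Fin.val_succ]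
        split_ifs <;> first | rfl | omega
    · refine ⟨⟨j - 1, by omega⟩, 1, 1, fun a => aux _ _ _ ?_ fun l' hl' => ?_⟩
      · unfold mulAt
        simp only [hup, Fin.lt_def, Fin.ext_iff, Fin.val_castSucc, Fin.val_succ, one_mul, mul_one]
        split_ifs <;> first | rfl | omega
      · have hl'' : (l' : ℕ) ≠ j - 1 := fun e => hl' (Fin.ext e)
        unfold mulAt
        simp only [hup, Fin.lt_def, Fin.ext_iff, Fin.val_castSucc, Fin.val_succ]
        split_ifs <;> first | rfl | omega

theorem continuous_mulAt (A : Type u) [Ring A] [TopologicalSpace A] [IsTopologicalRing A] {k : ℕ}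
    (i : Fin (k + 1)) :
    Continuous (mulAt i : (Fin (k + 2) → A) → (Fin (k + 1) → A)) := by
  refine continuous_pi fun l => ?_
  unfold mulAt
  split_ifs <;> fun_prop

variable (A) [Algebra ℂ A] [TopologicalSpace A] [IsTopologicalRing A]

/-- The multilinear map `x ↦ x_0 ⊗ ⋯ ⊗ x_i x_{i+1} ⊗ ⋯ ⊗ x_{k+1}`. -/
def mulAtMultilinear {k : ℕ} (i : Fin (k + 1)) :
    MultilinearMap ℂ (fun _ : Fin (k + 2) => A) (ProjTensor A (k + 1)) where
  toFun := fun x => pureTensor A (k + 1) (mulAt i x)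
  map_update_add' := fun x j a b => by
    obtain ⟨l, u, v, h⟩ := mulAt_update i x j
    rw [h, h, h, mul_add, add_mul, MultilinearMap.map_update_add]
  map_update_smul' := fun x j c a => by
    obtain ⟨l, u, v, h⟩ := mulAt_update i x j
    rw [h, h, mul_smul_comm, smul_mul_assoc, MultilinearMap.map_update_smul]

/-- The topological Hochschild chains `A ⊗̂ A^{⊗̂ k}` in degree `k`. -/
abbrev CH (k : ℕ) : Type u := CompTensor A (k + 1)

/-- The map `x_0 ⊗ ⋯ ⊗ x_{k+1} ↦ x_0 ⊗ ⋯ ⊗ x_i x_{i+1} ⊗ ⋯ ⊗ x_{k+1}`, for `0 ≤ i ≤ k`. -/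
def hochFace (k : ℕ) (i : Fin (k + 1)) : CH A (k + 1) →L[ℂ] CH A k :=
  (tensorLift (mulAt i) (continuous_mulAt A i) (mulAtMultilinear A i) fun _ => rfl).completion

/-- The operator `b'`. -/
def hochB' (k : ℕ) : CH A (k + 1) →L[ℂ] CH A k :=
  ∑ i : Fin (k + 1), (-1 : ℂ) ^ (i : ℕ) • hochFace A k i

/-- The Hochschild boundary `b`: its last term is
`(-1)^{k+1} x_{k+1} x_0 ⊗ x_1 ⊗ ⋯ ⊗ x_k`. -/
def hochB (k : ℕ) : CH A (k + 1) →L[ℂ] CH A k :=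
  hochB' A k + (-1 : ℂ) ^ (k + 1) • (hochFace A k 0).comp (tensorRot A (k + 1))

/-- The signed cyclic operator `t`. -/
def cycT (k : ℕ) : CH A k →L[ℂ] CH A k := (-1 : ℂ) ^ k • tensorRot A k

/-- The norm operator `N = 1 + t + ⋯ + t^k`. -/
def cycN (k : ℕ) : CH A k →L[ℂ] CH A k := ∑ i ∈ Finset.range (k + 1), cycT A k ^ i

/-- The topological cyclic chains in degree `n`: the total complex of the cyclic bicomplex, whose
entry in column `p` and row `q` is `CH A q`; the component `q` here lies in column `n - q`. -/
abbrev CC (n : ℕ) : Type u := ∀ q : Fin (n + 1), CH A q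

/-- The boundary of the total complex of the cyclic bicomplex. The vertical boundary is `b` in the
even columns and `-b'` in the odd columns; the horizontal boundary is `1 - t` from odd to even
columns, and `N` from even to odd columns. -/
def cycD (n : ℕ) : CC A (n + 1) →L[ℂ] CC A n :=
  ContinuousLinearMap.pi fun q : Fin (n + 1) =>
    if Even (n - (q : ℕ)) then
      (hochB A q).comp (ContinuousLinearMap.proj (φ := fun q : Fin (n + 2) => CH A q) q.succ) +
        (ContinuousLinearMap.id ℂ (CH A q) - cycT A q).comp
          (ContinuousLinearMap.proj (φ := fun q : Fin (n + 2) => CH A q) q.castSucc)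
    else
      -(hochB' A q).comp (ContinuousLinearMap.proj (φ := fun q : Fin (n + 2) => CH A q) q.succ) +
        (cycN A q).comp
          (ContinuousLinearMap.proj (φ := fun q : Fin (n + 2) => CH A q) q.castSucc)

variable {A} {B : Type u} [Ring B] [Algebra ℂ B] [TopologicalSpace B] [IsTopologicalRing B]

/-- The map of Hochschild chains induced by a continuous homomorphism. -/
def CH.map (φ : A →A[ℂ] B) (k : ℕ) : CH A k →L[ℂ] CH B k :=
  tensorPow ({ toLinearMap := φ.toAlgHom.toLinearMap, cont := φ.cont } : A →L[ℂ] B) (k + 1)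

/-- The map of cyclic chains induced by a continuous homomorphism. -/
def CC.map (φ : A →A[ℂ] B) (n : ℕ) : CC A n →L[ℂ] CC B n :=
  ContinuousLinearMap.pi fun q : Fin (n + 1) =>
    (CH.map φ q).comp (ContinuousLinearMap.proj (φ := fun q : Fin (n + 1) => CH A q) q)

end Hochschild

/-- The transpose of a continuous linear map, on continuous duals. -/
def dualMap {E F : Type u} [AddCommGroup E] [Module ℂ E] [TopologicalSpace E] [AddCommGroup F]
    [Module ℂ F] [TopologicalSpace F] (T : E →L[ℂ] F) : (F →L[ℂ] ℂ) →ₗ[ℂ] (E →L[ℂ] ℂ) where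
  toFun := fun ψ => ψ.comp T
  map_add' := fun _ _ => rfl
  map_smul' := fun _ _ => rfl

/-! ### Augmented simplicial complexes of resolution type -/

/-- An augmented simplicial abelian group `M` is a resolution: the augmentation is onto, and all
homotopy groups of the kernel `M(ε)` of the augmentation vanish, that is, every simplex of `M(ε)`
with trivial faces is the last face of a simplex of `M(ε)` whose other faces are trivial. -/
structure IsResolution (M : AugOp → Type u) [∀ X, AddCommGroup (M X)]
    (map : ∀ {X Y : AugOp}, (X ⟶ Y) → M X → M Y) : Prop where
  surjective : Function.Surjective (map (aug 0))
  pi_zero : ∀ x : M (deg 0), map (aug 0) x = 0 →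
    ∃ y : M (deg 1), map (aug 1) y = 0 ∧ map (face 0 0) y = 0 ∧ map (face 0 1) y = x
  pi_succ : ∀ n (x : M (deg (n + 1))), map (aug (n + 1)) x = 0 → (∀ i, map (face n i) x = 0) →
    ∃ y : M (deg (n + 2)), map (aug (n + 2)) y = 0 ∧
      (∀ i : Fin (n + 2), map (face (n + 1) i.castSucc) y = 0) ∧
      map (face (n + 1) (Fin.last (n + 2))) y = x

/-- A coaugmented cosimplicial abelian group `M` is a resolution: the coaugmented cochain complex
`0 → M^{-1} → M^0 → M^1 → ⋯` with the alternating sums of the cofaces as differentials is exact. -/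
structure IsCoresolution (M : AugOp → Type u) [∀ X, AddCommGroup (M X)]
    (map : ∀ {X Y : AugOp}, (X ⟶ Y) → M Y → M X) : Prop where
  injective : Function.Injective (map (aug 0))
  exact_zero : ∀ x : M (deg 0), map (face 0 0) x = map (face 0 1) x →
    ∃ y : M degNegOne, map (aug 0) y = x
  exact_succ : ∀ n (x : M (deg (n + 1))),
    ∑ i : Fin (n + 3), (-1 : ℤ) ^ (i : ℕ) • map (face (n + 1) i) x = 0 →
    ∃ y : M (deg n), ∑ i : Fin (n + 2), (-1 : ℤ) ^ (i : ℕ) • map (face n i) y = x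

/-- The data `C`, `d`, `map` form an augmented simplicial (connected) chain complex. -/
structure IsAugSimplicialComplex (C : AugOp → ℕ → Type u) [∀ X k, AddCommGroup (C X k)]
    [∀ X k, Module ℂ (C X k)] (d : ∀ X k, C X (k + 1) →ₗ[ℂ] C X k)
    (map : ∀ {X Y : AugOp}, (X ⟶ Y) → ∀ k, C X k →ₗ[ℂ] C Y k) : Prop where
  d_comp_d : ∀ X k x, d X k (d X (k + 1) x) = 0
  map_id : ∀ X k x, map (𝟙 X) k x = x
  map_comp : ∀ {X Y Z : AugOp} (f : X ⟶ Y) (g : Y ⟶ Z) k x, map (f ≫ g) k x = map g k (map f k x)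
  map_d : ∀ {X Y : AugOp} (f : X ⟶ Y) k x, map f k (d X k x) = d Y k (map f (k + 1) x)

/-- The data `C`, `d`, `map` form a coaugmented cosimplicial (connected) cochain complex. -/
structure IsCoaugCosimplicialComplex (C : AugOp → ℕ → Type u) [∀ X k, AddCommGroup (C X k)]
    [∀ X k, Module ℂ (C X k)] (d : ∀ X k, C X k →ₗ[ℂ] C X (k + 1))
    (map : ∀ {X Y : AugOp}, (X ⟶ Y) → ∀ k, C Y k →ₗ[ℂ] C X k) : Prop where
  d_comp_d : ∀ X k x, d X (k + 1) (d X k x) = 0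
  map_id : ∀ X k x, map (𝟙 X) k x = x
  map_comp : ∀ {X Y Z : AugOp} (f : X ⟶ Y) (g : Y ⟶ Z) k x, map (f ≫ g) k x = map f k (map g k x)
  map_d : ∀ {X Y : AugOp} (f : X ⟶ Y) k x, map f (k + 1) (d Y k x) = d X k (map f k x)

/-- An augmented simplicial chain complex of resolution type. -/
structure IsOfResolutionType (C : AugOp → ℕ → Type u) [∀ X k, AddCommGroup (C X k)]
    [∀ X k, Module ℂ (C X k)] (d : ∀ X k, C X (k + 1) →ₗ[ℂ] C X k)
    (map : ∀ {X Y : AugOp}, (X ⟶ Y) → ∀ k, C X k →ₗ[ℂ] C Y k) : Prop where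
  isComplex : IsAugSimplicialComplex C d map
  isResolution : ∀ k, IsResolution (fun X => C X k) (fun f => map f k)

/-- A coaugmented cosimplicial cochain complex of resolution type. -/
structure IsOfCoresolutionType (C : AugOp → ℕ → Type u) [∀ X k, AddCommGroup (C X k)]
    [∀ X k, Module ℂ (C X k)] (d : ∀ X k, C X k →ₗ[ℂ] C X (k + 1))
    (map : ∀ {X Y : AugOp}, (X ⟶ Y) → ∀ k, C Y k →ₗ[ℂ] C X k) : Prop where
  isComplex : IsCoaugCosimplicialComplex C d map
  isCoresolution : ∀ k, IsCoresolution (fun X => C X k) (fun f => map f k)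

end

end CMRes

open CMRes

/-!
The algebraic part of the statement is formal: the structure maps pull the defining seminorms back
to defining seminorms, so they extend to the completions, and only countably many seminorms occur.
An element `x` of the Connes-Moscovici algebra acts on `ℓ²` together with all its derivatives
`∂_L^i(x)`, and the seminorms `η_m` of `x` are computed from the norms of these. As the derivatives
of an operator are determined by the operator, the representation is injective, and as the algebra
is complete, its image contains all limits (`isCMRealization_leftRegExt`).

For a type P resolution, the contraction of the kernel of the augmentation and the section of the
augmentation combine to an extra degeneracy of the augmented simplicial set `Γ`: polynomially
bounded maps of sets `t_n : Γ_{n-1} → Γ_n` which the last face cancels and which commute with the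
others (`IsTypeP.exists_extraDegeneracy`). Everything follows once `t_n` is known to extend to the
completions of the group algebras. These maps are not homomorphisms, and this is where freeness
enters. In a free group Haagerup's inequality bounds the norm of `∂_L^i(b)` by a weighted `ℓ²`-norm
of `b` (`norm_derivOp_sq_le`), while in every group the value of `∂_L^i(a)` at `δ_1` shows that the
`η_m` dominate such `ℓ²`-norms. Hence an injective polynomially bounded map into a free group is
continuous in the seminorms `η_m` (`exists_eta_mapDomain_le`). The topology in degree `n` involves
also the seminorms `η_j ∘ Γ(f)`, and `f ∘ t_n` need not be injective. But the identities for the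
faces show that `f ∘ t_n` is a structure map, or a structure map followed by an injective
polynomially bounded map (`isTame_map_extraDegeneracy`), so that `t_n` is continuous.

Being linear and continuous, the extra degeneracy passes to completions, to completed tensor powers
and to finite products, hence to the Hochschild and cyclic chains in each degree, where it shows
that the augmented simplicial vector spaces are resolutions; its transpose contracts the cochain
complexes of the continuous duals. The Hochschild and cyclic complexes are complexes, functorially
in the algebra, because the identities between faces, rotations and norm operators may be checked
on pure tensors, which span a dense subspace.
-/

namespace CMRes

/-! ### The inequality of Haagerup -/

theorem sum_one_div_sq_le (N : ℕ) :
    ∑ i ∈ Finset.range N, (1 : ℝ) / (1 + (i : ℝ)) ^ 2 ≤ 2 - 1 / (N : ℝ) := by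
  induction N with
  | zero => simp
  | succ N ih =>
    rw [Finset.sum_range_succ]
    rcases Nat.eq_zero_or_pos N with rfl | hN
    · norm_num
    · have hN' : (0 : ℝ) < N := by exact_mod_cast hN
      have : (1 : ℝ) / (1 + N) ^ 2 ≤ 1 / N - 1 / (N + 1) := by
        rw [div_sub_div _ _ hN'.ne' (by positivity),
          div_le_div_iff₀ (by positivity) (by positivity)]
        nlinarith
      push_cast
      linarith

section RapidDecay

variable {G : Type u} [Group G]

open Classical in
/-- The part of a convolution product `c * ξ` with a prescribed cancellation pattern: only those
factorizations `x = g * h` count for which `g` and `x` have the same prefix `τ` and the rest of `x`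
is the rest `σ h` of `h`. Cauchy-Schwarz bounds its `ℓ²`-norm, because `x` is determined by its
prefix and its rest. -/
theorem sum_sq_sum_cancellation_le (σ : G → G) (τ : G → G) (s F : Finset G) (c ξ : G → ℝ)
    (M : ℝ) (hM : ∀ t : Finset G, ∑ h ∈ t, ξ h ^ 2 ≤ M) :
    ∑ x ∈ F, (∑ g ∈ s with τ g = τ x ∧ (τ x)⁻¹ * x = σ (g⁻¹ * x), c g * ξ (g⁻¹ * x)) ^ 2 ≤
      (∑ g ∈ s, c g ^ 2) * M := by
  set A : G → ℝ := fun u => ∑ g ∈ s with τ g = u, c g ^ 2 with hA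
  set H : Finset G := (s ×ˢ F).image fun p => p.1⁻¹ * p.2 with hH
  set B : G → ℝ := fun t => ∑ h ∈ H with σ h = t, ξ h ^ 2 with hB
  have hA0 : ∀ u, 0 ≤ A u := fun u => Finset.sum_nonneg fun _ _ => sq_nonneg _
  have hB0 : ∀ u, 0 ≤ B u := fun u => Finset.sum_nonneg fun _ _ => sq_nonneg _
  have h1 : ∀ x ∈ F,
      (∑ g ∈ s with τ g = τ x ∧ (τ x)⁻¹ * x = σ (g⁻¹ * x), c g * ξ (g⁻¹ * x)) ^ 2 ≤
        A (τ x) * B ((τ x)⁻¹ * x) := by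
    intro x hx
    refine (Finset.sum_mul_sq_le_sq_mul_sq _ _ _).trans (mul_le_mul ?_ ?_
      (Finset.sum_nonneg fun _ _ => sq_nonneg _) (hA0 _))
    · refine Finset.sum_le_sum_of_subset_of_nonneg ?_ fun _ _ _ => sq_nonneg _
      intro g hg
      simp only [Finset.mem_filter] at hg ⊢
      exact ⟨hg.1, hg.2.1⟩
    · rw [← Finset.sum_image (f := fun h => ξ h ^ 2) (g := fun g => g⁻¹ * x)
        (fun a _ b _ h => inv_injective (mul_right_cancel h))]
      refine Finset.sum_le_sum_of_subset_of_nonneg ?_ fun _ _ _ => sq_nonneg _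
      intro h hh
      obtain ⟨g, hg, rfl⟩ := Finset.mem_image.1 hh
      simp only [Finset.mem_filter] at hg ⊢
      exact ⟨Finset.mem_image.2 ⟨(g, x), Finset.mem_product.2 ⟨hg.1, hx⟩, rfl⟩, hg.2.2.symm⟩
  -- an element is determined by its prefix and the remaining suffix
  have h2 : ∑ x ∈ F, A (τ x) * B ((τ x)⁻¹ * x) ≤
      ∑ p ∈ (F.image τ) ×ˢ (F.image fun x => (τ x)⁻¹ * x), A p.1 * B p.2 := by
    rw [← Finset.sum_image (f := fun p : G × G => A p.1 * B p.2)
      (g := fun x => (τ x, (τ x)⁻¹ * x))]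
    · refine Finset.sum_le_sum_of_subset_of_nonneg ?_ fun p _ _ => mul_nonneg (hA0 _) (hB0 _)
      intro p hp
      obtain ⟨x, hx, rfl⟩ := Finset.mem_image.1 hp
      exact Finset.mem_product.2 ⟨Finset.mem_image_of_mem _ hx,
        Finset.mem_image_of_mem (fun x => (τ x)⁻¹ * x) hx⟩
    · intro a _ b _ h
      obtain ⟨h3, h4⟩ := Prod.mk.inj h
      rw [h3] at h4
      exact mul_left_cancel h4
  have h3 : ∀ (U T : Finset G) (f : G → G) (r : G → ℝ),
      ∑ u ∈ U, ∑ g ∈ T with f g = u, r g ^ 2 ≤ ∑ g ∈ T, r g ^ 2 := fun U T f r =>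
    Finset.sum_fiberwise_le_sum_of_sum_fiber_nonneg
      fun _ _ => Finset.sum_nonneg fun _ _ => sq_nonneg _
  refine (Finset.sum_le_sum h1).trans (h2.trans ?_)
  rw [Finset.sum_product, ← Finset.sum_mul_sum]
  exact mul_le_mul (h3 _ _ _ _) ((h3 _ _ _ _).trans (hM _))
    (Finset.sum_nonneg fun _ _ => hB0 _) (Finset.sum_nonneg fun _ _ => sq_nonneg _)

open Classical in
/-- Haagerup's inequality: convolution by `c` is bounded on `ℓ²` by a polynomially weighted
`ℓ²`-norm of `c`. The hypothesis on the prefixes `τ i g` expresses how products cancel in a free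
group. -/
theorem sum_sq_convolution_le (ℓ : G → ℕ) (τ : ℕ → G → G)
    (hτ : ∀ g h, ∃ i j, i + j = ℓ g ∧ τ i g = τ i (g * h) ∧
      (τ i (g * h))⁻¹ * (g * h) = (τ j h)⁻¹ * h)
    (s F : Finset G) (c ξ : G → ℝ) (hc : ∀ g, 0 ≤ c g) (hξ : ∀ g, 0 ≤ ξ g)
    (M : ℝ) (hM : ∀ t : Finset G, ∑ h ∈ t, ξ h ^ 2 ≤ M) :
    ∑ x ∈ F, (∑ g ∈ s, c g * ξ (g⁻¹ * x)) ^ 2 ≤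
      4 * (∑ g ∈ s, (1 + (ℓ g : ℝ)) ^ 5 * c g ^ 2) * M := by
  have hM0 : 0 ≤ M := by simpa using hM ∅
  set N : ℕ := s.sup ℓ + 1 with hN
  set I : Finset (ℕ × ℕ) := Finset.range N ×ˢ Finset.range N with hI
  -- weights with summable inverses, for Cauchy-Schwarz over the positions of cancellation
  set W : ℕ × ℕ → ℝ := fun p => (1 + (p.1 : ℝ)) ^ 2 * (1 + (p.2 : ℝ)) ^ 2 with hW
  have hW0 : ∀ p, 0 < W p := fun p => by positivity
  set T : ℕ × ℕ → G → ℝ := fun p x =>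
    ∑ g ∈ s.filter (fun g => ℓ g = p.1 + p.2) with
      τ p.1 g = τ p.1 x ∧ (τ p.1 x)⁻¹ * x = (τ p.2 (g⁻¹ * x))⁻¹ * (g⁻¹ * x),
      c g * ξ (g⁻¹ * x) with hT
  have hcξ : ∀ g x, 0 ≤ c g * ξ (g⁻¹ * x) := fun g x => mul_nonneg (hc g) (hξ _)
  -- splitting the pairs `(g, g⁻¹ x)` by the position at which cancellation stops
  have hsplit : ∀ x, ∑ g ∈ s, c g * ξ (g⁻¹ * x) ≤ ∑ p ∈ I, T p x := by
    intro x
    simp only [hT, Finset.filter_filter, Finset.sum_filter]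
    rw [Finset.sum_comm]
    refine Finset.sum_le_sum fun g hg => ?_
    obtain ⟨i, j, hij, h1, h2⟩ := hτ g (g⁻¹ * x)
    rw [mul_inv_cancel_left] at h1 h2
    have hle : ℓ g ≤ s.sup ℓ := Finset.le_sup hg
    have hmem : (i, j) ∈ I := by
      simp only [hI, Finset.mem_product, Finset.mem_range]
      omega
    refine le_trans (le_of_eq ?_) (Finset.single_le_sum (f := fun p : ℕ × ℕ =>
      if ℓ g = p.1 + p.2 ∧ τ p.1 g = τ p.1 x ∧
        (τ p.1 x)⁻¹ * x = (τ p.2 (g⁻¹ * x))⁻¹ * (g⁻¹ * x) then c g * ξ (g⁻¹ * x) else 0)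
      (fun p _ => by
        split_ifs
        exacts [hcξ _ _, le_rfl]) hmem)
    rw [if_pos ⟨hij.symm, h1, h2⟩]
  have hsumW : ∑ p ∈ I, (W p)⁻¹ ≤ 4 := by
    have h0 : ∑ i ∈ Finset.range N, (1 : ℝ) / (1 + (i : ℝ)) ^ 2 ≤ 2 :=
      (sum_one_div_sq_le N).trans (sub_le_self _ (by positivity))
    have h1 : ∑ p ∈ I, (W p)⁻¹ = (∑ i ∈ Finset.range N, (1 : ℝ) / (1 + (i : ℝ)) ^ 2) *
        ∑ i ∈ Finset.range N, (1 : ℝ) / (1 + (i : ℝ)) ^ 2 := by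
      rw [Finset.sum_mul_sum, ← Finset.sum_product']
      refine Finset.sum_congr rfl fun p _ => ?_
      rw [hW, mul_inv, one_div, one_div]
    have h2 : 0 ≤ ∑ i ∈ Finset.range N, (1 : ℝ) / (1 + (i : ℝ)) ^ 2 :=
      Finset.sum_nonneg fun _ _ => by positivity
    rw [h1]
    nlinarith
  have hsq : ∀ x ∈ F, (∑ g ∈ s, c g * ξ (g⁻¹ * x)) ^ 2 ≤ 4 * ∑ p ∈ I, W p * T p x ^ 2 := by
    intro x _
    refine (pow_le_pow_left₀ (Finset.sum_nonneg fun _ _ => hcξ _ _) (hsplit x) 2).trans ?_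
    refine (Finset.sum_sq_le_sum_mul_sum_of_sq_le_mul I (f := fun p => (W p)⁻¹)
      (g := fun p => W p * T p x ^ 2) (fun p _ => (inv_pos.2 (hW0 p)).le)
      (fun p _ => mul_nonneg (hW0 p).le (sq_nonneg _)) (fun p _ => ?_)).trans ?_
    · rw [inv_mul_cancel_left₀ (hW0 p).ne']
    · exact mul_le_mul_of_nonneg_right hsumW
        (Finset.sum_nonneg fun p _ => mul_nonneg (hW0 p).le (sq_nonneg _))
  refine (Finset.sum_le_sum hsq).trans ?_
  rw [← Finset.mul_sum, mul_assoc, Finset.sum_comm]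
  refine mul_le_mul_of_nonneg_left ?_ (by norm_num)
  have hT2 : ∀ p ∈ I, ∑ x ∈ F, W p * T p x ^ 2 ≤
      (∑ g ∈ s, if ℓ g = p.1 + p.2 then W p * c g ^ 2 else 0) * M := by
    intro p _
    rw [← Finset.mul_sum, ← Finset.sum_filter, ← Finset.mul_sum, mul_assoc (W p) _ M]
    exact mul_le_mul_of_nonneg_left (sum_sq_sum_cancellation_le (fun h => (τ p.2 h)⁻¹ * h)
      (τ p.1) (s.filter fun g => ℓ g = p.1 + p.2) F c ξ M hM) (hW0 p).le
  refine (Finset.sum_le_sum hT2).trans ?_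
  rw [← Finset.sum_mul, Finset.sum_comm]
  refine mul_le_mul_of_nonneg_right (Finset.sum_le_sum fun g _ => ?_) hM0
  rw [← Finset.sum_filter]
  have hbound : ∀ p ∈ I.filter (fun p => ℓ g = p.1 + p.2),
      W p * c g ^ 2 ≤ (1 + (ℓ g : ℝ)) ^ 4 * c g ^ 2 := by
    intro p hp
    have hp' : (ℓ g : ℝ) = p.1 + p.2 := by exact_mod_cast (Finset.mem_filter.1 hp).2
    refine mul_le_mul_of_nonneg_right ?_ (sq_nonneg _)
    have : W p = ((1 + (p.1 : ℝ)) * (1 + (p.2 : ℝ))) ^ 2 := by simp only [hW]; ring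
    rw [this, show (4 : ℕ) = 2 * 2 from rfl, pow_mul]
    refine pow_le_pow_left₀ (by positivity) ?_ 2
    rw [hp', pow_two]
    have : (0 : ℝ) ≤ p.1 := Nat.cast_nonneg _
    have : (0 : ℝ) ≤ p.2 := Nat.cast_nonneg _
    exact mul_le_mul (by linarith) (by linarith) (by linarith) (by linarith)
  refine (Finset.sum_le_card_nsmul _ _ _ hbound).trans ?_
  have hcard : (I.filter fun p => ℓ g = p.1 + p.2).card ≤ ℓ g + 1 := by
    rw [← Finset.Nat.card_antidiagonal (ℓ g)]
    refine Finset.card_le_card fun p hp => ?_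
    exact Finset.HasAntidiagonal.mem_antidiagonal.2 (Finset.mem_filter.1 hp).2.symm
  have hcard' : ((I.filter fun p => ℓ g = p.1 + p.2).card : ℝ) ≤ 1 + ℓ g := by
    have : ((I.filter fun p => ℓ g = p.1 + p.2).card : ℝ) ≤ ((ℓ g + 1 : ℕ) : ℝ) :=
      Nat.cast_le.2 hcard
    push_cast at this
    linarith
  rw [nsmul_eq_mul, pow_succ (1 + (ℓ g : ℝ)) 4, mul_comm ((1 + (ℓ g : ℝ)) ^ 4) (1 + (ℓ g : ℝ)),
    mul_assoc]
  exact mul_le_mul_of_nonneg_right hcard' (by positivity)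

end RapidDecay

section FreeGroup

variable {α : Type u} [DecidableEq α]

open FreeGroup

/-- Two reduced words cancel, upon concatenation, along a final segment `t` of the first. -/
theorem exists_cancellation (U W : List (α × Bool)) (hU : IsReduced U) (hW : IsReduced W) :
    ∃ p t r, U = p ++ t ∧ W = invRev t ++ r ∧ IsReduced (p ++ r) := by
  induction W generalizing U with
  | nil => exact ⟨U, [], [], by simp, by simp [invRev], by simpa using hU⟩
  | cons x W ih =>
    rcases List.eq_nil_or_concat U with rfl | ⟨U', y, rfl⟩
    · exact ⟨[], [], x :: W, by simp, by simp [invRev], by simpa using hW⟩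
    · by_cases hxy : y.1 = x.1 → y.2 = x.2
      · refine ⟨U' ++ [y], [], x :: W, by simp, by simp [invRev], ?_⟩
        refine IsReduced.append_overlap (by simpa using hU) ?_ (by simp)
        exact isReduced_cons_cons.2 ⟨hxy, hW⟩
      · obtain ⟨p, t, r, h1, h2, h3⟩ := ih U' (hU.infix ⟨[], [y], by simp⟩)
          (hW.infix ⟨[x], [], by simp⟩)
        refine ⟨p, t ++ [y], r, by simp [h1], ?_, h3⟩
        rw [Classical.not_imp] at hxy
        have hx : x = (y.1, !y.2) := by
          refine Prod.ext hxy.1.symm ?_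
          have := hxy.2
          revert this
          cases y.2 <;> cases x.2 <;> simp
        rw [h2, hx]
        simp [invRev]

/-- The prefix of length `i` of the reduced word of an element of a free group. -/
def freePrefix (i : ℕ) (g : FreeGroup α) : FreeGroup α := FreeGroup.mk (g.toWord.take i)

/-- In a product `g * h` the letters of `g` before some position `i` survive, and the remaining
`j` letters of `g` cancel the first `j` letters of `h`. -/
theorem exists_freePrefix_eq (g h : FreeGroup α) : ∃ i j, i + j = g.norm ∧
    freePrefix i g = freePrefix i (g * h) ∧
    (freePrefix i (g * h))⁻¹ * (g * h) = (freePrefix j h)⁻¹ * h := by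
  obtain ⟨p, t, r, h1, h2, h3⟩ := exists_cancellation g.toWord h.toWord isReduced_toWord
    isReduced_toWord
  have hg : g = FreeGroup.mk p * FreeGroup.mk t := by
    rw [mul_mk, ← h1, mk_toWord]
  have hh : h = (FreeGroup.mk t)⁻¹ * FreeGroup.mk r := by
    rw [inv_mk, mul_mk, ← h2, mk_toWord]
  have hgh : g * h = FreeGroup.mk (p ++ r) := by
    rw [hg, hh, ← mul_mk]
    group
  have hw : (g * h).toWord = p ++ r := by
    rw [hgh, toWord_mk, h3.reduce_eq]
  have e1 : freePrefix p.length (g * h) = FreeGroup.mk p := by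
    simp [freePrefix, hw]
  have e2 : freePrefix p.length g = FreeGroup.mk p := by
    simp [freePrefix, h1]
  have e3 : freePrefix t.length h = (FreeGroup.mk t)⁻¹ := by
    rw [freePrefix, h2, inv_mk, ← invRev_length (L₁ := t), List.take_left]
  refine ⟨p.length, t.length, ?_, by rw [e1, e2], ?_⟩
  · rw [FreeGroup.norm, h1, List.length_append]
  · rw [e1, e3, hg, hh]
    group

end FreeGroup

/-! ### The Connes-Moscovici seminorms and polynomially bounded maps -/

section Estimates

variable {G : Type u} [Group G] {H : Type u} [Group H]

/-- The length function `L` dominates an integer-valued length `ℓ` for which elements have prefixes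
`τ i g` with the cancellation property of free groups: in a product `g * h`, a prefix of `g`
survives, followed by what remains of `h` after removing a prefix, and the lengths of the two
prefixes add up to `ℓ g`. This is all that Haagerup's inequality needs. -/
def WordLength.DominatesCancellation (L : WordLength G) : Prop :=
  ∃ (ℓ : G → ℕ) (τ : ℕ → G → G), (∀ g, (ℓ g : ℝ) ≤ L g) ∧
    ∀ g h, ∃ i j, i + j = ℓ g ∧ τ i g = τ i (g * h) ∧
      (τ i (g * h))⁻¹ * (g * h) = (τ j h)⁻¹ * h

theorem IsFreeWithProperWordMetric.dominatesCancellation {L : WordLength G}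
    (h : IsFreeWithProperWordMetric L) : L.DominatesCancellation := by
  classical
  obtain ⟨ι, _, b, w, hw, -, hL⟩ := h
  refine ⟨fun g => (b.repr g).norm, fun i g => b.repr.symm (freePrefix i (b.repr g)),
    fun g => ?_, fun g h => ?_⟩
  · obtain ⟨n, hn, ⟨l, hl, rfl⟩, -⟩ := hL g
    rw [hn, Nat.cast_le]
    dsimp only
    rw [← hl]
    refine FreeGroup.norm_mk_le.trans ?_
    rw [← List.length_map (f := fun y : ι × Bool => w y.1)]
    refine List.length_le_sum_of_one_le _ fun m hm => ?_
    obtain ⟨y, -, rfl⟩ := List.mem_map.1 hm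
    exact hw _
  · obtain ⟨i, j, h1, h2, h3⟩ := exists_freePrefix_eq (b.repr g) (b.repr h)
    refine ⟨i, j, h1, by
      dsimp only
      rw [map_mul, h2], ?_⟩
    apply b.repr.injective
    simpa using h3

theorem derivOp_apply (L : WordLength G) (i : ℕ) (a : MonoidAlgebra ℂ G) (ξ : Ell2 G) (x : G) :
    (derivOp L i a ξ : Ell2 G) x = ∑ g ∈ a.coeff.support,
      a.coeff g * (((L x - L (g⁻¹ * x) : ℝ) : ℂ) ^ i * ξ (g⁻¹ * x)) := by
  have : derivOp L i a = ∑ g ∈ a.coeff.support, a.coeff g • unitDeriv L i g := rfl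
  rw [this, coe_sum_apply]
  rfl

/-- The norm of `∂_L^i(a)` bounds that of its value at `δ_1`. -/
theorem sum_sq_le_norm_derivOp_sq (L : WordLength G) (i : ℕ) (a : MonoidAlgebra ℂ G) :
    ∑ g ∈ a.coeff.support, (L g ^ i * ‖a.coeff g‖) ^ 2 ≤ ‖derivOp L i a‖ ^ 2 := by
  classical
  set δ : Ell2 G := lp.single 2 1 (1 : ℂ) with hδ
  have hδ1 : δ 1 = 1 := lp.single_apply_self (E := fun _ : G => ℂ) 2 1 1
  have hδ0 : ∀ x, x ≠ 1 → δ x = 0 := fun x hx => lp.single_apply_ne (E := fun _ : G => ℂ) 2 1 1 hx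
  have hnorm : ‖δ‖ = 1 := by
    rw [hδ, lp.norm_single (by norm_num)]
    simp
  have hval : ∀ x ∈ a.coeff.support,
      ‖(derivOp L i a δ : Ell2 G) x‖ = L x ^ i * ‖a.coeff x‖ := by
    intro x hx
    rw [derivOp_apply, Finset.sum_eq_single_of_mem x hx]
    · rw [inv_mul_cancel, hδ1, L.one, mul_one, sub_zero, norm_mul, norm_pow, Complex.norm_real,
        Real.norm_of_nonneg (L.nonneg x), mul_comm]
    · intro g _ hg
      rw [hδ0, mul_zero, mul_zero]
      intro h
      exact hg (inv_mul_eq_one.1 h)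
  have h1 := lp.sum_rpow_le_norm_rpow (p := 2) (by norm_num) (derivOp L i a δ) a.coeff.support
  have h2 : ‖derivOp L i a δ‖ ≤ ‖derivOp L i a‖ := by
    simpa [hnorm] using (derivOp L i a).le_opNorm δ
  simp only [ENNReal.toReal_ofNat, Real.rpow_two] at h1
  rw [← Finset.sum_congr rfl fun x hx => congrArg (· ^ 2) (hval x hx)]
  exact h1.trans (pow_le_pow_left₀ (norm_nonneg _) h2 2)

/-- Haagerup's inequality for the operators `∂_L^i(a)`: their norms are controlled by weighted
`ℓ²`-norms. -/
theorem norm_derivOp_sq_le {L : WordLength G} (hL : L.DominatesCancellation) (i : ℕ)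
    (a : MonoidAlgebra ℂ G) :
    ‖derivOp L i a‖ ^ 2 ≤
      4 * ∑ g ∈ a.coeff.support, (1 + L g) ^ 5 * (L g ^ i * ‖a.coeff g‖) ^ 2 := by
  obtain ⟨ℓ, τ, hℓ, hτ⟩ := hL
  set K : ℝ := 4 * ∑ g ∈ a.coeff.support, (1 + L g) ^ 5 * (L g ^ i * ‖a.coeff g‖) ^ 2 with hK
  have hK0 : 0 ≤ K := mul_nonneg (by norm_num) (Finset.sum_nonneg fun g _ =>
    mul_nonneg (pow_nonneg (add_nonneg zero_le_one (L.nonneg g)) _) (sq_nonneg _))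
  suffices h : ‖derivOp L i a‖ ≤ √K by
    calc ‖derivOp L i a‖ ^ 2 ≤ √K ^ 2 := pow_le_pow_left₀ (norm_nonneg _) h 2
      _ = K := Real.sq_sqrt hK0
  refine ContinuousLinearMap.opNorm_le_bound _ (Real.sqrt_nonneg _) fun ξ => ?_
  refine lp.norm_le_of_forall_sum_le (by norm_num) (by positivity) fun F => ?_
  simp only [ENNReal.toReal_ofNat, Real.rpow_two]
  rw [mul_pow, Real.sq_sqrt hK0]
  have hM : ∀ t : Finset G, ∑ h ∈ t, ‖ξ h‖ ^ 2 ≤ ‖ξ‖ ^ 2 := by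
    intro t
    simpa using lp.sum_rpow_le_norm_rpow (p := 2) (by norm_num) ξ t
  have hc : ∀ g, 0 ≤ L g ^ i * ‖a.coeff g‖ := fun g =>
    mul_nonneg (pow_nonneg (L.nonneg g) i) (norm_nonneg _)
  have key := sum_sq_convolution_le ℓ τ hτ a.coeff.support F (fun g => L g ^ i * ‖a.coeff g‖)
    (fun h => ‖ξ h‖) hc (fun h => norm_nonneg _) _ hM
  refine (Finset.sum_le_sum fun x _ => ?_).trans (key.trans ?_)
  · refine pow_le_pow_left₀ (norm_nonneg _) ?_ 2
    rw [derivOp_apply]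
    refine (norm_sum_le _ _).trans (Finset.sum_le_sum fun g _ => ?_)
    rw [norm_mul, norm_mul, ← mul_assoc, mul_comm (L g ^ i)]
    exact mul_le_mul_of_nonneg_right
      (mul_le_mul_of_nonneg_left (L.norm_sub_pow_le g i x) (norm_nonneg _)) (norm_nonneg _)
  · rw [hK]
    refine mul_le_mul_of_nonneg_right (mul_le_mul_of_nonneg_left ?_ (by norm_num)) (by positivity)
    refine Finset.sum_le_sum fun g _ => mul_le_mul_of_nonneg_right ?_ (sq_nonneg _)
    exact pow_le_pow_left₀ (by positivity) (by linarith [hℓ g]) 5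

theorem norm_derivOp_le_eta (L : WordLength G) {i m : ℕ} (h : i ≤ m) (a : MonoidAlgebra ℂ G) :
    ‖derivOp L i a‖ ≤ eta L m a := by
  rw [eta_apply]
  refine le_trans ?_ (Finset.single_le_sum
    (f := fun i => (m.choose i : ℝ) * ‖derivOp L i a‖) (fun _ _ => by positivity)
    (Finset.mem_range.2 (Nat.lt_succ_of_le h)))
  exact le_mul_of_one_le_left (norm_nonneg _) (by exact_mod_cast Nat.choose_pos h)

/-- The seminorm `η_m` dominates the `ℓ²`-norm with weight `(1 + L)^m`. This holds for every
word-length. -/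
theorem sum_one_add_pow_mul_sq_le (L : WordLength G) (m : ℕ) (a : MonoidAlgebra ℂ G) :
    ∑ g ∈ a.coeff.support, (1 + L g) ^ (2 * m) * ‖a.coeff g‖ ^ 2 ≤
      2 ^ (2 * m + 1) * eta L m a ^ 2 := by
  have h0 : ∀ i ≤ m, ∑ g ∈ a.coeff.support, (L g ^ i * ‖a.coeff g‖) ^ 2 ≤ eta L m a ^ 2 :=
    fun i hi => (sum_sq_le_norm_derivOp_sq L i a).trans
      (pow_le_pow_left₀ (norm_nonneg _) (norm_derivOp_le_eta L hi a) 2)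
  have h1 : ∀ g, (1 + L g) ^ (2 * m) ≤ 2 ^ (2 * m) * ((L g ^ 0) ^ 2 + (L g ^ m) ^ 2) := by
    intro g
    refine (add_pow_le zero_le_one (L.nonneg g) _).trans ?_
    rw [one_pow, pow_zero, one_pow, ← pow_mul, mul_comm m 2]
    refine mul_le_mul_of_nonneg_right (pow_le_pow_right₀ (by norm_num) (Nat.sub_le _ _)) ?_
    have := pow_nonneg (L.nonneg g) (2 * m)
    positivity
  calc _ ≤ ∑ g ∈ a.coeff.support, 2 ^ (2 * m) *
        ((L g ^ 0 * ‖a.coeff g‖) ^ 2 + (L g ^ m * ‖a.coeff g‖) ^ 2) := by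
        refine Finset.sum_le_sum fun g _ => ?_
        rw [mul_pow, mul_pow, ← add_mul, ← mul_assoc]
        exact mul_le_mul_of_nonneg_right (h1 g) (sq_nonneg _)
    _ ≤ 2 ^ (2 * m) * (eta L m a ^ 2 + eta L m a ^ 2) := by
        rw [← Finset.mul_sum, Finset.sum_add_distrib]
        exact mul_le_mul_of_nonneg_left (add_le_add (h0 0 (Nat.zero_le _)) (h0 m le_rfl))
          (by positivity)
    _ = _ := by ring

theorem PolyBounded.exists_le_one_add_pow {LG : WordLength G} {LH : WordLength H} {f : G → H}
    (h : PolyBounded LG LH f) :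
    ∃ (C : ℝ) (N : ℕ), 1 ≤ C ∧ ∀ g, 1 + LH (f g) ≤ C * (1 + LG g) ^ N := by
  obtain ⟨p, hp⟩ := h
  have hS : 0 ≤ ∑ i ∈ Finset.range (p.natDegree + 1), |p.coeff i| :=
    Finset.sum_nonneg fun _ _ => abs_nonneg _
  refine ⟨1 + ∑ i ∈ Finset.range (p.natDegree + 1), |p.coeff i|, p.natDegree, by linarith,
    fun g => ?_⟩
  have h1 : 1 ≤ 1 + LG g := by linarith [LG.nonneg g]
  rw [add_mul, one_mul]
  refine add_le_add (one_le_pow₀ h1) ((hp g).trans ?_)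
  rw [Polynomial.eval_eq_sum_range, Finset.sum_mul]
  refine Finset.sum_le_sum fun i hi => mul_le_mul (le_abs_self _) ?_ (pow_nonneg (LG.nonneg g) _)
    (abs_nonneg _)
  exact (pow_le_pow_left₀ (LG.nonneg g) (by linarith) i).trans
    (pow_le_pow_right₀ h1 (Nat.lt_succ_iff.1 (Finset.mem_range.1 hi)))

theorem polyBounded_of_le_one_add_pow {LG : WordLength G} {LH : WordLength H} {f : G → H}
    (C : ℝ) (N : ℕ) (h : ∀ g, LH (f g) ≤ C * (1 + LG g) ^ N) : PolyBounded LG LH f :=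
  ⟨Polynomial.C C * (1 + Polynomial.X) ^ N, fun g => by simpa using h g⟩

theorem PolyBounded.comp {K : Type u} [Group K] {LG : WordLength G} {LH : WordLength H}
    {LK : WordLength K} {f : G → H} {k : H → K} (hk : PolyBounded LH LK k)
    (hf : PolyBounded LG LH f) : PolyBounded LG LK (fun g => k (f g)) := by
  obtain ⟨C, N, hC, h1⟩ := hf.exists_le_one_add_pow
  obtain ⟨D, M, hD, h2⟩ := hk.exists_le_one_add_pow
  refine polyBounded_of_le_one_add_pow (D * C ^ M) (N * M) fun g => ?_
  have h3 : 1 + LK (k (f g)) ≤ D * (C * (1 + LG g) ^ N) ^ M :=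
    (h2 (f g)).trans (mul_le_mul_of_nonneg_left
      (pow_le_pow_left₀ (add_nonneg zero_le_one (LH.nonneg _)) (h1 g) M) (by linarith))
  rw [mul_pow, ← pow_mul, ← mul_assoc] at h3
  linarith

theorem PolyBounded.mul {LG : WordLength G} {LH : WordLength H} {f k : G → H}
    (hf : PolyBounded LG LH f) (hk : PolyBounded LG LH k) :
    PolyBounded LG LH (fun g => f g * k g) := by
  obtain ⟨p, hp⟩ := hf
  obtain ⟨q, hq⟩ := hk
  refine ⟨p + q, fun g => (LH.mul_le _ _).trans ?_⟩
  rw [Polynomial.eval_add]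
  exact add_le_add (hp g) (hq g)

theorem PolyBounded.inv {LG : WordLength G} {LH : WordLength H} {f : G → H}
    (hf : PolyBounded LG LH f) : PolyBounded LG LH (fun g => (f g)⁻¹) := by
  obtain ⟨p, hp⟩ := hf
  exact ⟨p, fun g => (LH.inv _).trans_le (hp g)⟩

theorem polyBounded_id (LG : WordLength G) : PolyBounded LG LG (fun g => g) :=
  ⟨Polynomial.X, fun g => by simp⟩

theorem polyBounded_const (LG : WordLength G) (LH : WordLength H) (c : H) :
    PolyBounded LG LH (fun _ => c) :=
  ⟨Polynomial.C (LH c), fun g => by simp⟩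

/-- An injective polynomially bounded map into a group with Haagerup's inequality is continuous in
the Connes-Moscovici seminorms, although it need not be a homomorphism: in the target the seminorms
are bounded above by weighted `ℓ²`-norms, and in the source they always are bounded below by such
norms. -/
theorem exists_eta_mapDomain_le {LG : WordLength G} {LH : WordLength H}
    (hL : LH.DominatesCancellation) {f : G → H} (hf : Function.Injective f)
    (hp : PolyBounded LG LH f) (j : ℕ) :
    ∃ (C : ℝ) (m : ℕ), 0 ≤ C ∧ ∀ a : MonoidAlgebra ℂ G,
      eta LH j (MonoidAlgebra.mapDomainLinearMap ℂ ℂ f a) ≤ C * eta LG m a := by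
  classical
  obtain ⟨C, N, hC, hCN⟩ := hp.exists_le_one_add_pow
  -- `(1 + L) ^ 5 * L ^ (2 * i)` is at most `(1 + L) ^ (2 * (3 + j))` for `i ≤ j`
  set m := N * (3 + j) with hm
  set D : ℝ := 4 * (C ^ (2 * (3 + j)) * 2 ^ (2 * m + 1)) with hD
  have hD1 : 1 ≤ D := by
    have h1 : 1 ≤ C ^ (2 * (3 + j)) := one_le_pow₀ hC
    have h2 : (1 : ℝ) ≤ 2 ^ (2 * m + 1) := one_le_pow₀ (by norm_num)
    have := one_le_mul_of_one_le_of_one_le h1 h2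
    linarith
  refine ⟨2 ^ j * D, m, by positivity, fun a => ?_⟩
  set b := MonoidAlgebra.mapDomainLinearMap ℂ ℂ f a with hb
  have hbc : b.coeff = a.coeff.mapDomain f := rfl
  have hbound : ∀ i ≤ j, ‖derivOp LH i b‖ ≤ D * eta LG m a := by
    intro i hi
    have h1 := norm_derivOp_sq_le hL i b
    rw [hbc, Finsupp.mapDomain_support_of_injective hf,
      Finset.sum_image fun _ _ _ _ h => hf h] at h1
    have h2 : ∀ g ∈ a.coeff.support,
        (1 + LH (f g)) ^ 5 * (LH (f g) ^ i * ‖a.coeff.mapDomain f (f g)‖) ^ 2 ≤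
          C ^ (2 * (3 + j)) * ((1 + LG g) ^ (2 * m) * ‖a.coeff g‖ ^ 2) := by
      intro g _
      have h3 : 0 ≤ LH (f g) := LH.nonneg _
      rw [Finsupp.mapDomain_apply hf, mul_pow, ← mul_assoc, ← mul_assoc]
      refine mul_le_mul_of_nonneg_right ?_ (sq_nonneg _)
      calc (1 + LH (f g)) ^ 5 * (LH (f g) ^ i) ^ 2
          ≤ (1 + LH (f g)) ^ 5 * ((1 + LH (f g)) ^ i) ^ 2 := by
            refine mul_le_mul_of_nonneg_left ?_ (by positivity)
            exact pow_le_pow_left₀ (by positivity) (pow_le_pow_left₀ h3 (by linarith) i) 2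
        _ = (1 + LH (f g)) ^ (5 + i * 2) := by rw [← pow_mul, ← pow_add]
        _ ≤ (1 + LH (f g)) ^ (2 * (3 + j)) := pow_le_pow_right₀ (by linarith) (by omega)
        _ ≤ (C * (1 + LG g) ^ N) ^ (2 * (3 + j)) := pow_le_pow_left₀ (by linarith) (hCN g) _
        _ = _ := by
            rw [mul_pow, ← pow_mul, hm]
            congr 2
            ring
    have h4 : ‖derivOp LH i b‖ ^ 2 ≤ D * eta LG m a ^ 2 := by
      refine h1.trans ?_
      rw [hD, mul_assoc, mul_assoc]
      refine mul_le_mul_of_nonneg_left ((Finset.sum_le_sum h2).trans ?_) (by norm_num)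
      rw [← Finset.mul_sum]
      exact mul_le_mul_of_nonneg_left (sum_one_add_pow_mul_sq_le LG m a) (by positivity)
    have h5 : 0 ≤ eta LG m a := apply_nonneg _ _
    refine le_of_sq_le_sq ?_ (by positivity)
    refine h4.trans ?_
    rw [mul_pow]
    exact mul_le_mul_of_nonneg_right (by nlinarith) (sq_nonneg _)
  rw [eta_apply]
  calc _ ≤ ∑ i ∈ Finset.range (j + 1), (j.choose i : ℝ) * (D * eta LG m a) :=
        Finset.sum_le_sum fun i hi => mul_le_mul_of_nonneg_left
          (hbound i (Nat.lt_succ_iff.1 (Finset.mem_range.1 hi))) (Nat.cast_nonneg _)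
    _ = _ := by
        rw [← Finset.sum_mul, ← Nat.cast_sum, Nat.sum_range_choose]
        push_cast
        ring

end Estimates

/-! ### Completions in families of seminorms -/

open Filter Topology in
/-- The seminorms that define the topology of a space extend to its completion, and define the
topology of the completion. -/
theorem exists_withSeminorms_completion {E : Type u} [AddCommGroup E] [Module ℂ E] [UniformSpace E]
    [IsUniformAddGroup E] [UniformContinuousConstSMul ℂ E] {ι : Type v} (p : SeminormFamily ℂ E ι)
    (hp : WithSeminorms p) : ∃ q : SeminormFamily ℂ (UniformSpace.Completion E) ι,
      WithSeminorms q ∧ ∀ i (x : E), q i (x : UniformSpace.Completion E) = p i x := by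
  have hpu : ∀ i, UniformContinuous (p i) := fun i =>
    Seminorm.uniformContinuous_of_continuousAt_zero (hp.continuous_seminorm i).continuousAt
  have hcont : ∀ i, Continuous (UniformSpace.Completion.extension (p i)) := fun i =>
    UniformSpace.Completion.continuous_extension
  have hcoe : ∀ i (x : E), UniformSpace.Completion.extension (p i)
      (x : UniformSpace.Completion E) = p i x := fun i x =>
    UniformSpace.Completion.extension_coe (hpu i) x
  let q : SeminormFamily ℂ (UniformSpace.Completion E) ι := fun i =>
    Seminorm.of (UniformSpace.Completion.extension (p i))
      (fun x y => by
        refine UniformSpace.Completion.induction_on₂ x y ?_ fun a b => ?_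
        · exact isClosed_le ((hcont i).comp (continuous_fst.add continuous_snd))
            (((hcont i).comp continuous_fst).add ((hcont i).comp continuous_snd))
        · rw [← UniformSpace.Completion.coe_add, hcoe, hcoe, hcoe]
          exact map_add_le_add _ _ _)
      (fun c x => by
        refine UniformSpace.Completion.induction_on x ?_ fun a => ?_
        · exact isClosed_eq ((hcont i).comp (continuous_const_smul c))
            ((hcont i).const_smul ‖c‖)
        · rw [← UniformSpace.Completion.coe_smul, hcoe, hcoe]
          exact map_smul_eq_mul _ _ _)
  have hq : ∀ i x, q i x = UniformSpace.Completion.extension (p i) x := fun i x => rfl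
  have hqc : ∀ i, Continuous (q i) := hcont
  have hqcoe : ∀ i (x : E), q i (x : UniformSpace.Completion E) = p i x := hcoe
  refine ⟨q, ?_, hqcoe⟩
  rw [SeminormFamily.withSeminorms_iff_nhds_eq_iInf]
  refine le_antisymm ?_ ?_
  · refine le_iInf fun i => tendsto_iff_comap.1 ?_
    have := (hqc i).tendsto 0
    rwa [map_zero] at this
  · have hb := (hp.hasBasis_ball (x := 0)).hasBasis_of_isDenseInducing
      UniformSpace.Completion.isDenseInducing_coe
    rw [UniformSpace.Completion.coe_zero] at hb
    rw [hb.ge_iff]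
    rintro ⟨s, r⟩ hr
    -- the open set of small elements lies in the closure of its trace on the dense subspace
    have hO : IsOpen {x : UniformSpace.Completion E | ∀ i ∈ s, q i x < r} := by
      simp only [Set.ofPred_forall]
      exact isOpen_biInter_finset fun i _ => isOpen_lt (hqc i) continuous_const
    have hsub : {x : UniformSpace.Completion E | ∀ i ∈ s, q i x < r} ⊆
        closure ((fun x : E => (x : UniformSpace.Completion E)) '' (s.sup p).ball 0 r) := by
      intro x hx
      refine closure_mono ?_
        (UniformSpace.Completion.denseRange_coe.open_subset_closure_inter hO hx)
      rintro _ ⟨hy, a, rfl⟩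
      refine ⟨a, ?_, rfl⟩
      rw [Seminorm.mem_ball_zero]
      refine Seminorm.finset_sup_apply_lt hr fun i hi => ?_
      rw [← hqcoe]
      exact hy i hi
    refine mem_of_superset ?_ hsub
    have : {x : UniformSpace.Completion E | ∀ i ∈ s, q i x < r} =
        ⋂ i ∈ s, {x : UniformSpace.Completion E | q i x < r} := by
      ext x
      simp
    rw [this]
    refine (biInter_finset_mem s).2 fun i _ => mem_iInf_of_mem i ?_
    exact mem_of_superset (preimage_mem_comap (Iio_mem_nhds hr)) fun x hx => hx

section FamilyCompletion

variable {A : Type u} [Ring A] [Algebra ℂ A] {ι : Type v} (S : SubmulFamily A ι)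

/-- Only countably many of the seminorms `S i` are used, so that the completion is metrizable. -/
theorem isFrechetAlgebra_familyCompletion [Countable ι] [Nonempty ι] :
    IsFrechetAlgebra (FamilyCompletion S) := by
  obtain ⟨q, hq, hqp⟩ := exists_withSeminorms_completion _ (withSeminorms_withFamily S)
  obtain ⟨e, he⟩ := exists_surjective_nat ι
  refine ⟨inferInstance, inferInstance, inferInstance, fun n => q (e n), ?_, fun n a b => ?_⟩
  · rw [SeminormFamily.withSeminorms_iff_nhds_eq_iInf] at hq ⊢
    rw [hq]
    exact (he.iInf_comp fun i => (nhds (0 : ℝ)).comap (q i)).symm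
  · have hc := hq.continuous_seminorm (e n)
    refine UniformSpace.Completion.induction_on₂ a b ?_ fun a b => ?_
    · exact isClosed_le (hc.comp (continuous_fst.mul continuous_snd))
        ((hc.comp continuous_fst).mul (hc.comp continuous_snd))
    · rw [← UniformSpace.Completion.coe_mul, hqp, hqp, hqp]
      exact S.mul_le _ _ _

variable {S} {B : Type u} [Ring B] [Algebra ℂ B] {κ : Type w} {T : SubmulFamily B κ}

theorem familyMap_coe (φ : A →ₐ[ℂ] B) (h : ∀ j, ∃ i, ∀ a, T.toFamily j (φ a) = S.toFamily i a)
    (a : A) : familyMap S T φ h (toFamilyCompletion S a) = toFamilyCompletion T (φ a) :=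
  UniformSpace.Completion.mapRingHom_coe (continuous_withFamily S T φ h)
    (f := (show WithFamily S →+* WithFamily T from φ.toRingHom)) a

theorem continuous_familyMap (φ : A →ₐ[ℂ] B)
    (h : ∀ j, ∃ i, ∀ a, T.toFamily j (φ a) = S.toFamily i a) : Continuous (familyMap S T φ h) :=
  (familyMap S T φ h).cont

theorem eq_of_forall_toFamilyCompletion {Y : Type*} [TopologicalSpace Y] [T2Space Y]
    {f g : FamilyCompletion S → Y} (hf : Continuous f) (hg : Continuous g)
    (h : ∀ a : A, f (toFamilyCompletion S a) = g (toFamilyCompletion S a))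
    (x : FamilyCompletion S) : f x = g x :=
  congrFun (UniformSpace.Completion.ext hf hg h) x

/-- Mutually inverse homomorphisms that pull back seminorms of either family to seminorms of the
other induce an isomorphism of the completions. -/
theorem exists_continuousAlgEquiv_of_inverse (φ : A →ₐ[ℂ] B) (ψ : B →ₐ[ℂ] A)
    (hφ : ∀ j, ∃ i, ∀ a, T.toFamily j (φ a) = S.toFamily i a)
    (hψ : ∀ i, ∃ j, ∀ b, S.toFamily i (ψ b) = T.toFamily j b)
    (h1 : ∀ a, ψ (φ a) = a) (h2 : ∀ b, φ (ψ b) = b) :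
    ∃ e : FamilyCompletion S ≃A[ℂ] FamilyCompletion T,
      ∀ a, e (toFamilyCompletion S a) = toFamilyCompletion T (φ a) := by
  have h3 : ∀ x, familyMap T S ψ hψ (familyMap S T φ hφ x) = x :=
    eq_of_forall_toFamilyCompletion
      ((continuous_familyMap ψ hψ).comp (continuous_familyMap φ hφ)) continuous_id
      fun a => by simp only [familyMap_coe, h1]
  have h4 : ∀ x, familyMap S T φ hφ (familyMap T S ψ hψ x) = x :=
    eq_of_forall_toFamilyCompletion
      ((continuous_familyMap φ hφ).comp (continuous_familyMap ψ hψ)) continuous_id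
      fun a => by simp only [familyMap_coe, h2]
  exact ⟨{ AlgEquiv.ofAlgHom (familyMap S T φ hφ).toAlgHom (familyMap T S ψ hψ).toAlgHom
            (AlgHom.ext h4) (AlgHom.ext h3) with
          continuous_toFun := (familyMap S T φ hφ).cont
          continuous_invFun := (familyMap T S ψ hψ).cont }, fun a => familyMap_coe φ hφ a⟩

end FamilyCompletion

section SimplicialAlgebra

variable (Γ : AugOp ⥤ GrpCat.{u}) (L : ∀ X, WordLength (Γ.obj X))

instance : Countable AugOp :=
  Function.Injective.countable (f := fun X : AugOp => match X.unop with
    | WithInitial.of n => some n.len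
    | WithInitial.star => none) (by
      rintro ⟨_ | _⟩ ⟨_ | _⟩ h
      · simp only [Option.some.injEq] at h
        rw [SimplexCategory.ext h]
      · simp at h
      · simp at h
      · rfl)

instance (X Y : AugOp) : Countable (X ⟶ Y) := by
  have : Countable (Y.unop ⟶ X.unop) := by
    rcases X with ⟨x | _⟩ <;> rcases Y with ⟨y | _⟩
    · exact Function.Injective.countable (f := fun f : y ⟶ x => (f.toOrderHom : _ → _))
        fun f g h => SimplexCategory.Hom.ext _ _ (DFunLike.coe_injective h)
    · exact inferInstanceAs (Countable PUnit)
    · exact inferInstanceAs (Countable PEmpty)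
    · exact inferInstanceAs (Countable PUnit)
  exact Function.Injective.countable (f := fun f : X ⟶ Y => f.unop) Quiver.Hom.unop_inj

theorem isFrechetAlgebra_HCM (X : AugOp) : IsFrechetAlgebra (HCM Γ L X) := by
  have : Nonempty (CMIndex X) := ⟨⟨X, 𝟙 X, 0⟩⟩
  exact isFrechetAlgebra_familyCompletion _

theorem groupAlgMap_id (X : AugOp) (a : MonoidAlgebra ℂ (Γ.obj X)) :
    groupAlgMap Γ (𝟙 X) a = a := by
  induction a using MonoidAlgebra.induction_linear with
  | zero => simp
  | add a b ha hb => simp only [map_add, ha, hb]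
  | single x c => simp [groupAlgMap]

variable {Γ L}

theorem HCM.map_coe {X Y : AugOp} (f : X ⟶ Y) (a : MonoidAlgebra ℂ (Γ.obj X)) :
    HCM.map Γ L f (toFamilyCompletion (cmFamily Γ L X) a) =
      toFamilyCompletion (cmFamily Γ L Y) (groupAlgMap Γ f a) :=
  familyMap_coe _ _ a

theorem HCM.continuous_map {X Y : AugOp} (f : X ⟶ Y) : Continuous (HCM.map Γ L f) :=
  (HCM.map Γ L f).cont

theorem HCM.map_id (X : AugOp) (x : HCM Γ L X) : HCM.map Γ L (𝟙 X) x = x :=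
  eq_of_forall_toFamilyCompletion (HCM.continuous_map (𝟙 X)) continuous_id
    (fun a => by rw [HCM.map_coe, groupAlgMap_id, id]) x

theorem HCM.map_comp {X Y Z : AugOp} (f : X ⟶ Y) (g : Y ⟶ Z) (x : HCM Γ L X) :
    HCM.map Γ L (f ≫ g) x = HCM.map Γ L g (HCM.map Γ L f x) :=
  eq_of_forall_toFamilyCompletion (HCM.continuous_map (f ≫ g))
    ((HCM.continuous_map g).comp (HCM.continuous_map f))
    (fun a => by
      rw [Function.comp_apply, HCM.map_coe, HCM.map_coe, HCM.map_coe, groupAlgMap_comp]) x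

theorem cmFamily_apply {X : AugOp} (i : CMIndex X) (a : MonoidAlgebra ℂ (Γ.obj X)) :
    (cmFamily Γ L X).toFamily i a = eta (L i.1) i.2.2 (groupAlgMap Γ i.2.1 a) :=
  rfl

/-- The object `[-1]` is initial in the augmented simplex category, so that the only seminorms in
this degree are the `η_j`. -/
theorem exists_HCM_degNegOne_equiv : ∃ e : HCM Γ L degNegOne ≃A[ℂ] CMAlgebra (L degNegOne),
    ∀ a, e (toFamilyCompletion (cmFamily Γ L degNegOne) a) =
      toFamilyCompletion (etaFamily (L degNegOne)) a := by
  have h1 : ∀ j, ∃ i : CMIndex degNegOne, ∀ a, (etaFamily (L degNegOne)).toFamily j a =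
      (cmFamily Γ L degNegOne).toFamily i a := fun j =>
    ⟨⟨degNegOne, 𝟙 _, j⟩, fun a => by
      rw [cmFamily_apply, groupAlgMap_id]
      rfl⟩
  have h2 : ∀ i : CMIndex degNegOne, ∃ j, ∀ a, (cmFamily Γ L degNegOne).toFamily i a =
      (etaFamily (L degNegOne)).toFamily j a := by
    rintro ⟨Y, f, j⟩
    obtain rfl : Y = degNegOne := by
      rcases Y with ⟨y | _⟩
      · exact PEmpty.elim f.unop
      · rfl
    obtain rfl : f = 𝟙 degNegOne := Quiver.Hom.unop_inj (WithInitial.starInitial.hom_ext _ _)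
    refine ⟨j, fun a => ?_⟩
    rw [cmFamily_apply, groupAlgMap_id]
    rfl
  exact exists_continuousAlgEquiv_of_inverse (AlgHom.id ℂ _) (AlgHom.id ℂ _) h1 h2
    (fun _ => rfl) (fun _ => rfl)

end SimplicialAlgebra

/-! ### The Connes-Moscovici algebra as an algebra of operators -/

section EtaSeq

variable {G : Type u}

theorem etaSeq_sub_le (m : ℕ) (S S' : ℕ → Bdd G) :
    etaSeq m (S - S') ≤ etaSeq m S + etaSeq m S' := by
  simp only [etaSeq, ← Finset.sum_add_distrib, ← mul_add]
  exact Finset.sum_le_sum fun i _ => mul_le_mul_of_nonneg_left (norm_sub_le _ _) (Nat.cast_nonneg _)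

theorem etaSeq_mono {m n : ℕ} (h : m ≤ n) (S : ℕ → Bdd G) : etaSeq m S ≤ etaSeq n S := by
  refine (Finset.sum_le_sum fun i _ => mul_le_mul_of_nonneg_right
    (Nat.cast_le.2 (Nat.choose_le_choose i h)) (norm_nonneg _)).trans ?_
  exact Finset.sum_le_sum_of_subset_of_nonneg
    (Finset.range_mono (Nat.succ_le_succ h)) fun _ _ _ => by positivity

theorem norm_le_etaSeq {i m : ℕ} (h : i ≤ m) (S : ℕ → Bdd G) : ‖S i‖ ≤ etaSeq m S := by
  refine le_trans ?_ (Finset.single_le_sum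
    (f := fun i => (m.choose i : ℝ) * ‖S i‖) (fun _ _ => by positivity)
    (Finset.mem_range.2 (Nat.lt_succ_of_le h)))
  exact le_mul_of_one_le_left (norm_nonneg _) (by exact_mod_cast Nat.choose_pos h)

end EtaSeq

section Realization

variable {G : Type u} [Group G] {L : WordLength G}

theorem IsDeriv.sub {T T' S S' : Bdd G} (h : IsDeriv L T S) (h' : IsDeriv L T' S') :
    IsDeriv L (T - T') (S - S') := by
  intro x y
  have h1 := h x y
  have h2 := h' x y
  simp only [sub_apply, lp.coeFn_sub, Pi.sub_apply]
  rw [h1, h2]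
  ring

/-- A bounded operator is determined by its values on the basis vectors `δ_y`. -/
theorem IsDeriv.unique {T S S' : Bdd G} (h : IsDeriv L T S) (h' : IsDeriv L T S') : S = S' := by
  classical
  refine lp.ext_continuousLinearMap (by norm_num) fun y => ?_
  refine ContinuousLinearMap.ext_ring ?_
  refine lp.ext (funext fun x => ?_)
  have h1 := h x y
  rw [← h' x y] at h1
  exact h1

theorem IsDerivSeq.sub {T T' : Bdd G} {S S' : ℕ → Bdd G} (h : IsDerivSeq L T S)
    (h' : IsDerivSeq L T' S') : IsDerivSeq L (T - T') (S - S') :=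
  ⟨by rw [Pi.sub_apply, h.1, h'.1], fun i => (h.2 i).sub (h'.2 i)⟩

theorem IsDerivSeq.unique {T : Bdd G} {S S' : ℕ → Bdd G} (h : IsDerivSeq L T S)
    (h' : IsDerivSeq L T S') : S = S' := by
  funext i
  induction i with
  | zero => rw [h.1, h'.1]
  | succ i ih =>
    have h1 := h.2 i
    rw [ih] at h1
    exact h1.unique (h'.2 i)

/-- The matrix coefficients that enter `IsDeriv` are continuous functions of the operators. -/
theorem isClosed_isDeriv {X : Type*} [TopologicalSpace X] {T S : X → Bdd G} (hT : Continuous T)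
    (hS : Continuous S) : IsClosed {a | IsDeriv L (T a) (S a)} := by
  classical
  have hev : ∀ {R : X → Bdd G} (_ : Continuous R) (ξ : Ell2 G) (x : G),
      Continuous fun a => (R a ξ : Ell2 G) x := fun {R} hR ξ x =>
    (lp.evalCLM ℂ (fun _ : G => ℂ) 2 x).continuous.comp (hR.clm_apply continuous_const)
  simp only [IsDeriv, Set.ofPred_forall]
  exact isClosed_iInter fun x => isClosed_iInter fun y =>
    isClosed_eq (hev hS _ x) ((continuous_const.mul (hev hT _ x)).sub (hev hT _ x))

variable (L)

/-- `∂_L^i`, as a continuous linear map on the topologized group algebra. -/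
noncomputable def derivCLM (i : ℕ) : WithFamily (etaFamily L) →L[ℂ] Bdd G where
  toLinearMap := (derivOp L i : MonoidAlgebra ℂ G →ₗ[ℂ] Bdd G)
  cont := by
    refine WithSeminorms.continuous_of_isBounded (withSeminorms_withFamily (etaFamily L))
      (norm_withSeminorms ℂ (Bdd G)) (derivOp L i : MonoidAlgebra ℂ G →ₗ[ℂ] Bdd G) fun _ =>
        ⟨{i}, 1, fun a => ?_⟩
    rw [Finset.sup_singleton, one_smul]
    exact norm_derivOp_le_eta L le_rfl a

/-- The continuous extension of `∂_L^i` to the Connes-Moscovici algebra. -/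
noncomputable def derivExt (i : ℕ) : CMAlgebra L →L[ℂ] Bdd G := (derivCLM L i).fromCompletion

variable {L}

theorem derivExt_coe (i : ℕ) (a : MonoidAlgebra ℂ G) :
    derivExt L i (toFamilyCompletion (etaFamily L) a) = derivOp L i a :=
  ContinuousLinearMap.fromCompletion_apply_coe (derivCLM L i) a

theorem isDerivSeq_derivExt (x : CMAlgebra L) :
    IsDerivSeq L (derivExt L 0 x) fun i => derivExt L i x := by
  refine ⟨rfl, fun i => ?_⟩
  refine UniformSpace.Completion.induction_on
    (p := fun x => IsDeriv L (derivExt L i x) (derivExt L (i + 1) x)) x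
    (isClosed_isDeriv (derivExt L i).continuous (derivExt L (i + 1)).continuous) fun a => ?_
  suffices h : ∀ b : MonoidAlgebra ℂ G,
      IsDeriv L (derivExt L i (toFamilyCompletion (etaFamily L) b))
        (derivExt L (i + 1) (toFamilyCompletion (etaFamily L) b)) from h a
  intro b
  rw [derivExt_coe, derivExt_coe]
  exact (isDerivSeq_derivOp L b).2 i

variable (L)

/-- The extension of the left regular representation to the Connes-Moscovici algebra. -/
noncomputable def leftRegExt : CMAlgebra L →ₐ[ℂ] Bdd G :=
  AlgHom.ofLinearMap (derivExt L 0).toLinearMap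
    (by
      have := derivExt_coe (L := L) 0 1
      rw [map_one (toFamilyCompletion (etaFamily L)), derivOp_zero, map_one (leftReg G)] at this
      exact this)
    (fun x y => by
      refine UniformSpace.Completion.induction_on₂
        (p := fun x y => derivExt L 0 (x * y) = derivExt L 0 x * derivExt L 0 y) x y ?_
        fun a b => ?_
      · have h := (derivExt L 0).continuous
        exact isClosed_eq (h.comp (continuous_fst.mul continuous_snd))
          ((h.comp continuous_fst).mul (h.comp continuous_snd))
      · have := derivExt_coe (L := L) 0
          ((show MonoidAlgebra ℂ G from a) * (show MonoidAlgebra ℂ G from b))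
        rw [map_mul (toFamilyCompletion (etaFamily L)), derivOp_zero, map_mul (leftReg G),
          ← derivOp_zero L, ← derivOp_zero L, ← derivExt_coe, ← derivExt_coe] at this
        exact this)

variable {L}

theorem leftRegExt_apply (x : CMAlgebra L) : leftRegExt L x = derivExt L 0 x := rfl

open Filter Topology in
/-- The Connes-Moscovici algebra is an algebra of operators: an element is determined by the
operator it defines because the derivatives of an operator are determined by the operator. -/
theorem isCMRealization_leftRegExt :
    IsCMRealization L (toFamilyCompletion (etaFamily L)) (leftRegExt L) := by
  obtain ⟨q, hq, hqp⟩ :=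
    exists_withSeminorms_completion _ (withSeminorms_withFamily (etaFamily L))
  have hcoe : ∀ a : MonoidAlgebra ℂ G, leftRegExt L (toFamilyCompletion (etaFamily L) a) =
      leftReg G a := fun a => by rw [leftRegExt_apply, derivExt_coe, derivOp_zero]
  have hqS : ∀ m x, q m x = etaSeq m fun i => derivExt L i x := by
    intro m
    refine eq_of_forall_toFamilyCompletion (hq.continuous_seminorm m) ?_ fun a => ?_
    · exact continuous_finsetSum _ fun i _ =>
        continuous_const.mul (derivExt L i).continuous.norm
    · simp only [derivExt_coe]
      exact hqp m a
  have huniq : ∀ x S, IsDerivSeq L (leftRegExt L x) S → S = fun i => derivExt L i x :=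
    fun x S hS => hS.unique (isDerivSeq_derivExt x)
  have happrox : ∀ (x : CMAlgebra L) (m : ℕ) (ε : ℝ), 0 < ε → ∃ a : MonoidAlgebra ℂ G,
      q m (x - toFamilyCompletion (etaFamily L) a) < ε := by
    intro x m ε hε
    have hO : IsOpen {y : CMAlgebra L | q m (x - y) < ε} :=
      isOpen_lt ((hq.continuous_seminorm m).comp (continuous_const.sub continuous_id))
        continuous_const
    exact UniformSpace.Completion.denseRange_coe.exists_mem_open hO ⟨x, by simpa using hε⟩
  refine ⟨?_, hcoe, ?_, q, hq, fun m x S hS => by rw [hqS, huniq x S hS]⟩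
  · rw [injective_iff_map_eq_zero]
    intro x hx
    by_contra hne
    obtain ⟨m, hm⟩ := hq.separating_of_T1 x hne
    refine hm ?_
    have h0 : IsDerivSeq L (leftRegExt L x) 0 := by
      rw [hx]
      have := (isDerivSeq_derivExt x).sub (isDerivSeq_derivExt x)
      rwa [sub_self, sub_self] at this
    rw [hqS, ← huniq x 0 h0]
    simp [etaSeq]
  · refine Set.Subset.antisymm ?_ ?_
    · rintro _ ⟨x, rfl⟩
      refine ⟨⟨?_, _, isDerivSeq_derivExt x⟩, fun m ε hε => ?_⟩
      · refine UniformSpace.Completion.induction_on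
          (p := fun x => derivExt L 0 x ∈ closure (Set.range (leftReg G))) x
          (isClosed_closure.preimage (derivExt L 0).continuous) fun a => subset_closure ⟨a, ?_⟩
        exact (hcoe a).symm
      · obtain ⟨a, ha⟩ := happrox x m ε hε
        refine ⟨a, fun i => derivExt L i (x - toFamilyCompletion (etaFamily L) a), ?_, ?_⟩
        · rw [← hcoe, ← map_sub]
          exact isDerivSeq_derivExt _
        · rwa [← hqS]
    · rintro T ⟨-, hT⟩
      -- choosing the `n`-th approximation with respect to `η_n` makes it good for `η_k`, `k ≤ n`
      choose a S hS hlt using fun n : ℕ => hT n (1 / (n + 1 : ℝ)) (by positivity)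
      set y : ℕ → CMAlgebra L := fun n => toFamilyCompletion (etaFamily L) (a n) with hy
      have hdist : ∀ k m n, q k (y m - y n) ≤ etaSeq k (S m) + etaSeq k (S n) := by
        intro k m n
        have h1 := (hS n).sub (hS m)
        rw [sub_sub_sub_cancel_left, ← hcoe, ← hcoe, ← map_sub] at h1
        rw [hqS, ← huniq _ _ h1, add_comm]
        exact etaSeq_sub_le _ _ _
      have hsmall : ∀ k, ∀ ε > 0, ∃ N : ℕ, ∀ n ≥ N, etaSeq k (S n) < ε := by
        intro k ε hε
        obtain ⟨N, hN⟩ := exists_nat_one_div_lt hε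
        refine ⟨max k N, fun n hn => ?_⟩
        refine (etaSeq_mono ((le_max_left _ _).trans hn) _).trans_lt ((hlt n).trans_le ?_)
        refine (one_div_le_one_div_of_le (by positivity) ?_).trans hN.le
        have : (N : ℝ) ≤ n := Nat.cast_le.2 ((le_max_right _ _).trans hn)
        linarith
      have hcauchy : CauchySeq y := by
        rw [cauchySeq_iff_tendsto, uniformity_eq_comap_nhds_zero, tendsto_comap_iff,
          hq.tendsto_nhds]
        intro k ε hε
        obtain ⟨N, hN⟩ := hsmall k (ε / 2) (half_pos hε)
        filter_upwards [eventually_ge_atTop (N, N)] with p hp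
        have h1 := hN p.1 hp.1
        have h2 := hN p.2 hp.2
        have h3 := hdist k p.2 p.1
        simp only [Function.comp_apply, Prod.map, sub_zero]
        linarith
      obtain ⟨x, hx⟩ := cauchySeq_tendsto_of_complete hcauchy
      refine ⟨x, tendsto_nhds_unique (((derivExt L 0).continuous.tendsto x).comp hx) ?_⟩
      rw [tendsto_iff_norm_sub_tendsto_zero, Metric.tendsto_atTop]
      intro ε hε
      obtain ⟨N, hN⟩ := hsmall 0 ε hε
      refine ⟨N, fun n hn => ?_⟩
      rw [Real.dist_eq, sub_zero, abs_of_nonneg (norm_nonneg _), norm_sub_rev]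
      refine lt_of_le_of_lt ?_ (hN n hn)
      have h1 := norm_le_etaSeq le_rfl (S n) (i := 0)
      rwa [(hS n).1, ← hcoe] at h1

end Realization

/-! ### Pure tensors and tuples -/

section PureTensors

variable {E F F' K : Type u} [AddCommGroup E] [Module ℂ E] [TopologicalSpace E]
  [AddCommGroup F] [Module ℂ F] [TopologicalSpace F]
  [AddCommGroup F'] [Module ℂ F'] [TopologicalSpace F']
  [AddCommGroup K] [Module ℂ K] [TopologicalSpace K] {n m : ℕ}

/-- The pure tensor `x_1 ⊗ ⋯ ⊗ x_n`, as an element of the completed tensor power. -/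
noncomputable def compPure (x : Fin n → E) : CompTensor E n :=
  ((pureTensor E n x : ProjTensor E n) : CompTensor E n)

/-- Pure tensors span a dense subspace of the completed tensor power. -/
theorem compTensor_hom_ext {Y : Type*} [AddCommGroup Y] [Module ℂ Y] [TopologicalSpace Y]
    [T2Space Y] {f g : CompTensor E n →L[ℂ] Y} (h : ∀ x, f (compPure x) = g (compPure x)) :
    f = g := by
  refine ContinuousLinearMap.ext (congrFun
    (UniformSpace.Completion.ext f.continuous g.continuous fun a => ?_))
  induction a using PiTensorProduct.induction_on with
  | smul_tprod r x =>
    have h1 : (((r • pureTensor E n x : ProjTensor E n)) : CompTensor E n) = r • compPure x :=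
      UniformSpace.Completion.coe_smul r (pureTensor E n x)
    refine (congrArg f h1).trans (Eq.trans ?_ (congrArg g h1).symm)
    rw [map_smul, map_smul, h]
  | add a b ha hb =>
    have h1 : ((show ProjTensor E n from a + b : ProjTensor E n) : CompTensor E n) =
        ((show ProjTensor E n from a : ProjTensor E n) : CompTensor E n) +
        ((show ProjTensor E n from b : ProjTensor E n) : CompTensor E n) :=
      UniformSpace.Completion.coe_add _ _
    refine (congrArg f h1).trans (Eq.trans ?_ (congrArg g h1).symm)
    rw [map_add, map_add]
    exact congrArg₂ (· + ·) ha hb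

theorem tensorLift_completion_compPure (c : (Fin n → E) → (Fin m → F)) (hc : Continuous c)
    (μ : MultilinearMap ℂ (fun _ : Fin n => E) (ProjTensor F m))
    (hμ : ∀ x, μ x = pureTensor F m (c x)) (x : Fin n → E) :
    (tensorLift c hc μ hμ).completion (compPure x) = compPure (c x) := by
  have h : tensorLift c hc μ hμ (pureTensor E n x) = pureTensor F m (c x) :=
    (PiTensorProduct.lift.tprod x).trans (hμ x)
  rw [compPure, ContinuousLinearMap.completion_apply_coe, h, compPure]

theorem tensorPow_compPure (φ : E →L[ℂ] F) (x : Fin n → E) :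
    tensorPow φ n (compPure x) = compPure fun i => φ (x i) :=
  tensorLift_completion_compPure _ _ _ _ x

theorem tensorPow_of_forall_eq (φ : E →L[ℂ] E) (h : ∀ x, φ x = x) (y : CompTensor E n) :
    tensorPow φ n y = y := by
  have : tensorPow φ n = ContinuousLinearMap.id ℂ _ := compTensor_hom_ext fun x => by
    rw [tensorPow_compPure]
    simp only [h, ContinuousLinearMap.id_apply]
  rw [this, ContinuousLinearMap.id_apply]

theorem tensorPow_comp (φ : F →L[ℂ] K) (ψ : E →L[ℂ] F) (y : CompTensor E n) :
    tensorPow φ n (tensorPow ψ n y) = tensorPow (φ.comp ψ) n y := by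
  have : (tensorPow φ n).comp (tensorPow ψ n) = tensorPow (φ.comp ψ) n :=
    compTensor_hom_ext fun x => by
      rw [ContinuousLinearMap.comp_apply, tensorPow_compPure, tensorPow_compPure,
        tensorPow_compPure]
      rfl
  rw [← this, ContinuousLinearMap.comp_apply]

theorem tensorPow_comm {φ : F →L[ℂ] K} {ψ : E →L[ℂ] F} {φ' : F' →L[ℂ] K} {ψ' : E →L[ℂ] F'}
    (h : ∀ x, φ (ψ x) = φ' (ψ' x)) (y : CompTensor E n) :
    tensorPow φ n (tensorPow ψ n y) = tensorPow φ' n (tensorPow ψ' n y) := by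
  rw [tensorPow_comp, tensorPow_comp, ContinuousLinearMap.ext (f := φ.comp ψ) (g := φ'.comp ψ') h]

end PureTensors

section Tuples

variable {A : Type u}

/-- The rotated tuple `(x_k, x_0, …, x_{k-1})`. -/
def rotTuple {k : ℕ} (x : Fin (k + 1) → A) (i : Fin (k + 1)) : A := x ((finRotate (k + 1)).symm i)

open Fin.CommRing in
theorem rotTuple_iterate {k : ℕ} (m : ℕ) (x : Fin (k + 1) → A) (i : Fin (k + 1)) :
    (rotTuple^[m] x) i = x (i - (m : Fin (k + 1))) := by
  induction m generalizing i with
  | zero => simp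
  | succ m ih =>
    rw [Function.iterate_succ_apply', rotTuple, ih]
    congr 1
    have : (finRotate (k + 1)).symm i = i - 1 := by
      rw [Equiv.symm_apply_eq, finRotate_apply, sub_add_cancel]
    rw [this]
    push_cast
    ring

theorem rotTuple_iterate_self {k : ℕ} (x : Fin (k + 1) → A) : rotTuple^[k + 1] x = x := by
  funext i
  rw [rotTuple_iterate, Fin.natCast_self, sub_zero]

theorem rotTuple_zero {k : ℕ} (x : Fin (k + 1) → A) : rotTuple x 0 = x (Fin.last k) := by
  rw [rotTuple]
  rw [(Equiv.symm_apply_eq _).2 finRotate_last.symm]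

theorem rotTuple_succ {k : ℕ} (x : Fin (k + 2) → A) (i : Fin (k + 1)) :
    rotTuple x i.succ = x i.castSucc := by
  rw [rotTuple]
  have : (finRotate (k + 2)).symm i.succ = i.castSucc :=
    (Equiv.symm_apply_eq _).2 (finRotate_of_lt i.2).symm
  rw [this]

variable [Ring A]

theorem mulAt_mulAt {k : ℕ} {i j : Fin (k + 1)} (h : i ≤ j) (x : Fin (k + 3) → A) :
    mulAt i (mulAt j.succ x) = mulAt j (mulAt i.castSucc x) := by
  funext l
  have h' : (i : ℕ) ≤ j := h
  simp only [mulAt, Fin.lt_def, Fin.ext_iff, Fin.val_castSucc, Fin.val_succ, Fin.succ_castSucc]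
  split_ifs <;> first | rfl | omega | exact (mul_assoc (_ : A) _ _).symm

theorem mulAt_succ_rotTuple {k : ℕ} (i : Fin (k + 1)) (x : Fin (k + 3) → A) :
    mulAt i.succ (rotTuple x) = rotTuple (mulAt i.castSucc x) := by
  funext l
  refine Fin.cases ?_ (fun l => ?_) l
  · rw [rotTuple_zero]
    have := i.2
    simp only [mulAt, Fin.lt_def, Fin.ext_iff, Fin.val_castSucc, Fin.val_succ, Fin.val_zero,
      Fin.val_last]
    rw [if_pos (by omega), if_neg (by omega), if_neg (by omega), Fin.succ_last,
      Fin.castSucc_zero, rotTuple_zero]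
  · rw [rotTuple_succ]
    simp only [mulAt, Fin.lt_def, Fin.ext_iff, Fin.val_castSucc, Fin.val_succ,
      Fin.castSucc_succ, rotTuple_succ]
    split_ifs <;> first | rfl | omega

theorem mulAt_zero_rotTuple_rotTuple {k : ℕ} (x : Fin (k + 2) → A) :
    mulAt 0 (rotTuple (rotTuple x)) = rotTuple (mulAt (Fin.last k) x) := by
  funext l
  refine Fin.cases ?_ (fun l => ?_) l
  · rw [rotTuple_zero]
    simp only [mulAt, lt_irrefl, if_false, if_true]
    rw [Fin.castSucc_zero, rotTuple_zero, rotTuple_succ, ← Fin.succ_last, rotTuple_succ,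
      Fin.castSucc_zero, rotTuple_zero]
    rfl
  · obtain ⟨k, rfl⟩ : ∃ k', k = k' + 1 := Nat.exists_eq_succ_of_ne_zero (by
      rintro rfl
      exact l.elim0)
    rw [rotTuple_succ]
    have := l.2
    simp only [mulAt, Fin.lt_def, Fin.ext_iff, Fin.val_castSucc, Fin.val_succ, Fin.val_last,
      Fin.val_zero]
    rw [if_neg (by omega), if_neg (by omega), if_pos (by omega), rotTuple_succ,
      Fin.castSucc_succ, rotTuple_succ]

end Tuples

/-! ### Identities in the cyclic bicomplex -/

/-- The cancellation in the square of an alternating sum of operators that satisfy the simplicial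
identities. -/
theorem sum_sum_alternating_eq_zero {V : Type*} [AddCommGroup V] [Module ℂ V] {m : ℕ}
    (F : Fin (m + 1) → Fin (m + 2) → V) (h : ∀ i j, i ≤ j → F i j.succ = F j i.castSucc) :
    ∑ i : Fin (m + 1), ∑ j : Fin (m + 2), (-1 : ℂ) ^ (i : ℕ) • (-1 : ℂ) ^ (j : ℕ) • F i j = 0 := by
  rw [← Finset.sum_product']
  have hcancel : ∀ i j : Fin (m + 1), i ≤ j →
      (-1 : ℂ) ^ (i : ℕ) • (-1 : ℂ) ^ (j.succ : ℕ) • F i j.succ +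
        (-1 : ℂ) ^ (j : ℕ) • (-1 : ℂ) ^ (i.castSucc : ℕ) • F j i.castSucc = 0 := by
    intro i j hij
    rw [h i j hij, smul_smul, smul_smul, ← add_smul, Fin.val_succ, Fin.val_castSucc, pow_succ]
    ring_nf
    rw [zero_smul]
  -- the terms for `(i, j + 1)` and `(j, i)`, where `i ≤ j`, cancel
  refine Finset.sum_involution (fun p _ => if hp : (p.2 : ℕ) ≤ p.1
    then (p.2.castLT (by have := p.1.2; omega), p.1.succ)
    else (p.2.pred (by
      rintro h0
      rw [h0] at hp
      exact hp (Nat.zero_le _)), p.1.castSucc)) ?_ ?_ ?_ ?_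
  · rintro ⟨i, j⟩ -
    split_ifs with hp
    · have hj := i.2
      have := hcancel (j.castLT (by dsimp only at hp; omega)) i hp
      rw [Fin.castSucc_castLT, add_comm] at this
      exact this
    · obtain ⟨j, rfl⟩ := Fin.exists_succ_eq.2 (show j ≠ 0 by
        rintro rfl
        exact hp (Nat.zero_le _))
      simp only [Fin.pred_succ]
      refine hcancel i j ?_
      simp only [Fin.val_succ, not_le] at hp
      exact Nat.lt_succ_iff.1 hp
  · rintro ⟨i, j⟩ - - heq
    split_ifs at heq with hp
    · have := congrArg (fun p => (p.2 : ℕ)) heq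
      simp only [Fin.val_succ] at this hp
      omega
    · have := congrArg (fun p => (p.2 : ℕ)) heq
      simp only [Fin.val_castSucc] at this hp
      omega
  · intro _ _
    simp
  · rintro ⟨i, j⟩ -
    by_cases hp : (j : ℕ) ≤ i
    · have h2 : ¬ ((i.succ : ℕ) ≤ j) := by
        rw [Fin.val_succ]
        omega
      simp only [hp, dif_pos, Fin.val_castLT, h2, dif_neg, not_false_eq_true, Fin.pred_succ,
        Fin.castSucc_castLT]
    · obtain ⟨j, rfl⟩ := Fin.exists_succ_eq.2 (show j ≠ 0 by
        rintro rfl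
        exact hp (Nat.zero_le _))
      have h2 : (i.castSucc : ℕ) ≤ j := by
        simp only [Fin.val_succ, not_le] at hp
        rw [Fin.val_castSucc]
        omega
      simp only [hp, dif_neg, not_false_eq_true, Fin.pred_succ, h2, dif_pos, Fin.castLT_castSucc]

theorem neg_one_pow_add_self (m : ℕ) : (-1 : ℂ) ^ (m + m) = 1 := Even.neg_one_pow ⟨m, rfl⟩

section Cyclic

variable {A : Type u} [Ring A] [Algebra ℂ A] [TopologicalSpace A]

theorem tensorRot_compPure {k : ℕ} (x : Fin (k + 1) → A) :
    tensorRot A k (compPure x) = compPure (rotTuple x) :=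
  tensorLift_completion_compPure _ _ _ _ x

theorem tensorRot_pow_self (k : ℕ) : tensorRot A k ^ (k + 1) = 1 := by
  refine compTensor_hom_ext fun x => ?_
  have h : ∀ m, (tensorRot A k ^ m) (compPure x) = compPure (rotTuple^[m] x) := by
    intro m
    induction m with
    | zero => simp
    | succ m ih =>
      rw [pow_succ', mul_apply_eq_comp, ih, tensorRot_compPure,
        Function.iterate_succ_apply']
  rw [h, rotTuple_iterate_self, one_apply_eq_self]

theorem cycT_apply {k : ℕ} (y : CH A k) : cycT A k y = (-1 : ℂ) ^ k • tensorRot A k y := rfl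

theorem cycT_pow_self (k : ℕ) : cycT A k ^ (k + 1) = 1 := by
  rw [cycT, smul_pow, tensorRot_pow_self, ← pow_mul, (Nat.even_mul_succ_self k).neg_one_pow,
    one_smul]

theorem cycN_cycT (k : ℕ) (y : CH A k) : cycN A k (cycT A k y) = cycN A k y := by
  have h := geom_sum_mul (cycT A k) (k + 1)
  rw [cycT_pow_self, sub_self, mul_sub, mul_one, sub_eq_zero] at h
  exact DFunLike.congr_fun h y

theorem cycT_cycN (k : ℕ) (y : CH A k) : cycT A k (cycN A k y) = cycN A k y := by
  have h := mul_geom_sum (cycT A k) (k + 1)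
  rw [cycT_pow_self, sub_self, sub_mul, one_mul, sub_eq_zero] at h
  exact DFunLike.congr_fun h y

theorem cycN_of_cycT_eq {k : ℕ} {y : CH A k} (h : cycT A k y = y) :
    cycN A k y = (k + 1 : ℂ) • y := by
  have h1 : ∀ i, (cycT A k ^ i) y = y := by
    intro i
    induction i with
    | zero => rfl
    | succ i ih => rw [pow_succ, mul_apply_eq_comp, h, ih]
  rw [cycN, sum_apply, Finset.sum_congr rfl fun i _ => h1 i, Finset.sum_const, Finset.card_range,
    ← Nat.cast_smul_eq_nsmul ℂ]
  push_cast
  rfl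

variable {B : Type u} [Ring B] [Algebra ℂ B] [TopologicalSpace B]

theorem CH.map_compPure (φ : A →A[ℂ] B) {k : ℕ} (x : Fin (k + 1) → A) :
    CH.map φ k (compPure x) = compPure fun i => φ (x i) :=
  tensorPow_compPure _ x

theorem CH.map_tensorRot (φ : A →A[ℂ] B) {k : ℕ} (y : CH A k) :
    CH.map φ k (tensorRot A k y) = tensorRot B k (CH.map φ k y) := by
  refine DFunLike.congr_fun (f := (CH.map φ k).comp (tensorRot A k))
    (g := (tensorRot B k).comp (CH.map φ k)) (compTensor_hom_ext fun x => ?_) y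
  simp only [ContinuousLinearMap.comp_apply, tensorRot_compPure, CH.map_compPure]
  rfl

theorem CH.map_cycT (φ : A →A[ℂ] B) {k : ℕ} (y : CH A k) :
    CH.map φ k (cycT A k y) = cycT B k (CH.map φ k y) := by
  simp only [cycT_apply, map_smul, CH.map_tensorRot]

theorem CH.map_cycN (φ : A →A[ℂ] B) {k : ℕ} (y : CH A k) :
    CH.map φ k (cycN A k y) = cycN B k (CH.map φ k y) := by
  have h : ∀ i, CH.map φ k ((cycT A k ^ i) y) = (cycT B k ^ i) (CH.map φ k y) := by
    intro i
    induction i with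
    | zero => rfl
    | succ i ih =>
      rw [pow_succ', pow_succ', mul_apply_eq_comp, mul_apply_eq_comp,
        CH.map_cycT, ih]
  rw [cycN, cycN, sum_apply, sum_apply, map_sum]
  exact Finset.sum_congr rfl fun i _ => h i

theorem CC.map_apply (φ : A →A[ℂ] B) {n : ℕ} (x : CC A n) (q : Fin (n + 1)) :
    CC.map φ n x q = CH.map φ q (x q) :=
  rfl

variable [IsTopologicalRing A]

theorem hochFace_compPure {k : ℕ} (i : Fin (k + 1)) (x : Fin (k + 2) → A) :
    hochFace A k i (compPure x) = compPure (mulAt i x) :=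
  tensorLift_completion_compPure _ _ _ _ x

theorem hochFace_hochFace {k : ℕ} {i j : Fin (k + 1)} (h : i ≤ j) (y : CH A (k + 2)) :
    hochFace A k i (hochFace A (k + 1) j.succ y) =
      hochFace A k j (hochFace A (k + 1) i.castSucc y) := by
  refine DFunLike.congr_fun (f := (hochFace A k i).comp (hochFace A (k + 1) j.succ))
    (g := (hochFace A k j).comp (hochFace A (k + 1) i.castSucc))
    (compTensor_hom_ext fun x => ?_) y
  simp only [ContinuousLinearMap.comp_apply, hochFace_compPure, mulAt_mulAt h]

theorem hochFace_succ_tensorRot {k : ℕ} (i : Fin (k + 1)) (y : CH A (k + 2)) :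
    hochFace A (k + 1) i.succ (tensorRot A (k + 2) y) =
      tensorRot A (k + 1) (hochFace A (k + 1) i.castSucc y) := by
  refine DFunLike.congr_fun (f := (hochFace A (k + 1) i.succ).comp (tensorRot A (k + 2)))
    (g := (tensorRot A (k + 1)).comp (hochFace A (k + 1) i.castSucc))
    (compTensor_hom_ext fun x => ?_) y
  simp only [ContinuousLinearMap.comp_apply, hochFace_compPure, tensorRot_compPure,
    mulAt_succ_rotTuple]

theorem hochFace_zero_tensorRot_tensorRot {k : ℕ} (y : CH A (k + 1)) :
    hochFace A k 0 (tensorRot A (k + 1) (tensorRot A (k + 1) y)) =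
      tensorRot A k (hochFace A k (Fin.last k) y) := by
  refine DFunLike.congr_fun
    (f := (hochFace A k 0).comp ((tensorRot A (k + 1)).comp (tensorRot A (k + 1))))
    (g := (tensorRot A k).comp (hochFace A k (Fin.last k)))
    (compTensor_hom_ext fun x => ?_) y
  simp only [ContinuousLinearMap.comp_apply, hochFace_compPure, tensorRot_compPure,
    mulAt_zero_rotTuple_rotTuple]

theorem hochB'_apply {k : ℕ} (y : CH A (k + 1)) :
    hochB' A k y = ∑ i : Fin (k + 1), (-1 : ℂ) ^ (i : ℕ) • hochFace A k i y := by
  simp [hochB', sum_apply]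

/-- The last face `x_0 ⊗ ⋯ ⊗ x_{k+1} ↦ x_{k+1} x_0 ⊗ x_1 ⊗ ⋯ ⊗ x_k`. -/
noncomputable def lastFace (k : ℕ) : CH A (k + 1) →L[ℂ] CH A k :=
  (hochFace A k 0).comp (tensorRot A (k + 1))

theorem lastFace_apply {k : ℕ} (y : CH A (k + 1)) :
    lastFace k y = hochFace A k 0 (tensorRot A (k + 1) y) :=
  rfl

theorem hochB_apply {k : ℕ} (y : CH A (k + 1)) :
    hochB A k y = hochB' A k y + (-1 : ℂ) ^ (k + 1) • lastFace k y :=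
  rfl

theorem hochFace_lastFace {k : ℕ} (i : Fin (k + 1)) (y : CH A (k + 2)) :
    hochFace A k i (lastFace (k + 1) y) = lastFace k (hochFace A (k + 1) i.castSucc y) := by
  rw [lastFace_apply, lastFace_apply, ← hochFace_succ_tensorRot,
    hochFace_hochFace (Fin.zero_le i), Fin.castSucc_zero]

theorem lastFace_lastFace {k : ℕ} (y : CH A (k + 2)) :
    lastFace k (lastFace (k + 1) y) =
      lastFace k (hochFace A (k + 1) (Fin.last (k + 1)) y) := by
  rw [lastFace_apply, lastFace_apply, lastFace_apply, ← hochFace_zero_tensorRot_tensorRot]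
  have h := hochFace_succ_tensorRot (A := A) (k := k) 0 (tensorRot A (k + 2) y)
  rw [Fin.castSucc_zero] at h
  rw [← h, hochFace_hochFace le_rfl, Fin.castSucc_zero]

theorem hochB'_hochB' {k : ℕ} (y : CH A (k + 2)) : hochB' A k (hochB' A (k + 1) y) = 0 := by
  rw [hochB'_apply]
  simp only [hochB'_apply (k := k + 1), map_sum, map_smul, Finset.smul_sum]
  exact sum_sum_alternating_eq_zero (fun i j => hochFace A k i (hochFace A (k + 1) j y))
    fun i j h => hochFace_hochFace h y

theorem hochB_hochB {k : ℕ} (y : CH A (k + 2)) : hochB A k (hochB A (k + 1) y) = 0 := by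
  have h1 : hochB' A k (lastFace (k + 1) y) = lastFace k (hochB' A (k + 1) y) -
      (-1 : ℂ) ^ (k + 1) • lastFace k (lastFace (k + 1) y) := by
    rw [hochB'_apply, hochB'_apply, Fin.sum_univ_castSucc (n := k + 1), map_add, map_smul, map_sum,
      lastFace_lastFace, Fin.val_last, add_sub_cancel_right]
    refine Finset.sum_congr rfl fun i _ => ?_
    rw [hochFace_lastFace, map_smul, Fin.val_castSucc]
  rw [hochB_apply, hochB_apply, map_add, map_add, hochB'_hochB', map_smul, map_smul, h1, pow_succ]
  module

/-- The relation `b t = b - b' + t b'`. -/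
theorem hochB_cycT {k : ℕ} (y : CH A (k + 1)) :
    hochB A k (cycT A (k + 1) y) = hochB A k y - hochB' A k y + cycT A k (hochB' A k y) := by
  have h1 : hochB' A k (tensorRot A (k + 1) y) + (-1 : ℂ) ^ (k + 1) •
      lastFace k (tensorRot A (k + 1) y) =
        lastFace k y - tensorRot A k (hochB' A k y) := by
    rw [lastFace_apply, hochFace_zero_tensorRot_tensorRot, hochB'_apply, Fin.sum_univ_succ,
      hochB'_apply, Fin.sum_univ_castSucc, map_add, map_sum, lastFace_apply]
    have h2 : ∀ i : Fin k, (-1 : ℂ) ^ (i.succ : ℕ) •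
        hochFace A k i.succ (tensorRot A (k + 1) y) =
          -tensorRot A k ((-1 : ℂ) ^ (i.castSucc : ℕ) • hochFace A k i.castSucc y) := by
      intro i
      obtain ⟨k, rfl⟩ : ∃ k', k = k' + 1 := Nat.exists_eq_succ_of_ne_zero (by
        rintro rfl
        exact i.elim0)
      rw [hochFace_succ_tensorRot, map_smul, Fin.val_succ, Fin.val_castSucc, pow_succ, mul_neg_one,
        neg_smul]
    rw [Finset.sum_congr rfl fun i _ => h2 i, Finset.sum_neg_distrib, map_smul, Fin.val_zero,
      pow_zero, one_smul, Fin.val_last, pow_succ, mul_neg_one, neg_smul]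
    abel
  rw [cycT_apply, map_smul, hochB_apply, h1, hochB_apply, cycT_apply, smul_sub, pow_succ,
    mul_neg_one, neg_smul, neg_smul]
  abel

/-- The relation `b' N = N b`. For a chain `z = N y`, which is invariant under `t`, the signed faces
of `z` all have the same image `Y` under `N`, so that `N b' z = (k + 1) Y` and `N b z = (k + 2) Y`.
By the relation for `b t`, the chain `b' z` is invariant under `t`, so that `(k + 1) b' z = N b' z`,
and `N b` does not change upon composition with `t`, so that `(k + 2) N b y = N b z`. -/
theorem hochB'_cycN {k : ℕ} (y : CH A (k + 1)) :
    hochB' A k (cycN A (k + 1) y) = cycN A k (hochB A k y) := by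
  set z := cycN A (k + 1) y with hz
  have htz : cycT A (k + 1) z = z := cycT_cycN (k + 1) y
  have hrot : tensorRot A (k + 1) z = (-1 : ℂ) ^ (k + 1) • z := by
    have h := congrArg (fun w => (-1 : ℂ) ^ (k + 1) • w) htz
    rw [cycT_apply, smul_smul, ← pow_add, neg_one_pow_add_self, one_smul] at h
    exact h
  have hN : ∀ w, cycN A k (tensorRot A k w) = (-1 : ℂ) ^ k • cycN A k w := by
    intro w
    have h := cycN_cycT k w
    rw [cycT_apply, map_smul] at h
    rw [← h, smul_smul, ← pow_add, neg_one_pow_add_self, one_smul]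
  set Y := cycN A k (hochFace A k 0 z) with hY
  have hface : ∀ i : Fin (k + 1), (-1 : ℂ) ^ (i : ℕ) • cycN A k (hochFace A k i z) = Y := by
    intro i
    induction i using Fin.induction with
    | zero => simp [hY]
    | succ i ih =>
      obtain ⟨k, rfl⟩ : ∃ k', k = k' + 1 := Nat.exists_eq_succ_of_ne_zero (by
        rintro rfl
        exact i.elim0)
      have h := congrArg (cycN A (k + 1)) (hochFace_succ_tensorRot i z)
      rw [hrot, map_smul, map_smul, hN, pow_succ, mul_neg_one, neg_smul] at h
      have h' := congrArg (fun w => (-1 : ℂ) ^ (k + 1) • w) h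
      simp only [smul_neg, smul_smul, ← pow_add, neg_one_pow_add_self,
        one_smul] at h'
      rw [← ih, Fin.val_castSucc, Fin.val_succ, ← h', pow_succ, mul_neg_one, neg_smul, smul_neg]
  have hNb' : cycN A k (hochB' A k z) = (k + 1 : ℂ) • Y := by
    rw [hochB'_apply, map_sum, Finset.sum_congr rfl fun i _ => (map_smul _ _ _).trans (hface i),
      Finset.sum_const, Finset.card_univ, Fintype.card_fin, ← Nat.cast_smul_eq_nsmul ℂ]
    push_cast
    rfl
  have hNb : cycN A k (hochB A k z) = (k + 2 : ℂ) • Y := by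
    rw [hochB_apply, map_add, hNb', lastFace_apply, hrot, map_smul, map_smul, map_smul, smul_smul,
      ← pow_add, neg_one_pow_add_self, one_smul, ← hY]
    module
  have hinv : cycT A k (hochB' A k z) = hochB' A k z := by
    have h := hochB_cycT z
    rw [htz] at h
    rw [sub_add_eq_add_sub, add_sub_assoc, left_eq_add, sub_eq_zero] at h
    exact h
  have h1 : (k + 1 : ℂ) • hochB' A k z = (k + 1 : ℂ) • Y := by
    rw [← cycN_of_cycT_eq hinv, hNb']
  have h2 : ∀ w, cycN A k (hochB A k (cycT A (k + 1) w)) = cycN A k (hochB A k w) := by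
    intro w
    rw [hochB_cycT, map_add, map_sub, cycN_cycT, sub_add_cancel]
  have h3 : (k + 2 : ℂ) • cycN A k (hochB A k y) = (k + 2 : ℂ) • Y := by
    have h5 : z = ∑ i ∈ Finset.range (k + 1 + 1), (cycT A (k + 1) ^ i) y := by
      rw [hz, cycN, sum_apply]
    rw [← hNb, h5, map_sum, map_sum]
    have h4 : ∀ i, cycN A k (hochB A k ((cycT A (k + 1) ^ i) y)) = cycN A k (hochB A k y) := by
      intro i
      induction i with
      | zero => rfl
      | succ i ih => rw [pow_succ', mul_apply_eq_comp, h2, ih]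
    rw [Finset.sum_congr rfl fun i _ => h4 i, Finset.sum_const, Finset.card_range,
      ← Nat.cast_smul_eq_nsmul ℂ]
    push_cast
    congr 1
    ring
  have hk1 : (k + 1 : ℂ) ≠ 0 := by exact_mod_cast Nat.succ_ne_zero k
  have hk2 : (k + 2 : ℂ) ≠ 0 := by exact_mod_cast Nat.succ_ne_zero (k + 1)
  rw [smul_right_injective _ hk1 h1, smul_right_injective _ hk2 h3]

theorem cycD_even {n : ℕ} (x : CC A (n + 1)) (q : Fin (n + 1)) (h : Even (n - (q : ℕ)))
    (y : CH A (q + 1)) (z : CH A q) (hy : x q.succ = y) (hz : x q.castSucc = z) :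
    cycD A n x q = hochB A q y + (z - cycT A q z) := by
  simp only [cycD, ContinuousLinearMap.pi_apply]
  rw [if_pos h, ← hy, ← hz]
  rfl

theorem cycD_odd {n : ℕ} (x : CC A (n + 1)) (q : Fin (n + 1)) (h : ¬ Even (n - (q : ℕ)))
    (y : CH A (q + 1)) (z : CH A q) (hy : x q.succ = y) (hz : x q.castSucc = z) :
    cycD A n x q = -hochB' A q y + cycN A q z := by
  simp only [cycD, ContinuousLinearMap.pi_apply]
  rw [if_neg h, ← hy, ← hz]
  rfl

theorem cycD_cycD {n : ℕ} (x : CC A (n + 2)) : cycD A n (cycD A (n + 1) x) = 0 := by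
  funext q
  rw [Pi.zero_apply]
  have hq := q.2
  set y : CH A (q + 2) := x q.succ.succ
  set z : CH A (q + 1) := x q.succ.castSucc
  set w : CH A q := x q.castSucc.castSucc
  by_cases h : Even (n - (q : ℕ))
  · have h1 : Even (n + 1 - (q.succ : ℕ)) := by rwa [Fin.val_succ, Nat.add_sub_add_right]
    have h2 : ¬ Even (n + 1 - (q.castSucc : ℕ)) := by
      rw [Fin.val_castSucc, Nat.sub_add_comm (by omega), Nat.even_add_one]
      exact not_not.2 h
    rw [cycD_even _ q h _ _ (cycD_even x q.succ h1 y z rfl rfl)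
      (cycD_odd x q.castSucc h2 z w rfl rfl)]
    change hochB A q (hochB A (q + 1) y + (z - cycT A (q + 1) z)) +
      (-hochB' A q z + cycN A q w - cycT A q (-hochB' A q z + cycN A q w)) = 0
    rw [map_add, map_sub, map_add, map_neg, hochB_hochB, hochB_cycT, cycT_cycN]
    abel
  · have h1 : ¬ Even (n + 1 - (q.succ : ℕ)) := by rwa [Fin.val_succ, Nat.add_sub_add_right]
    have h2 : Even (n + 1 - (q.castSucc : ℕ)) := by
      rw [Fin.val_castSucc, Nat.sub_add_comm (by omega), Nat.even_add_one]
      exact h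
    rw [cycD_odd _ q h _ _ (cycD_odd x q.succ h1 y z rfl rfl)
      (cycD_even x q.castSucc h2 z w rfl rfl)]
    change -hochB' A q (-hochB' A (q + 1) y + cycN A (q + 1) z) +
      cycN A q (hochB A q z + (w - cycT A q w)) = 0
    rw [map_add, map_neg, map_add, map_sub, hochB'_hochB', hochB'_cycN, cycN_cycT]
    abel

variable [IsTopologicalRing B]

theorem CH.map_hochFace (φ : A →A[ℂ] B) {k : ℕ} (i : Fin (k + 1)) (y : CH A (k + 1)) :
    CH.map φ k (hochFace A k i y) = hochFace B k i (CH.map φ (k + 1) y) := by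
  refine DFunLike.congr_fun (f := (CH.map φ k).comp (hochFace A k i))
    (g := (hochFace B k i).comp (CH.map φ (k + 1))) (compTensor_hom_ext fun x => ?_) y
  simp only [ContinuousLinearMap.comp_apply, hochFace_compPure, CH.map_compPure]
  congr 1
  funext l
  simp only [mulAt]
  split_ifs <;> first | rfl | exact map_mul φ _ _

theorem CH.map_hochB' (φ : A →A[ℂ] B) {k : ℕ} (y : CH A (k + 1)) :
    CH.map φ k (hochB' A k y) = hochB' B k (CH.map φ (k + 1) y) := by
  simp only [hochB'_apply, map_sum, map_smul, CH.map_hochFace]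

theorem CH.map_hochB (φ : A →A[ℂ] B) {k : ℕ} (y : CH A (k + 1)) :
    CH.map φ k (hochB A k y) = hochB B k (CH.map φ (k + 1) y) := by
  simp only [hochB_apply, lastFace_apply, map_add, map_smul, CH.map_hochFace, CH.map_hochB',
    CH.map_tensorRot]

theorem CC.map_cycD (φ : A →A[ℂ] B) {n : ℕ} (x : CC A (n + 1)) :
    CC.map φ n (cycD A n x) = cycD B n (CC.map φ (n + 1) x) := by
  funext q
  rw [CC.map_apply]
  by_cases h : Even (n - (q : ℕ))
  · rw [cycD_even x q h _ _ rfl rfl, cycD_even _ q h _ _ (CC.map_apply φ x q.succ)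
      (CC.map_apply φ x q.castSucc), map_add, map_sub]
    exact congrArg₂ (· + ·) (CH.map_hochB φ (x q.succ))
      (congrArg (_ - ·) (CH.map_cycT φ (x q.castSucc)))
  · rw [cycD_odd x q h _ _ rfl rfl, cycD_odd _ q h _ _ (CC.map_apply φ x q.succ)
      (CC.map_apply φ x q.castSucc), map_add, map_neg]
    exact congrArg₂ (fun u v => -u + v) (CH.map_hochB' φ (x q.succ))
      (CH.map_cycN φ (x q.castSucc))

end Cyclic

/-! ### The extra degeneracy of a type P resolution -/

/-- The object `[n - 1]`. -/
abbrev lower : ℕ → AugOp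
  | 0 => degNegOne
  | n + 1 => deg n

/-- The face `∂_i` from degree `n` to degree `n - 1`; this is the augmentation if `n = 0`. -/
def lowerFace : ∀ n : ℕ, Fin (n + 1) → (lower (n + 1) ⟶ lower n)
  | 0, _ => aug 0
  | n + 1, i => face n i

/-- The maps `t n` from degree `n - 1` to degree `n` form an extra degeneracy of the augmented
simplicial set given by `M` and `map`, at the end of each simplex. Only the identities for the faces
are required. -/
structure IsExtraDegeneracy (M : AugOp → Type v) (map : ∀ {X Y : AugOp}, (X ⟶ Y) → M X → M Y)
    (t : ∀ n, M (lower n) → M (deg n)) : Prop where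
  aug_zero : ∀ x : M degNegOne, map (aug 0) (t 0 x) = x
  face_last : ∀ n (x : M (deg n)), map (face n (Fin.last (n + 1))) (t (n + 1) x) = x
  face_castSucc : ∀ n (i : Fin (n + 1)) (x : M (deg n)),
    map (face n i.castSucc) (t (n + 1) x) = t n (map (lowerFace n i) x)

theorem IsExtraDegeneracy.injective {M : AugOp → Type v}
    {map : ∀ {X Y : AugOp}, (X ⟶ Y) → M X → M Y} {t : ∀ n, M (lower n) → M (deg n)}
    (h : IsExtraDegeneracy M map t) (n : ℕ) : Function.Injective (t n) := by
  cases n with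
  | zero => exact Function.LeftInverse.injective h.aug_zero
  | succ n => exact Function.LeftInverse.injective (h.face_last n)

section Groups

variable {Γ : AugOp ⥤ GrpCat.{u}} {L : ∀ X, WordLength (Γ.obj X)}

theorem map_comp_apply {X Y Z : AugOp} (f : X ⟶ Y) (g : Y ⟶ Z) (x : Γ.obj X) :
    Γ.map (f ≫ g) x = Γ.map g (Γ.map f x) := by
  rw [Γ.map_comp]
  rfl

theorem map_id_apply (X : AugOp) (x : Γ.obj X) : Γ.map (𝟙 X) x = x := by
  rw [Γ.map_id]
  rfl

/-- The morphism from degree `n` to degree `m` given by a monotone map `[m] → [n]`. -/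
def simplexMap {m n : ℕ} (θ : SimplexCategory.mk m ⟶ SimplexCategory.mk n) : deg n ⟶ deg m :=
  (AugmentedSimplexCategory.inclusion.map θ).op

theorem simplexMap_id (n : ℕ) : simplexMap (𝟙 (SimplexCategory.mk n)) = 𝟙 (deg n) := by
  rw [simplexMap, CategoryTheory.Functor.map_id]
  rfl

theorem simplexMap_comp {l m n : ℕ} (θ : SimplexCategory.mk l ⟶ SimplexCategory.mk m)
    (θ' : SimplexCategory.mk m ⟶ SimplexCategory.mk n) :
    simplexMap (θ ≫ θ') = simplexMap θ' ≫ simplexMap θ := by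
  rw [simplexMap, Functor.map_comp]
  rfl

theorem simplexMap_delta (n : ℕ) (i : Fin (n + 2)) :
    simplexMap (SimplexCategory.δ i) = face n i := rfl

theorem simplexMap_sigma (n : ℕ) (i : Fin (n + 1)) :
    simplexMap (SimplexCategory.σ i) = degen n i := rfl

theorem hom_zero_ext {n : ℕ} (f g : SimplexCategory.mk n ⟶ SimplexCategory.mk 0) : f = g :=
  SimplexCategory.Hom.ext _ _
    (OrderHom.ext _ _ (funext fun _ => Subsingleton.elim (α := Fin 1) _ _))

/-- The iterated degeneracy from degree `0` to degree `n`. -/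
def totalDegen (n : ℕ) : deg 0 ⟶ deg n :=
  simplexMap (SimplexCategory.const (SimplexCategory.mk n) (SimplexCategory.mk 0) 0)

theorem simplexMap_eq_totalDegen {n : ℕ} (f : SimplexCategory.mk n ⟶ SimplexCategory.mk 0) :
    simplexMap f = totalDegen n :=
  congrArg simplexMap (hom_zero_ext f _)

theorem totalDegen_zero : totalDegen 0 = 𝟙 (deg 0) := by
  rw [← simplexMap_id, simplexMap_eq_totalDegen]

theorem totalDegen_comp_face (n : ℕ) (i : Fin (n + 2)) :
    totalDegen (n + 1) ≫ face n i = totalDegen n := by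
  rw [← simplexMap_delta, totalDegen, ← simplexMap_comp, simplexMap_eq_totalDegen]

theorem totalDegen_comp_degen (n : ℕ) : totalDegen n ≫ degen n 0 = totalDegen (n + 1) := by
  rw [← simplexMap_sigma, totalDegen, ← simplexMap_comp, simplexMap_eq_totalDegen]

theorem totalDegen_comp_aug (n : ℕ) : totalDegen n ≫ aug n = aug 0 :=
  Quiver.Hom.unop_inj (WithInitial.starInitial.hom_ext _ _)

theorem IsTypeP.polyBounded_aug_all (h : IsTypeP Γ L) (n : ℕ) :
    PolyBounded (L (deg n)) (L degNegOne) (Γ.map (aug n)) := by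
  induction n with
  | zero => exact h.polyBounded_aug
  | succ n ih =>
    have := ih.comp (h.polyBounded_face n 0)
    simpa only [← map_comp_apply, face_comp_aug] using this

theorem IsTypeP.polyBounded_totalDegen (h : IsTypeP Γ L) (n : ℕ) :
    PolyBounded (L (deg 0)) (L (deg n)) (Γ.map (totalDegen n)) := by
  induction n with
  | zero =>
    obtain ⟨p, hp⟩ := polyBounded_id (L (deg 0))
    rw [totalDegen_zero]
    exact ⟨p, fun g => by
      rw [map_id_apply]
      exact hp g⟩
  | succ n ih =>
    have := (h.polyBounded_degen n 0).comp ih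
    simpa only [← map_comp_apply, totalDegen_comp_degen] using this

/-- A section of the augmentation extends to a section in each degree, by iterated degeneracies.
Every element of `Γ_n` thus is the product of an element of the kernel of the augmentation and a
value of the section. The extra degeneracy applies the contraction to the first factor, and
moves the second one degree up; it begins with the section multiplied by the vertex `v`. -/
theorem IsTypeP.exists_extraDegeneracy (h : IsTypeP Γ L) :
    ∃ t : ∀ n, Γ.obj (lower n) → Γ.obj (deg n),
      IsExtraDegeneracy (fun X => Γ.obj X) (fun f => Γ.map f) t ∧
      ∀ n, PolyBounded (L (lower n)) (L (deg n)) (t n) := by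
  obtain ⟨s, hs, hsP⟩ := h.exists_section
  obtain ⟨v, c, hc⟩ := h.exists_contraction
  let sec : ∀ n, Γ.obj degNegOne → Γ.obj (deg n) := fun n x => Γ.map (totalDegen n) (s x)
  have hsec_face : ∀ n i x, Γ.map (face n i) (sec (n + 1) x) = sec n x := fun n i x => by
    rw [← map_comp_apply, totalDegen_comp_face]
  have hsec_zero : ∀ x, sec 0 x = s x := fun x => by
    simp only [sec, totalDegen_zero, map_id_apply]
  have hsec_aug : ∀ n x, Γ.map (aug n) (sec n x) = x := fun n x => by
    rw [← map_comp_apply, totalDegen_comp_aug, hs]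
  have hsecP : ∀ n, PolyBounded (L degNegOne) (L (deg n)) (sec n) := fun n =>
    (h.polyBounded_totalDegen n).comp hsP
  let k : ∀ n, Γ.obj (deg n) → augKer Γ n := fun n g =>
    ⟨g * (sec n (Γ.map (aug n) g))⁻¹, by
      have h1 : (Γ.map (aug n)).hom (sec n (Γ.map (aug n) g)) = Γ.map (aug n) g := hsec_aug n _
      change (Γ.map (aug n)).hom (g * (sec n (Γ.map (aug n) g))⁻¹) = 1
      rw [map_mul, map_inv, h1]
      exact mul_inv_cancel _⟩
  have hkP : ∀ n, PolyBounded (L (deg n)) ((L (deg n)).restrict (augKer Γ n)) (k n) := fun n =>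
    (polyBounded_id (L (deg n))).mul ((hsecP n).comp (h.polyBounded_aug_all n)).inv
  have hk_face : ∀ n i g, kerFace Γ n i (k (n + 1) g) = k n (Γ.map (face n i) g) := by
    intro n i g
    refine Subtype.ext ?_
    change (Γ.map (face n i)).hom (g * (sec (n + 1) (Γ.map (aug (n + 1)) g))⁻¹) =
      Γ.map (face n i) g * (sec n (Γ.map (aug n) (Γ.map (face n i) g)))⁻¹
    have h1 : (Γ.map (face n i)).hom (sec (n + 1) (Γ.map (aug (n + 1)) g)) =
      sec n (Γ.map (aug (n + 1)) g) := hsec_face n i _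
    rw [map_mul, map_inv, h1, ← map_comp_apply, face_comp_aug]
  let t : ∀ n, Γ.obj (lower n) → Γ.obj (deg n) := fun n => match n with
    | 0 => fun x => (v : Γ.obj (deg 0)) * sec 0 x
    | n + 1 => fun g => (c n (k n g) : Γ.obj (deg (n + 1))) * sec (n + 1) (Γ.map (aug n) g)
  have ht0 : ∀ x, t 0 x = (v : Γ.obj (deg 0)) * sec 0 x := fun x => rfl
  have ht1 : ∀ n (g : Γ.obj (deg n)),
      t (n + 1) g = (c n (k n g) : Γ.obj (deg (n + 1))) * sec (n + 1) (Γ.map (aug n) g) :=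
    fun n g => rfl
  have hface : ∀ n (i : Fin (n + 2)) (g : Γ.obj (deg n)), Γ.map (face n i) (t (n + 1) g) =
      (kerFace Γ n i (c n (k n g)) : Γ.obj (deg n)) * sec n (Γ.map (aug n) g) := by
    intro n i g
    rw [ht1, ← hsec_face n i]
    exact map_mul (Γ.map (face n i)).hom _ _
  refine ⟨t, ⟨fun x => ?_, fun n g => ?_, fun n i g => ?_⟩, fun n => ?_⟩
  · have h1 : (Γ.map (aug 0)).hom v = 1 := v.2
    have h2 : (Γ.map (aug 0)).hom (sec 0 x) = x := hsec_aug 0 x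
    rw [ht0]
    change (Γ.map (aug 0)).hom ((v : Γ.obj (deg 0)) * sec 0 x) = x
    rw [map_mul, h1, h2, one_mul]
  · rw [hface, hc.face_last]
    exact inv_mul_cancel_right _ _
  · rw [hface]
    cases n with
    | zero =>
      obtain rfl : i = 0 := Fin.fin_one_eq_zero i
      rw [Fin.castSucc_zero, hc.face_zero]
      rfl
    | succ n =>
      rw [hc.face_castSucc, hk_face, ← face_comp_aug n i, map_comp_apply]
      rfl
  · cases n with
    | zero => exact (polyBounded_const _ _ _).mul (hsecP 0)
    | succ n =>
      have h1 : PolyBounded (L (deg n)) (L (deg (n + 1)))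
          (fun g => (c n (k n g) : Γ.obj (deg (n + 1)))) := (hc.polyBounded n).comp (hkP n)
      exact h1.mul ((hsecP (n + 1)).comp (h.polyBounded_aug_all n))

theorem IsTypeP.dominatesCancellation (h : IsTypeP Γ L) (n : ℕ) :
    (L (deg n)).DominatesCancellation :=
  (h.free n).dominatesCancellation

variable (Γ L) in
/-- A map of sets into `Γ_m`, `m ≥ 0`, that is a structure map, or a structure map followed by an
injective polynomially bounded map. -/
def IsTame {X : AugOp} {m : ℕ} (φ : Γ.obj X → Γ.obj (deg m)) : Prop :=
  (∃ f : X ⟶ deg m, ∀ x, φ x = Γ.map f x) ∨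
    ∃ (Z : AugOp) (g : X ⟶ Z) (ψ : Γ.obj Z → Γ.obj (deg m)), Function.Injective ψ ∧
      PolyBounded (L Z) (L (deg m)) ψ ∧ ∀ x, φ x = ψ (Γ.map g x)

theorem IsTame.precomp {W X : AugOp} {m : ℕ} {φ : Γ.obj X → Γ.obj (deg m)} (hφ : IsTame Γ L φ)
    (e : W ⟶ X) : IsTame Γ L fun x => φ (Γ.map e x) := by
  rcases hφ with ⟨f, hf⟩ | ⟨Z, g, ψ, h1, h2, h3⟩
  · exact Or.inl ⟨e ≫ f, fun x => by
      dsimp only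
      rw [hf, map_comp_apply]⟩
  · exact Or.inr ⟨Z, e ≫ g, ψ, h1, h2, fun x => by
      dsimp only
      rw [h3, map_comp_apply]⟩

theorem degen_comp_face (n : ℕ) (i : Fin (n + 1)) : degen n i ≫ face n i.castSucc = 𝟙 (deg n) := by
  rw [← simplexMap_delta, ← simplexMap_sigma, ← simplexMap_comp, SimplexCategory.δ_comp_σ_self,
    simplexMap_id]

theorem IsTame.degen (hP : IsTypeP Γ L) {X : AugOp} {m : ℕ} {φ : Γ.obj X → Γ.obj (deg m)}
    (hφ : IsTame Γ L φ) (i : Fin (m + 1)) : IsTame Γ L fun x => Γ.map (degen m i) (φ x) := by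
  rcases hφ with ⟨f, hf⟩ | ⟨Z, g, ψ, h1, h2, h3⟩
  · exact Or.inl ⟨f ≫ CMRes.degen m i, fun x => by
      dsimp only
      rw [hf, map_comp_apply]⟩
  · have hinj : Function.Injective (Γ.map (CMRes.degen m i)) :=
      Function.LeftInverse.injective (g := Γ.map (face m i.castSucc)) fun x => by
        rw [← map_comp_apply, degen_comp_face, map_id_apply]
    exact Or.inr ⟨Z, g, _, hinj.comp h1, (hP.polyBounded_degen m i).comp h2, fun x => by
      dsimp only
      rw [h3, Function.comp_apply]⟩

/-- The extra degeneracy followed by a structure map is tame. No compatibility with degeneracies is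
needed: those in the structure map are taken out on the left, where they are injective and
polynomially bounded, and the faces are moved past the extra degeneracy, until a face cancels it or
nothing but the extra degeneracy is left. -/
theorem isTame_map_extraDegeneracy (hP : IsTypeP Γ L) {t : ∀ n, Γ.obj (lower n) → Γ.obj (deg n)}
    (ht : IsExtraDegeneracy (fun X => Γ.obj X) (fun f => Γ.map f) t)
    (htP : ∀ n, PolyBounded (L (lower n)) (L (deg n)) (t n)) (N : ℕ) :
    ∀ m n : ℕ, m + n ≤ N → ∀ θ : SimplexCategory.mk m ⟶ SimplexCategory.mk n,
      IsTame Γ L fun x : Γ.obj (lower n) =>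
        Γ.map (simplexMap θ) (t n x) := by
  induction N with
  | zero =>
    intro m n hmn θ
    obtain rfl : m = 0 := by omega
    obtain rfl : n = 0 := by omega
    refine Or.inr ⟨_, 𝟙 _, t 0, ht.injective 0, htP 0, fun x => ?_⟩
    dsimp only
    rw [simplexMap_eq_totalDegen θ, totalDegen_zero, map_id_apply, map_id_apply]
  | succ N ih =>
    intro m n hmn θ
    by_cases hinj : Function.Injective θ.toOrderHom
    · by_cases hsurj : Function.Surjective θ.toOrderHom
      · obtain rfl : m = n := by
          have := Fintype.card_of_bijective ⟨hinj, hsurj⟩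
          simpa using this
        have : Mono θ := SimplexCategory.mono_iff_injective.2 hinj
        obtain rfl := SimplexCategory.eq_id_of_mono θ
        refine Or.inr ⟨_, 𝟙 _, t m, ht.injective m, htP m, fun x => ?_⟩
        dsimp only
        rw [simplexMap_id, map_id_apply, map_id_apply]
      · obtain ⟨n, rfl⟩ : ∃ n', n = n' + 1 := Nat.exists_eq_succ_of_ne_zero (by
          rintro rfl
          exact hsurj fun y => ⟨0, Subsingleton.elim (α := Fin 1) _ _⟩)
        obtain ⟨i, θ', rfl⟩ := SimplexCategory.eq_comp_δ_of_not_surjective θ hsurj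
        have hcomp : ∀ x : Γ.obj (deg (n + 1)),
            Γ.map (simplexMap (θ' ≫ SimplexCategory.δ i)) x =
              Γ.map (simplexMap θ') (Γ.map (face n i) x) := fun x => by
          rw [← map_comp_apply, simplexMap_comp, simplexMap_delta]
        simp only [hcomp]
        clear hcomp
        revert hmn
        refine Fin.lastCases (fun hmn => ?_) (fun i hmn => ?_) i
        · exact Or.inl ⟨simplexMap θ', fun x => by
            dsimp only
            rw [ht.face_last]⟩
        · simp only [ht.face_castSucc]
          exact (ih m n (by omega) θ').precomp (lowerFace n i)
    · obtain ⟨m, rfl⟩ : ∃ m', m = m' + 1 := Nat.exists_eq_succ_of_ne_zero (by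
        rintro rfl
        exact hinj fun x y _ => Subsingleton.elim (α := Fin 1) _ _)
      obtain ⟨i, θ', rfl⟩ := SimplexCategory.eq_σ_comp_of_not_injective θ hinj
      have hcomp : ∀ x : Γ.obj (deg n),
          Γ.map (simplexMap (SimplexCategory.σ i ≫ θ')) x =
            Γ.map (degen m i) (Γ.map (simplexMap θ') x) := fun x => by
        rw [← map_comp_apply, simplexMap_comp, simplexMap_sigma]
      simp only [hcomp]
      exact (ih m n (by omega) θ').degen hP i

theorem groupAlgMap_mapDomain {X Y Z : AugOp} (f : Y ⟶ Z) (φ : Γ.obj X → Γ.obj Y)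
    (a : MonoidAlgebra ℂ (Γ.obj X)) :
    groupAlgMap Γ f (MonoidAlgebra.mapDomainLinearMap ℂ ℂ φ a) =
      MonoidAlgebra.mapDomainLinearMap ℂ ℂ (fun x => Γ.map f (φ x)) a := by
  induction a using MonoidAlgebra.induction_linear with
  | zero => simp
  | add a b ha hb => simp only [map_add, ha, hb]
  | single x c => simp [groupAlgMap]

theorem mapDomain_groupAlgMap {X Y Z : AugOp} (f : X ⟶ Y) (φ : Γ.obj Y → Γ.obj Z)
    (a : MonoidAlgebra ℂ (Γ.obj X)) :
    MonoidAlgebra.mapDomainLinearMap ℂ ℂ φ (groupAlgMap Γ f a) =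
      MonoidAlgebra.mapDomainLinearMap ℂ ℂ (fun x => φ (Γ.map f x)) a := by
  induction a using MonoidAlgebra.induction_linear with
  | zero => simp
  | add a b ha hb => simp only [map_add, ha, hb]
  | single x c => simp [groupAlgMap]

theorem groupAlgMap_eq_mapDomain {X Y : AugOp} (f : X ⟶ Y) (a : MonoidAlgebra ℂ (Γ.obj X)) :
    groupAlgMap Γ f a = MonoidAlgebra.mapDomainLinearMap ℂ ℂ (fun x => Γ.map f x) a := by
  induction a using MonoidAlgebra.induction_linear with
  | zero => simp
  | add a b ha hb => simp only [map_add, ha, hb]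
  | single x c => simp [groupAlgMap]

theorem exists_eta_structureMap_le {X Y : AugOp} (f : X ⟶ Y) (j : ℕ) :
    ∃ (i : CMIndex X) (C : ℝ), 0 ≤ C ∧ ∀ a,
      eta (L Y) j (MonoidAlgebra.mapDomainLinearMap ℂ ℂ (fun x => Γ.map f x) a) ≤
        C * (cmFamily Γ L X).toFamily i a :=
  ⟨⟨Y, f, j⟩, 1, zero_le_one, fun a => by
    rw [one_mul, ← groupAlgMap_eq_mapDomain, cmFamily_apply]⟩

theorem IsTame.exists_eta_le (hP : IsTypeP Γ L) {X : AugOp} {m : ℕ}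
    {φ : Γ.obj X → Γ.obj (deg m)} (hφ : IsTame Γ L φ) (j : ℕ) :
    ∃ (i : CMIndex X) (C : ℝ), 0 ≤ C ∧ ∀ a,
      eta (L (deg m)) j (MonoidAlgebra.mapDomainLinearMap ℂ ℂ φ a) ≤
        C * (cmFamily Γ L X).toFamily i a := by
  rcases hφ with ⟨f, hf⟩ | ⟨Z, g, ψ, h1, h2, h3⟩
  · obtain rfl : φ = fun x => Γ.map f x := funext hf
    exact exists_eta_structureMap_le f j
  · obtain rfl : φ = fun x => ψ (Γ.map g x) := funext h3
    obtain ⟨C, k, hC, hle⟩ := exists_eta_mapDomain_le (hP.dominatesCancellation m) h1 h2 j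
    refine ⟨⟨Z, g, k⟩, C, hC, fun a => ?_⟩
    rw [← mapDomain_groupAlgMap, cmFamily_apply]
    exact hle _

/-- The extra degeneracy is bounded with respect to all the seminorms `η_j ∘ Γ(f)`. For `f` with
values in degree `-1` this is clear, because there `f` cancels the extra degeneracy. -/
theorem exists_cmFamily_extraDegeneracy_le (hP : IsTypeP Γ L)
    {t : ∀ n, Γ.obj (lower n) → Γ.obj (deg n)}
    (ht : IsExtraDegeneracy (fun X => Γ.obj X) (fun f => Γ.map f) t)
    (htP : ∀ n, PolyBounded (L (lower n)) (L (deg n)) (t n)) (n : ℕ) (i : CMIndex (deg n)) :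
    ∃ (i' : CMIndex (lower n)) (C : ℝ), 0 ≤ C ∧ ∀ a,
      (cmFamily Γ L (deg n)).toFamily i (MonoidAlgebra.mapDomainLinearMap ℂ ℂ (t n) a) ≤
        C * (cmFamily Γ L (lower n)).toFamily i' a := by
  obtain ⟨Y, f, j⟩ := i
  obtain ⟨m, rfl⟩ | rfl : (∃ m, Y = deg m) ∨ Y = degNegOne := by
    rcases Y with ⟨y | _⟩
    · exact Or.inl ⟨y.len, rfl⟩
    · exact Or.inr rfl
  · obtain ⟨θ, hθ⟩ := AugmentedSimplexCategory.inclusion.map_surjective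
      (X := SimplexCategory.mk m) (Y := SimplexCategory.mk n) f.unop
    obtain rfl : f = simplexMap θ := Quiver.Hom.unop_inj hθ.symm
    simp only [cmFamily_apply (Γ := Γ) (L := L) (X := deg n), groupAlgMap_mapDomain]
    exact (isTame_map_extraDegeneracy hP ht htP _ m n le_rfl θ).exists_eta_le hP j
  · obtain rfl : f = aug n := Quiver.Hom.unop_inj (WithInitial.starInitial.hom_ext _ _)
    simp only [cmFamily_apply (Γ := Γ) (L := L) (X := deg n), groupAlgMap_mapDomain]
    cases n with
    | zero =>
      have h := exists_eta_structureMap_le (Γ := Γ) (L := L) (𝟙 degNegOne) j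
      have h1 : (fun x => Γ.map (aug 0) (t 0 x)) = fun x => Γ.map (𝟙 degNegOne) x :=
        funext fun x => (ht.aug_zero x).trans (map_id_apply _ x).symm
      rw [h1]
      exact h
    | succ n =>
      have h := exists_eta_structureMap_le (Γ := Γ) (L := L) (aug n) j
      have h1 : (fun x => Γ.map (aug (n + 1)) (t (n + 1) x)) = fun x => Γ.map (aug n) x :=
        funext fun x => by
          dsimp only
          rw [← face_comp_aug n (Fin.last (n + 1)), map_comp_apply, ht.face_last]
      rw [h1]
      exact h

end Groups

/-! ### Complexes of resolution type -/

section Generic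

/-- A simplex with trivial faces is the last face of its image under the extra degeneracy, whose
other faces are trivial. -/
theorem IsExtraDegeneracy.isResolution {M : AugOp → Type u} [∀ X, AddCommGroup (M X)]
    {map : ∀ {X Y : AugOp}, (X ⟶ Y) → M X → M Y} {t : ∀ n, M (lower n) → M (deg n)}
    (h : IsExtraDegeneracy M map t)
    (map_comp : ∀ {X Y Z : AugOp} (f : X ⟶ Y) (g : Y ⟶ Z) x, map (f ≫ g) x = map g (map f x))
    (ht : ∀ n, t n 0 = 0) : IsResolution M map where
  surjective := fun x => ⟨t 0 x, h.aug_zero x⟩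
  pi_zero := fun x hx => by
    refine ⟨t 1 x, ?_, ?_, h.face_last 0 x⟩
    · rw [← face_comp_aug 0 (Fin.last 1), map_comp, h.face_last, hx]
    · refine (h.face_castSucc 0 0 x).trans ?_
      change t 0 (map (aug 0) x) = 0
      rw [hx, ht]
  pi_succ := fun n x hx hfx => by
    refine ⟨t (n + 2) x, ?_, fun i => ?_, h.face_last (n + 1) x⟩
    · rw [← face_comp_aug (n + 1) (Fin.last (n + 2)), map_comp, h.face_last, hx]
    · refine (h.face_castSucc (n + 1) i x).trans ?_
      change t (n + 1) (map (face n i) x) = 0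
      rw [hfx, ht]

variable {M : AugOp → Type u} [∀ X, AddCommGroup (M X)] [∀ X, Module ℂ (M X)]
  [∀ X, TopologicalSpace (M X)] {map : ∀ {X Y : AugOp}, (X ⟶ Y) → M X →L[ℂ] M Y}
  {t : ∀ n, M (lower n) →L[ℂ] M (deg n)}

/-- The transpose of a continuous linear extra degeneracy contracts the cochain complex of
continuous duals. -/
theorem IsExtraDegeneracy.isCoresolution_dual
    (h : IsExtraDegeneracy M (fun f => map f) fun n => t n) :
    IsCoresolution (fun X => M X →L[ℂ] ℂ) fun f => dualMap (map f) where
  injective := fun x y hxy => by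
    ext z
    have h1 := congrArg (fun x : M (deg 0) →L[ℂ] ℂ => x (t 0 z)) hxy
    change x (map (aug 0) (t 0 z)) = y (map (aug 0) (t 0 z)) at h1
    rwa [h.aug_zero] at h1
  exact_zero := fun x hx => by
    refine ⟨x.comp (t 0), ContinuousLinearMap.ext fun z => ?_⟩
    have h1 := congrArg (fun x : M (deg 1) →L[ℂ] ℂ => x (t 1 z)) hx
    change x (map (face 0 (Fin.castSucc 0)) (t 1 z)) = x (map (face 0 (Fin.last 1)) (t 1 z)) at h1
    rw [h.face_castSucc, h.face_last] at h1
    exact h1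
  exact_succ := fun n x hx => by
    refine ⟨(-1 : ℤ) ^ (n + 1) • x.comp (t (n + 1)), ContinuousLinearMap.ext fun z => ?_⟩
    have h1 := congrArg (fun x : M (deg (n + 2)) →L[ℂ] ℂ => x (t (n + 2) z)) hx
    simp only [sum_apply, smul_apply] at h1 ⊢
    change ∑ i : Fin (n + 3), (-1 : ℤ) ^ (i : ℕ) • x (map (face (n + 1) i) (t (n + 2) z)) = 0 at h1
    change ∑ i : Fin (n + 2), (-1 : ℤ) ^ (i : ℕ) •
      ((-1 : ℤ) ^ (n + 1) • x (t (n + 1) (map (face n i) z))) = x z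
    rw [Fin.sum_univ_castSucc, h.face_last] at h1
    simp only [h.face_castSucc] at h1
    have h2 := eq_neg_of_add_eq_zero_left h1
    simp only [smul_comm _ ((-1 : ℤ) ^ (n + 1))]
    rw [← Finset.smul_sum]
    refine (congrArg (fun w => (-1 : ℤ) ^ (n + 1) • w) h2).trans ?_
    have h3 : (-1 : ℤ) ^ (n + 1) * (-1) ^ (n + 2) = -1 := by
      rw [← pow_add, Odd.neg_one_pow ⟨n + 1, by ring⟩]
    simp only [Fin.val_last]
    rw [smul_neg, smul_smul, h3, neg_one_smul, neg_neg]

theorem IsExtraDegeneracy.tensorPow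
    (h : IsExtraDegeneracy M (fun f => map f) fun n => t n) (k : ℕ) :
    IsExtraDegeneracy (fun X => CompTensor (M X) k) (fun f => CMRes.tensorPow (map f) k)
      fun n => CMRes.tensorPow (t n) k where
  aug_zero := fun x => by
    rw [tensorPow_comp]
    exact tensorPow_of_forall_eq _ h.aug_zero x
  face_last := fun n x => by
    rw [tensorPow_comp]
    exact tensorPow_of_forall_eq _ (h.face_last n) x
  face_castSucc := fun n i x => tensorPow_comm (h.face_castSucc n i) x

end Generic

section HCM

variable {Γ : AugOp ⥤ GrpCat.{u}} {L : ∀ X, WordLength (Γ.obj X)}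

/-- The structure map of the completed simplicial group algebra, as a continuous linear map. -/
noncomputable def HCM.mapCLM {X Y : AugOp} (f : X ⟶ Y) : HCM Γ L X →L[ℂ] HCM Γ L Y :=
  { toLinearMap := (HCM.map Γ L f).toAlgHom.toLinearMap, cont := (HCM.map Γ L f).cont }

theorem IsTypeP.exists_extraDegeneracy_HCM (hP : IsTypeP Γ L) :
    ∃ t : ∀ n, HCM Γ L (lower n) →L[ℂ] HCM Γ L (deg n),
      IsExtraDegeneracy (fun X => HCM Γ L X) (fun f => HCM.mapCLM f) fun n => t n := by
  obtain ⟨t, ht, htP⟩ := hP.exists_extraDegeneracy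
  let t' : ∀ n, WithFamily (cmFamily Γ L (lower n)) →L[ℂ] WithFamily (cmFamily Γ L (deg n)) :=
    fun n =>
      { toLinearMap := (MonoidAlgebra.mapDomainLinearMap ℂ ℂ (t n) :
          MonoidAlgebra ℂ (Γ.obj (lower n)) →ₗ[ℂ] MonoidAlgebra ℂ (Γ.obj (deg n)))
        cont := by
          refine WithSeminorms.continuous_of_isBounded
            (withSeminorms_withFamily (cmFamily Γ L (lower n)))
            (withSeminorms_withFamily (cmFamily Γ L (deg n)))
            (MonoidAlgebra.mapDomainLinearMap ℂ ℂ (t n) :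
              MonoidAlgebra ℂ (Γ.obj (lower n)) →ₗ[ℂ] MonoidAlgebra ℂ (Γ.obj (deg n))) fun i => ?_
          obtain ⟨i', C, hC, hle⟩ := exists_cmFamily_extraDegeneracy_le hP ht htP n i
          refine ⟨{i'}, ⟨C, hC⟩, fun a => ?_⟩
          rw [Finset.sup_singleton]
          exact hle a }
  let T : ∀ n, HCM Γ L (lower n) →L[ℂ] HCM Γ L (deg n) := fun n => (t' n).completion
  have hT : ∀ n (a : MonoidAlgebra ℂ (Γ.obj (lower n))),
      T n (toFamilyCompletion (cmFamily Γ L (lower n)) a) =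
        toFamilyCompletion (cmFamily Γ L (deg n)) (MonoidAlgebra.mapDomainLinearMap ℂ ℂ (t n) a) :=
    fun n a => ContinuousLinearMap.completion_apply_coe (t' n) a
  have hmap : ∀ {X Y : AugOp} (f : X ⟶ Y) (a : MonoidAlgebra ℂ (Γ.obj X)),
      HCM.mapCLM f (toFamilyCompletion (cmFamily Γ L X) a) =
        toFamilyCompletion (cmFamily Γ L Y) (groupAlgMap Γ f a) := fun f a => HCM.map_coe f a
  have hid : ∀ {X : AugOp} (a : MonoidAlgebra ℂ (Γ.obj X)),
      MonoidAlgebra.mapDomainLinearMap ℂ ℂ (fun x => x) a = a := fun {X} a => by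
    rw [← groupAlgMap_id Γ X a, mapDomain_groupAlgMap, groupAlgMap_eq_mapDomain]
  refine ⟨T, ⟨fun x => ?_, fun n x => ?_, fun n i x => ?_⟩⟩
  · refine eq_of_forall_toFamilyCompletion
      ((HCM.mapCLM (aug 0)).continuous.comp (T 0).continuous) continuous_id (fun a => ?_) x
    rw [Function.comp_apply, hT, hmap, groupAlgMap_mapDomain, id,
      show (fun x => Γ.map (aug 0) (t 0 x)) = fun x => x from funext ht.aug_zero]
    exact congrArg _ (hid (X := degNegOne) a)
  · refine eq_of_forall_toFamilyCompletion
      ((HCM.mapCLM (face n (Fin.last (n + 1)))).continuous.comp (T (n + 1)).continuous)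
      continuous_id (fun a => ?_) x
    rw [Function.comp_apply, hT, hmap, groupAlgMap_mapDomain, id,
      show (fun x => Γ.map (face n (Fin.last (n + 1))) (t (n + 1) x)) = fun x => x from
        funext (ht.face_last n)]
    exact congrArg _ (hid (X := deg n) a)
  · refine eq_of_forall_toFamilyCompletion
      ((HCM.mapCLM (face n i.castSucc)).continuous.comp (T (n + 1)).continuous)
      ((T n).continuous.comp (HCM.mapCLM (lowerFace n i)).continuous) (fun a => ?_) x
    rw [Function.comp_apply, Function.comp_apply, hT, hmap, hmap, hT, groupAlgMap_mapDomain,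
      mapDomain_groupAlgMap]
    exact congrArg (fun φ => toFamilyCompletion (cmFamily Γ L (deg n))
      (MonoidAlgebra.mapDomainLinearMap ℂ ℂ φ a)) (funext (ht.face_castSucc n i))

theorem IsTypeP.exists_extraDegeneracy_CH (hP : IsTypeP Γ L) (k : ℕ) :
    ∃ t : ∀ n, CH (HCM Γ L (lower n)) k →L[ℂ] CH (HCM Γ L (deg n)) k,
      IsExtraDegeneracy (fun X => CH (HCM Γ L X) k) (fun f => CH.map (HCM.map Γ L f) k)
        fun n => t n := by
  obtain ⟨t, ht⟩ := hP.exists_extraDegeneracy_HCM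
  exact ⟨_, ht.tensorPow (k + 1)⟩

theorem IsTypeP.exists_extraDegeneracy_CC (hP : IsTypeP Γ L) (n : ℕ) :
    ∃ t : ∀ m, CC (HCM Γ L (lower m)) n →L[ℂ] CC (HCM Γ L (deg m)) n,
      IsExtraDegeneracy (fun X => CC (HCM Γ L X) n) (fun f => CC.map (HCM.map Γ L f) n)
        fun m => t m := by
  choose t ht using fun q : Fin (n + 1) => hP.exists_extraDegeneracy_CH (q : ℕ)
  exact ⟨fun m => ContinuousLinearMap.pi fun q => (t q m).comp
      (ContinuousLinearMap.proj (φ := fun q : Fin (n + 1) => CH (HCM Γ L (lower m)) q) q),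
    fun x => funext fun q => (ht q).aug_zero (x q),
    fun m x => funext fun q => (ht q).face_last m (x q),
    fun m i x => funext fun q => (ht q).face_castSucc m i (x q)⟩

variable (Γ L)

theorem isAugSimplicialComplex_CH : IsAugSimplicialComplex (fun X k => CH (HCM Γ L X) k)
    (fun X k => (hochB (HCM Γ L X) k).toLinearMap)
    (fun f k => (CH.map (HCM.map Γ L f) k).toLinearMap) where
  d_comp_d := fun _ _ x => hochB_hochB x
  map_id := fun X k x => tensorPow_of_forall_eq _ (HCM.map_id X) x
  map_comp := fun f g k x => by
    refine Eq.trans ?_ (tensorPow_comp (HCM.mapCLM (Γ := Γ) (L := L) g) (HCM.mapCLM f) x).symm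
    exact congrArg (fun φ => tensorPow φ (k + 1) x)
      (ContinuousLinearMap.ext fun y => HCM.map_comp f g y)
  map_d := fun f _ x => CH.map_hochB (HCM.map Γ L f) x

theorem isAugSimplicialComplex_CC : IsAugSimplicialComplex (fun X n => CC (HCM Γ L X) n)
    (fun X n => (cycD (HCM Γ L X) n).toLinearMap)
    (fun f n => (CC.map (HCM.map Γ L f) n).toLinearMap) where
  d_comp_d := fun _ _ x => cycD_cycD x
  map_id := fun X _ x => funext fun q => (isAugSimplicialComplex_CH Γ L).map_id X q (x q)
  map_comp := fun f g _ x =>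
    funext fun q => (isAugSimplicialComplex_CH Γ L).map_comp f g q (x q)
  map_d := fun f _ x => CC.map_cycD (HCM.map Γ L f) x

end HCM

/-- The continuous dual of an augmented simplicial complex. -/
theorem IsAugSimplicialComplex.dual {C : AugOp → ℕ → Type u} [∀ X k, AddCommGroup (C X k)]
    [∀ X k, Module ℂ (C X k)] [∀ X k, TopologicalSpace (C X k)]
    {d : ∀ X k, C X (k + 1) →L[ℂ] C X k} {map : ∀ {X Y : AugOp}, (X ⟶ Y) → ∀ k, C X k →L[ℂ] C Y k}
    (h : IsAugSimplicialComplex C (fun X k => (d X k).toLinearMap)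
      fun f k => (map f k).toLinearMap) :
    IsCoaugCosimplicialComplex (fun X k => C X k →L[ℂ] ℂ) (fun X k => dualMap (d X k))
      fun f k => dualMap (map f k) where
  d_comp_d := fun X k x => ContinuousLinearMap.ext fun z =>
    (congrArg x (h.d_comp_d X k z)).trans (map_zero x)
  map_id := fun X k x => ContinuousLinearMap.ext fun z => congrArg x (h.map_id X k z)
  map_comp := fun f g k x => ContinuousLinearMap.ext fun z => congrArg x (h.map_comp f g k z)
  map_d := fun f k x => ContinuousLinearMap.ext fun z => congrArg x (h.map_d f k z).symm

end CMRes

theorem mainTheorem4 (Γ : AugmentedSimplexCategoryᵒᵖ ⥤ GrpCat.{u})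
    (L : ∀ X, WordLength (Γ.obj X)) :
    ((∀ X, IsFrechetAlgebra (HCM Γ L X)) ∧
      (∀ X (x : HCM Γ L X), HCM.map Γ L (𝟙 X) x = x) ∧
      (∀ (X Y Z : AugmentedSimplexCategoryᵒᵖ) (f : X ⟶ Y) (g : Y ⟶ Z) (x : HCM Γ L X),
        HCM.map Γ L (f ≫ g) x = HCM.map Γ L g (HCM.map Γ L f x)) ∧
      (∀ (X Y : AugmentedSimplexCategoryᵒᵖ) (f : X ⟶ Y) (a : MonoidAlgebra ℂ (Γ.obj X)),
        HCM.map Γ L f (toFamilyCompletion (cmFamily Γ L X) a) =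
          toFamilyCompletion (cmFamily Γ L Y) (groupAlgMap Γ f a)) ∧
      (∃ e : HCM Γ L degNegOne ≃A[ℂ] CMAlgebra (L degNegOne),
        ∀ a, e (toFamilyCompletion (cmFamily Γ L degNegOne) a) =
          toFamilyCompletion (etaFamily (L degNegOne)) a) ∧
      (∃ Φ : CMAlgebra (L degNegOne) →ₐ[ℂ] Bdd (Γ.obj degNegOne),
        IsCMRealization (L degNegOne) (toFamilyCompletion (etaFamily (L degNegOne))) Φ)) ∧
    (IsTypeP Γ L →
      IsOfResolutionType (fun X k => CH (HCM Γ L X) k)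
        (fun X k => (hochB (HCM Γ L X) k).toLinearMap)
        (fun f k => (CH.map (HCM.map Γ L f) k).toLinearMap) ∧
      IsOfResolutionType (fun X n => CC (HCM Γ L X) n)
        (fun X n => (cycD (HCM Γ L X) n).toLinearMap)
        (fun f n => (CC.map (HCM.map Γ L f) n).toLinearMap) ∧
      IsOfCoresolutionType (fun X k => CH (HCM Γ L X) k →L[ℂ] ℂ)
        (fun X k => dualMap (hochB (HCM Γ L X) k))
        (fun f k => dualMap (CH.map (HCM.map Γ L f) k)) ∧
      IsOfCoresolutionType (fun X n => CC (HCM Γ L X) n →L[ℂ] ℂ)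
        (fun X n => dualMap (cycD (HCM Γ L X) n))
        (fun f n => dualMap (CC.map (HCM.map Γ L f) n))) := by
  refine ⟨⟨isFrechetAlgebra_HCM Γ L, HCM.map_id, fun _ _ _ => HCM.map_comp,
    fun _ _ => HCM.map_coe, exists_HCM_degNegOne_equiv, _, isCMRealization_leftRegExt⟩,
    fun hP => ⟨⟨isAugSimplicialComplex_CH Γ L, fun k => ?_⟩,
      ⟨isAugSimplicialComplex_CC Γ L, fun n => ?_⟩,
      ⟨(isAugSimplicialComplex_CH Γ L).dual, fun k => ?_⟩,
      ⟨(isAugSimplicialComplex_CC Γ L).dual, fun n => ?_⟩⟩⟩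
  · obtain ⟨t, ht⟩ := hP.exists_extraDegeneracy_CH k
    exact ht.isResolution (fun f g => (isAugSimplicialComplex_CH Γ L).map_comp f g k)
      fun m => map_zero (t m)
  · obtain ⟨t, ht⟩ := hP.exists_extraDegeneracy_CC n
    exact ht.isResolution (fun f g => (isAugSimplicialComplex_CC Γ L).map_comp f g n)
      fun m => map_zero (t m)
  · obtain ⟨t, ht⟩ := hP.exists_extraDegeneracy_CH k
    exact ht.isCoresolution_dual
  · obtain ⟨t, ht⟩ := hP.exists_extraDegeneracy_CC n
    exact ht.isCoresolution_dual
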